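/- **Setting.** Let $d\in\{2,3\}$ and let $\Omega\subset\mathbb R^d$ be a polygonal or polyhedral domain (a bounded, connected, open, nonempty set with Lipschitz boundary $\Gamma=\partial\Omega$ contained in finitely many hyperplanes; convexity is not assumed), and let $\Gamma_1,\dots,\Gamma_N$ be its open plane facets. Let $Y_0=H^1_0(\Omega)^d$, $Q=L^2_0(\Omega)$ (mean value zero), let $(\cdot,\cdot)$ be the $L^2(\Omega)$ scalar products, and let $H^s(\Omega)$, $H^s(\Gamma)$ be the Sobolev(–Slobodeckij) spaces. Let $\tilde H^t(\Gamma)=H^t(\Gamma)$ if $t\in[0,1]$, $\tilde H^t(\Gamma)=C(\Gamma)\cap\prod_jH^t(\Gamma_j)$ if $t>1$, and $\|v\|_{\tilde H^t(\Gamma)}=\sum_{j}\|v\|_{H^t(\Gamma_j)}$. *Weak solution.* For boundary data $u$, let $(y,p)\in H^1(\Omega)^d\times Q$ with $y|_\Gamma=u$ satisfy $$(\nabla y,\nabla v)-(\nabla\cdot v,p)=0\ \ \forall v\in Y_0,\qquad (\nabla\cdot y,q)=0\ \ \forall q\in Q .$$ *Discretization.* For a parameter $h>0$ let $Y_h\subset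 H^1(\Omega)^d$ and $Q_h\subset Q$ be finite-dimensional subspaces, and put $Y_{0h}=\{v_h\in Y_h: v_h|_\Gamma=0\}$, $Y_h^\partial=Y_h|_\Gamma$, $\tilde Q_h=Q_h\oplus\mathcal P_0(\Omega)$ with $\mathcal P_0(\Omega)$ the constants. For $u_h\in Y_h^\partial$ let $(y_h,p_h)\in Y_h\times Q_h$ with $y_h|_\Gamma=u_h$ satisfy $$(\nabla y_h,\nabla v_h)-(\nabla\cdot v_h,p_h)=0\ \ \forall v_h\in Y_{0h},\qquad (\nabla\cdot y_h,q_h)=0\ \ \forall q_h\in Q_h .$$ *Assumptions.* There are constants $\alpha>0$, $c_1>0$, $c_A(r)$ ($r\ge 0$) and a number $k\in\mathbb N$, all independent of $h$, such that (A1) $\displaystyle\sup_{v_h\in Y_{0h}\setminus\{0\}}\frac{(\nabla\cdot v_h,q_h)}{\|\nabla v_h\|_{L^2(\Omega)^{d\times d}}}\ge\alpha\|q_h\|_{L^2(\Omega)}$ for all $q_h\in Q_h$; (A2) for all real $r\ge0$: $\displaystyle\inf_{v_h\in Y_h}\|v-v_h\|_{H^1(\Omega)^d}\le c_A(r)\,h^{\min(k,r)}\|v\|_{H^{r+1}(\Omega)^d}$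 for all $v\in H^{r+1}(\Omega)^d$, and $\displaystyle\inf_{\tilde q_h\in\tilde Q_h}\|q-\tilde q_h\|_{L^2(\Omega)}\le c_A(r)\,h^{\min(k,r)}\|q\|_{H^r(\Omega)}$ for all $q\in H^r(\Omega)$; (A3) $\displaystyle\inf_{\varphi_h\in Y_h,\ \varphi_h|_\Gamma=g_h}\|\nabla\varphi_h\|_{L^2(\Omega)^{d\times d}}\le c_1\|g_h\|_{H^{1/2}(\Gamma)^d}$ for all $g_h\in Y_h^\partial$. **Theorem (error estimates in the energy norm).** Let $t\ge\frac12$ and $c_2\in\mathbb R$. There is a constant $C>0$, depending only on $\Omega$, $k$, $t$, $\alpha$, $c_1$, $c_2$ and $c_A$ (in particular not on $h$, $Y_h$, $Q_h$ or on the data and solutions), such that the following holds whenever (A1)–(A3) hold and $y\in H^{t+\frac12}(\Omega)^d$, $p\in H^{t-\frac12}(\Omega)$, $u\in\tilde H^t(\Gamma)^d$. (i) If $\|u-u_h\|_{H^{1/2}(\Gamma)^d}\le c_2\,h^{\min(t-\frac12,k)}\|u\|_{\tilde H^t(\Gamma)^d}$, then $$\|\nabla(y-y_h)\|_{L^2(\Omega)^{d\times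 d}}+\|p-p_h\|_{L^2(\Omega)}\le C\,h^{\min(t-\frac12,k)}\bigl(\|y\|_{H^{t+\frac12}(\Omega)^d}+\|p\|_{H^{t-\frac12}(\Omega)}+\|u\|_{\tilde H^t(\Gamma)^d}\bigr).$$ (ii) If $u_h=u$, then $$\|\nabla(y-y_h)\|_{L^2(\Omega)^{d\times d}}+\|p-p_h\|_{L^2(\Omega)}\le C\,h^{\min(t-\frac12,k)}\bigl(\|y\|_{H^{t+\frac12}(\Omega)^d}+\|p\|_{H^{t-\frac12}(\Omega)}\bigr).$$ -/

import Mathlib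

open MeasureTheory Set Filter Topology
open scoped ENNReal ContDiff

noncomputable section

namespace Stokes

/-- Euclidean space `ℝⁿ` with the Euclidean norm. -/
abbrev E (n : ℕ) : Type := EuclideanSpace ℝ (Fin n)

section Sobolev

variable {F : Type*} [NormedAddCommGroup F] [NormedSpace ℝ F]

/-- `w` is the weak (distributional) derivative `∂_{I 0} ⋯ ∂_{I (j-1)} v` on the open set `Ω`:
`∫_Ω (∂_I φ) v = (-1)^j ∫_Ω φ w` for all test functions `φ ∈ C_c^∞(Ω)`. -/
def IsWeakDeriv {n j : ℕ} (Ω : Set (E n)) (I : Fin j → Fin n) (v w : E n → F) : Prop :=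
  LocallyIntegrableOn v Ω volume ∧ LocallyIntegrableOn w Ω volume ∧
    ∀ φ : E n → ℝ, ContDiff ℝ ∞ φ → HasCompactSupport φ → tsupport φ ⊆ Ω →
      ∫ x in Ω, (iteratedFDeriv ℝ j φ x fun i => EuclideanSpace.single (I i) (1 : ℝ)) • v x
        = (-1 : ℝ) ^ j • ∫ x in Ω, φ x • w x

/-- The squared Gagliardo (Sobolev–Slobodeckij) seminorm of order `θ ∈ (0,1)` with respect to a
measure `μ` on an `m`-dimensional set:
`∬ ‖f x - f y‖² / |x - y|^(m + 2θ) dμ(y) dμ(x)`. -/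
def eGagliardoSq {n : ℕ} (m : ℕ) (θ : ℝ) (μ : Measure (E n)) (f : E n → F) : ℝ≥0∞ :=
  ∫⁻ x, ∫⁻ y, ‖f x - f y‖ₑ ^ 2 / edist x y ^ ((m : ℝ) + 2 * θ) ∂μ ∂μ

/-- The norm of `H^s(Ω)`, `s ≥ 0`, with value `∞` for functions that are not in `H^s(Ω)`:
with `m = ⌊s⌋` and `θ = s - m`, its square is the sum of the `‖∂_I v‖²_{L²(Ω)}` over all weak
derivatives of order at most `m`, and, if `θ > 0`, of the squared Gagliardo seminorms of order `θ`
of the weak derivatives of order `m`. (Weak derivatives are a.e. unique, so each infimum is the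
value at the weak derivative, or `∞` if there is none. Derivatives are indexed by tuples, i.e.
`|∇^j v|` is the Frobenius norm of the tensor of `j`-th derivatives.) -/
def eSobolevNorm {n : ℕ} (s : ℝ) (Ω : Set (E n)) (v : E n → F) : ℝ≥0∞ :=
  ((∑ j ∈ Finset.range (⌊s⌋₊ + 1), ∑ I : Fin j → Fin n,
      ⨅ (w : E n → F) (_ : IsWeakDeriv Ω I v w), ∫⁻ x in Ω, ‖w x‖ₑ ^ 2)
    + if s = ⌊s⌋₊ then 0 else
        ∑ I : Fin ⌊s⌋₊ → Fin n, ⨅ (w : E n → F) (_ : IsWeakDeriv Ω I v w),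
          eGagliardoSq n (s - ⌊s⌋₊) (volume.restrict Ω) w) ^ (1 / 2 : ℝ)

/-- `v ∈ H^s(Ω)`. -/
def MemSobolev {n : ℕ} (s : ℝ) (Ω : Set (E n)) (v : E n → F) : Prop :=
  eSobolevNorm s Ω v < ⊤

/-- `‖v‖_{H^s(Ω)}` as a real number, for `v ∈ H^s(Ω)`. -/
def sobolevNorm {n : ℕ} (s : ℝ) (Ω : Set (E n)) (v : E n → F) : ℝ :=
  (eSobolevNorm s Ω v).toReal

end Sobolev

section Domain

variable {d : ℕ}

/-- In the ball `B(x, r)` the set `Ω` is the subgraph of the Lipschitz function `φ`, with respect to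
the Cartesian coordinates given by the isometry `L : ℝ^(d-1) → ℝ^d` and the unit vector `ν` normal
to its range. -/
def IsLipschitzChart (Ω : Set (E d)) (L : E (d - 1) →ₗᵢ[ℝ] E d) (ν : E d) (φ : E (d - 1) → ℝ)
    (x : E d) (r : ℝ) : Prop :=
  ‖ν‖ = 1 ∧ (∀ a, inner ℝ (L a) ν = 0) ∧ (∃ K, LipschitzWith K φ) ∧
    ∀ (a : E (d - 1)) (s : ℝ), L a + s • ν ∈ Metric.ball x r → (L a + s • ν ∈ Ω ↔ s < φ a)

/-- Polygonal (`d = 2`) or polyhedral (`d = 3`) domain: a nonempty bounded connected open set with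
Lipschitz boundary, the boundary being contained in finitely many hyperplanes. -/
structure IsPolyhedralDomain (Ω : Set (E d)) : Prop where
  isOpen : IsOpen Ω
  isConnected : IsConnected Ω
  isBounded : Bornology.IsBounded Ω
  lipschitz : ∀ x ∈ frontier Ω, ∃ (L : E (d - 1) →ₗᵢ[ℝ] E d) (ν : E d) (φ : E (d - 1) → ℝ) (r : ℝ),
    0 < r ∧ IsLipschitzChart Ω L ν φ x r
  flat : ∃ S : Finset (E d × ℝ), (∀ q ∈ S, q.1 ≠ 0) ∧
    frontier Ω ⊆ {x | ∃ q ∈ S, inner ℝ q.1 x = q.2}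

/-- The points of `Γ = ∂Ω` near which `Γ` is a piece of a hyperplane. -/
def flatPart (Ω : Set (E d)) : Set (E d) :=
  {x | x ∈ frontier Ω ∧ ∃ (ν : E d) (r : ℝ), ν ≠ 0 ∧ 0 < r ∧
    ∀ z ∈ Metric.ball x r, (z ∈ frontier Ω ↔ inner ℝ ν (z - x) = 0)}

/-- The (relatively open) plane facets `Γ_j` of `Γ`: the connected components of its flat part. -/
def facets (Ω : Set (E d)) : Set (Set (E d)) :=
  {G | ∃ x ∈ flatPart Ω, G = connectedComponentIn (flatPart Ω) x}

/-- The surface measure of `Γ = ∂Ω`. -/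
def surfaceMeasure (Ω : Set (E d)) : Measure (E d) :=
  (Measure.euclideanHausdorffMeasure (d - 1)).restrict (frontier Ω)

end Domain

section Spaces

variable {d : ℕ}

/-- `L²(Ω)`. -/
abbrev L2 (Ω : Set (E d)) : Type := Lp ℝ 2 (volume.restrict Ω)

/-- `L²(Ω)^d`. -/
abbrev L2vec (Ω : Set (E d)) : Type := Lp (E d) 2 (volume.restrict Ω)

/-- `L²(Γ)^d`, `Γ = ∂Ω`. -/
abbrev L2bdry (Ω : Set (E d)) : Type := Lp (E d) 2 (surfaceMeasure Ω)

/-- `Q = L²_0(Ω)`, as a set. -/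
def L20 (Ω : Set (E d)) : Set (L2 Ω) := {q | ∫ x in Ω, q x = 0}

/-- The weak partial derivative `∂_k v` on `Ω` (a function; `0` if there is none). -/
def pd (Ω : Set (E d)) (k : Fin d) (v : E d → E d) : E d → E d :=
  open Classical in if h : ∃ w, IsWeakDeriv Ω (fun _ : Fin 1 => k) v w then h.choose else 0

/-- `(∇v, ∇w)`, the scalar product of `L²(Ω)^{d×d}`. -/
def gradInner (Ω : Set (E d)) (v w : L2vec Ω) : ℝ :=
  ∑ k, ∫ x in Ω, inner ℝ (pd Ω k v x) (pd Ω k w x)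

/-- `‖∇v‖_{L²(Ω)^{d×d}}`. -/
def gradNorm (Ω : Set (E d)) (v : L2vec Ω) : ℝ := √(gradInner Ω v v)

/-- `(∇·v, q)`, the scalar product of `L²(Ω)`. -/
def divInner (Ω : Set (E d)) (v : L2vec Ω) (q : L2 Ω) : ℝ :=
  ∫ x in Ω, (∑ k, pd Ω k v x k) * q x

/-- `v|_Γ = g`: the trace operator is the continuous extension to `H^1(Ω)` of the restriction of
functions that are smooth up to the boundary. -/
def IsTrace (Ω : Set (E d)) (v : L2vec Ω) (g : L2bdry Ω) : Prop :=
  ∃ φ : ℕ → E d → E d, (∀ n, ContDiff ℝ ∞ (φ n)) ∧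
    Tendsto (fun n => eSobolevNorm 1 Ω (fun x => φ n x - v x)) atTop (𝓝 0) ∧
    Tendsto (fun n => eLpNorm (fun x => φ n x - g x) 2 (surfaceMeasure Ω)) atTop (𝓝 0)

/-- `Y_0 = H^1_0(Ω)^d`, the functions in `H^1(Ω)^d` that vanish on `Γ`. -/
def Y0 (Ω : Set (E d)) : Set (L2vec Ω) := {v | MemSobolev 1 Ω v ∧ IsTrace Ω v 0}

/-- The norm of `H^s(Γ)^d`, `0 ≤ s < 1`, with value `∞` for functions not in that space:
`‖g‖²_{L²(Γ)}` plus, if `s > 0`, the squared Gagliardo seminorm on `Γ × Γ`, and the root of it. -/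
def eBdryNorm (s : ℝ) (Ω : Set (E d)) (g : L2bdry Ω) : ℝ≥0∞ :=
  ((∫⁻ x, ‖g x‖ₑ ^ 2 ∂(surfaceMeasure Ω))
    + if s = 0 then 0 else eGagliardoSq (d - 1) s (surfaceMeasure Ω) g) ^ (1 / 2 : ℝ)

/-- `‖g‖_{H^{1/2}(Γ)^d}`. -/
def hHalfNorm (Ω : Set (E d)) (g : L2bdry Ω) : ℝ := (eBdryNorm (1 / 2) Ω g).toReal

/-- `g ∈ H^s(Γ)^d`, `0 ≤ s ≤ 1`. For `s = 1` this means that `g` is in `H^1` in all local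
Lipschitz parametrizations `a ↦ L a + φ(a) ν` of `Γ`. -/
def MemBdrySobolev (s : ℝ) (Ω : Set (E d)) (g : L2bdry Ω) : Prop :=
  if s < 1 then eBdryNorm s Ω g < ⊤
  else ∀ (L : E (d - 1) →ₗᵢ[ℝ] E d) (ν : E d) (φ : E (d - 1) → ℝ) (x : E d) (r : ℝ),
    x ∈ frontier Ω → 0 < r → IsLipschitzChart Ω L ν φ x r →
      MemSobolev 1 {a | L a + φ a • ν ∈ Metric.ball x r} (fun a => g (L a + φ a • ν))

/-- The norm of `H^t(G)^d` for a plane facet `G`, with value `∞` for functions not in that space: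
the `H^t`-norm in Cartesian coordinates of the hyperplane of `G`. (The norm does not depend on the
choice of these coordinates, so the infimum is over equal values.) -/
def eFacetNorm (t : ℝ) (G : Set (E d)) (g : E d → E d) : ℝ≥0∞ :=
  ⨅ (ψ : E (d - 1) →ᵃⁱ[ℝ] E d) (_ : G ⊆ range ψ), eSobolevNorm t (ψ ⁻¹' G) (g ∘ ψ)

/-- `g ∈ H̃^t(Γ)^d`: this is `H^t(Γ)^d` for `t ≤ 1`, and for `t > 1` the space of functions that are
continuous on `Γ` and in `H^t` on each facet. -/
def MemHTilde (t : ℝ) (Ω : Set (E d)) (g : L2bdry Ω) : Prop :=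
  if t ≤ 1 then MemBdrySobolev t Ω g
  else (∃ g' : E d → E d, ContinuousOn g' (frontier Ω) ∧ g =ᵐ[surfaceMeasure Ω] g') ∧
    ∀ G ∈ facets Ω, eFacetNorm t G g < ⊤

/-- `‖g‖_{H̃^t(Γ)^d} = ∑_j ‖g‖_{H^t(Γ_j)^d}`. -/
def hTildeNorm (t : ℝ) (Ω : Set (E d)) (g : L2bdry Ω) : ℝ :=
  (∑' G : facets Ω, eFacetNorm t (G : Set (E d)) g).toReal

end Spaces

section Problems

variable {d : ℕ}

/-- `(y, p)` is the weak solution of the Stokes problem with boundary datum `u`. -/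
structure IsWeakSolution (Ω : Set (E d)) (u : L2bdry Ω) (y : L2vec Ω) (p : L2 Ω) : Prop where
  mem_H1 : MemSobolev 1 Ω y
  trace : IsTrace Ω y u
  mem_Q : p ∈ L20 Ω
  momentum : ∀ v ∈ Y0 Ω, gradInner Ω y v - divInner Ω v p = 0
  continuity : ∀ q ∈ L20 Ω, divInner Ω y q = 0

/-- `Y_h` and `Q_h` are finite-dimensional subspaces of `H^1(Ω)^d` and `L²_0(Ω)`. -/
structure IsConforming (Ω : Set (E d)) (Yh : Submodule ℝ (L2vec Ω)) (Qh : Submodule ℝ (L2 Ω)) :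
    Prop where
  finite_Y : FiniteDimensional ℝ Yh
  finite_Q : FiniteDimensional ℝ Qh
  mem_H1 : ∀ v ∈ Yh, MemSobolev 1 Ω v
  mem_Q : ∀ q ∈ Qh, q ∈ L20 Ω

/-- `Y_{0h} = {v ∈ Y_h : v|_Γ = 0}`. -/
def Y0h (Ω : Set (E d)) (Yh : Submodule ℝ (L2vec Ω)) : Set (L2vec Ω) :=
  {v | v ∈ Yh ∧ IsTrace Ω v 0}

/-- `Y_h^∂ = Y_h|_Γ`. -/
def YhBdry (Ω : Set (E d)) (Yh : Submodule ℝ (L2vec Ω)) : Set (L2bdry Ω) :=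
  {g | ∃ v ∈ Yh, IsTrace Ω v g}

/-- `Q̃_h = Q_h ⊕ P_0(Ω)`. -/
def QhTilde (Ω : Set (E d)) (Qh : Submodule ℝ (L2 Ω)) : Set (L2 Ω) :=
  {q | ∃ qh ∈ Qh, ∃ c : ℝ, ∀ᵐ x ∂(volume.restrict Ω), q x = qh x + c}

/-- `(y_h, p_h)` is the discrete solution with discrete boundary datum `u_h`. -/
structure IsDiscreteSolution (Ω : Set (E d)) (Yh : Submodule ℝ (L2vec Ω)) (Qh : Submodule ℝ (L2 Ω))
    (uh : L2bdry Ω) (yh : L2vec Ω) (ph : L2 Ω) : Prop where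
  mem_Y : yh ∈ Yh
  trace : IsTrace Ω yh uh
  mem_Q : ph ∈ Qh
  momentum : ∀ v ∈ Y0h Ω Yh, gradInner Ω yh v - divInner Ω v ph = 0
  continuity : ∀ q ∈ Qh, divInner Ω yh q = 0

/-- The discrete inf-sup condition with constant `α`. -/
def InfSup (Ω : Set (E d)) (Yh : Submodule ℝ (L2vec Ω)) (Qh : Submodule ℝ (L2 Ω)) (α : ℝ) : Prop :=
  ∀ q ∈ Qh, α * ‖q‖ ≤ ⨆ v : {v // v ∈ Y0h Ω Yh ∧ v ≠ 0}, divInner Ω v.1 q / gradNorm Ω v.1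

/-- The approximation properties of order `k` of `Y_h` and `Q̃_h` for the parameter `h`;
the constant `c r` may depend on the regularity index `r`. -/
def ApproxProperty (Ω : Set (E d)) (Yh : Submodule ℝ (L2vec Ω)) (Qh : Submodule ℝ (L2 Ω))
    (h : ℝ) (k : ℕ) (c : ℝ → ℝ) : Prop :=
  ∀ r : ℝ, 0 ≤ r →
    (∀ v : L2vec Ω, MemSobolev (r + 1) Ω v →
      ⨅ vh : Yh, sobolevNorm 1 Ω (v - vh.1 : L2vec Ω) ≤
        c r * h ^ min (k : ℝ) r * sobolevNorm (r + 1) Ω v) ∧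
    (∀ q : L2 Ω, MemSobolev r Ω q →
      ⨅ qh : QhTilde Ω Qh, ‖q - qh.1‖ ≤ c r * h ^ min (k : ℝ) r * sobolevNorm r Ω q)

/-- The discrete extension property of `Y_h` with constant `c₁`. -/
def DiscreteExtension (Ω : Set (E d)) (Yh : Submodule ℝ (L2vec Ω)) (c₁ : ℝ) : Prop :=
  ∀ uh ∈ YhBdry Ω Yh,
    ⨅ φ : {φ // φ ∈ Yh ∧ IsTrace Ω φ uh}, gradNorm Ω φ.1 ≤ c₁ * hHalfNorm Ω uh

end Problems

end Stokes

end

noncomputable section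

namespace Stokes

/-! The core is a Brezzi-type quasi-optimality argument. Take any v_h ∈ Y_h, with trace g_h, and any
q_h ∈ Q_h. Then u_h - g_h is the trace of y_h - v_h ∈ Y_h, so (A3) provides φ_h ∈ Y_h with this
trace and with gradient essentially bounded by c₁‖u_h - g_h‖_{1/2}. The latter is controlled by ‖u -
g_h‖_{1/2} and ‖u - u_h‖_{1/2}, and the trace theorem bounds the first of these by ‖y - v_h‖_{H¹}.

Now v_h + φ_h has the boundary values of y_h, and the inf-sup condition yields w_h ∈ Y_{0h} that
repairs its discrete divergence (`AbstractInfSup.exists_correction`). The difference e_h = v_h + φ_h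
+ w_h - y_h lies in Y_{0h} and is orthogonal in divergence to Q_h. Testing both momentum equations
with e_h therefore removes p_h and leaves only p - q_h. This bounds the velocity error, and a second
use of the inf-sup condition bounds the pressure error (`AbstractInfSup.energy_estimate`). Constants
added to q_h cannot improve the approximation of the mean-free p (`norm_sub_le_of_mem_QhTilde`), so
(A2) applies with r = t - 1/2 and gives the rate.

The longest part is the trace theorem H¹(Ω) → H^{1/2}(Γ). Traces are defined by smooth
approximation, so a trace of v_h has to be produced as well as bounded. Density of smooth functions
comes from a partition of unity and mollifiers whose supports are shifted so that they sample only
points of Ω. The bound is Gagliardo's: two boundary points with parameters at distance r are joined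
by going down to depth r, across, and up again. The vertical pieces are handled by Hardy's
inequality, the horizontal one by Tonelli and translation invariance. Local estimates in Lipschitz
charts are glued by a Lebesgue number of the covering, and Fatou's lemma carries the bound to H¹. -/

theorem ennreal_add_sq_le (a b : ℝ≥0∞) : (a + b) ^ 2 ≤ 2 * (a ^ 2 + b ^ 2) := by
  have := ENNReal.rpow_add_le_mul_rpow_add_rpow a b (p := 2) (by norm_num)
  norm_num at this
  exact this

/-! ### Square integrals and the L² norm -/

section MemLpTwo

variable {F : Type*} [NormedAddCommGroup F]

theorem memLp_two_of_lintegral_lt_top {X : Type*} [MeasurableSpace X] {μ : Measure X} {f : X → F}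
    (hf : AEStronglyMeasurable f μ) (h : ∫⁻ x, ‖f x‖ₑ ^ 2 ∂μ < ⊤) : MemLp f 2 μ := by
  refine ⟨hf, ?_⟩
  rw [eLpNorm_eq_lintegral_rpow_enorm_toReal (by simp) (by simp)]
  simp only [ENNReal.toReal_ofNat, ENNReal.rpow_ofNat]
  exact ENNReal.rpow_lt_top_of_nonneg (by norm_num) h.ne

theorem eLpNorm_two_sq {X : Type*} [MeasurableSpace X] {μ : Measure X} (f : X → F) :
    eLpNorm f 2 μ ^ 2 = ∫⁻ x, ‖f x‖ₑ ^ 2 ∂μ := by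
  rw [eLpNorm_eq_lintegral_rpow_enorm_toReal (by simp) (by simp), ← ENNReal.rpow_natCast,
    ← ENNReal.rpow_mul]
  simp

theorem lintegral_enorm_add_sq_le {X : Type*} [MeasurableSpace X] {μ : Measure X} {f g : X → F}
    (hf : AEStronglyMeasurable f μ) :
    ∫⁻ x, ‖f x + g x‖ₑ ^ 2 ∂μ ≤ 2 * (∫⁻ x, ‖f x‖ₑ ^ 2 ∂μ) + 2 * ∫⁻ x, ‖g x‖ₑ ^ 2 ∂μ := by
  rw [← lintegral_const_mul' 2 _ (by simp), ← lintegral_const_mul' 2 _ (by simp),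
    ← lintegral_add_left' ((hf.enorm.pow_const 2).const_mul 2)]
  refine lintegral_mono fun x => ?_
  calc ‖f x + g x‖ₑ ^ 2 ≤ (‖f x‖ₑ + ‖g x‖ₑ) ^ 2 := by gcongr; exact enorm_add_le _ _
    _ ≤ 2 * ‖f x‖ₑ ^ 2 + 2 * ‖g x‖ₑ ^ 2 := by
      rw [← mul_add]
      exact ennreal_add_sq_le _ _

end MemLpTwo

/-! ### Calculus of weak derivatives and the norm of H¹ -/

section WeakDerivative

variable {F : Type*} [NormedAddCommGroup F] [NormedSpace ℝ F]

/-- Local integrability on Ω suffices because only the compact set `tsupport φ` inside Ω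
contributes. This makes both sides of the defining identity of a weak derivative genuine integrals,
hence additive. -/
theorem integrableOn_smul_of_tsupport_subset {n : ℕ} {Ω : Set (E n)} {v : E n → F}
    (hv : LocallyIntegrableOn v Ω volume) {φ : E n → ℝ} (hφ : Continuous φ)
    (hc : HasCompactSupport φ) (hs : tsupport φ ⊆ Ω) :
    IntegrableOn (fun x => φ x • v x) Ω volume := by
  have h1 : IntegrableOn (fun x => φ x • v x) (tsupport φ) volume :=
    (hv.integrableOn_compact_subset hs hc).continuousOn_smul hφ.continuousOn hc
  have h2 : Integrable (fun x => φ x • v x) volume := by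
    refine (integrableOn_iff_integrable_of_support_subset ?_).1 h1
    exact (Function.support_smul_subset_left φ v).trans subset_closure
  exact h2.integrableOn

theorem IsWeakDeriv.congr {n j : ℕ} {Ω : Set (E n)} {I : Fin j → Fin n} {v v' w w' : E n → F}
    (h : IsWeakDeriv Ω I v w) (hv : v =ᵐ[volume.restrict Ω] v')
    (hw : w =ᵐ[volume.restrict Ω] w') : IsWeakDeriv Ω I v' w' := by
  refine ⟨h.1.congr hv, h.2.1.congr hw, fun φ h1 h2 h3 => ?_⟩
  have e1 : ∫ x in Ω, (iteratedFDeriv ℝ j φ x fun i => EuclideanSpace.single (I i) (1 : ℝ)) • v' x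
      = ∫ x in Ω, (iteratedFDeriv ℝ j φ x fun i => EuclideanSpace.single (I i) (1 : ℝ)) • v x :=
    integral_congr_ae (by filter_upwards [hv] with x hx; rw [hx])
  have e2 : ∫ x in Ω, φ x • w' x = ∫ x in Ω, φ x • w x :=
    integral_congr_ae (by filter_upwards [hw] with x hx; rw [hx])
  rw [e1, e2, h.2.2 φ h1 h2 h3]

theorem iteratedFDeriv_test {n j : ℕ} {Ω : Set (E n)} (m : Fin j → E n) {φ : E n → ℝ}
    (h1 : ContDiff ℝ ∞ φ) (h2 : HasCompactSupport φ) (h3 : tsupport φ ⊆ Ω) :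
    Continuous (fun x => iteratedFDeriv ℝ j φ x m) ∧
      HasCompactSupport (fun x => iteratedFDeriv ℝ j φ x m) ∧
      tsupport (fun x => iteratedFDeriv ℝ j φ x m) ⊆ Ω := by
  have hsub : tsupport (fun x => iteratedFDeriv ℝ j φ x m) ⊆ tsupport φ := by
    refine closure_minimal (fun x hx => ?_) isClosed_closure
    refine support_iteratedFDeriv_subset (𝕜 := ℝ) j ?_
    intro h0
    apply hx
    simp [h0]
  refine ⟨?_, h2.of_isClosed_subset isClosed_closure hsub, hsub.trans h3⟩
  have := h1.continuous_iteratedFDeriv (m := j) (by exact_mod_cast le_top)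
  fun_prop

theorem IsWeakDeriv.add {n j : ℕ} {Ω : Set (E n)} {I : Fin j → Fin n} {v v' w w' : E n → F}
    (h : IsWeakDeriv Ω I v w) (h' : IsWeakDeriv Ω I v' w') :
    IsWeakDeriv Ω I (fun x => v x + v' x) (fun x => w x + w' x) := by
  refine ⟨h.1.add h'.1, h.2.1.add h'.2.1, fun φ h1 h2 h3 => ?_⟩
  obtain ⟨a1, a2, a3⟩ := iteratedFDeriv_test (fun i => EuclideanSpace.single (I i) (1 : ℝ)) h1 h2 h3
  simp only [smul_add]
  rw [integral_add (integrableOn_smul_of_tsupport_subset h.1 a1 a2 a3)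
      (integrableOn_smul_of_tsupport_subset h'.1 a1 a2 a3),
    integral_add (integrableOn_smul_of_tsupport_subset h.2.1 h1.continuous h2 h3)
      (integrableOn_smul_of_tsupport_subset h'.2.1 h1.continuous h2 h3),
    smul_add, h.2.2 φ h1 h2 h3, h'.2.2 φ h1 h2 h3]

theorem IsWeakDeriv.const_smul {n j : ℕ} {Ω : Set (E n)} {I : Fin j → Fin n} {v w : E n → F}
    (h : IsWeakDeriv Ω I v w) (c : ℝ) :
    IsWeakDeriv Ω I (fun x => c • v x) (fun x => c • w x) := by
  refine ⟨h.1.smul c, h.2.1.smul c, fun φ h1 h2 h3 => ?_⟩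
  simp only [smul_comm _ c]
  rw [integral_smul, integral_smul, h.2.2 φ h1 h2 h3, smul_comm]

theorem IsWeakDeriv.sub {n j : ℕ} {Ω : Set (E n)} {I : Fin j → Fin n} {v v' w w' : E n → F}
    (h : IsWeakDeriv Ω I v w) (h' : IsWeakDeriv Ω I v' w') :
    IsWeakDeriv Ω I (fun x => v x - v' x) (fun x => w x - w' x) := by
  have := h.add (h'.const_smul (-1))
  simpa [sub_eq_add_neg] using this

/-- Subtracting the two defining identities and cancelling the sign leaves a locally integrable
function orthogonal to all test functions, which vanishes by the fundamental lemma of the calculus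
of variations. -/
theorem IsWeakDeriv.unique [CompleteSpace F] {n j : ℕ} {Ω : Set (E n)} (hΩ : IsOpen Ω)
    {I : Fin j → Fin n} {v w w' : E n → F}
    (h : IsWeakDeriv Ω I v w) (h' : IsWeakDeriv Ω I v w') : w =ᵐ[volume.restrict Ω] w' := by
  have key : ∀ᵐ x ∂(volume : Measure (E n)), x ∈ Ω → w x - w' x = 0 := by
    refine hΩ.ae_eq_zero_of_integral_contDiff_smul_eq_zero (h.2.1.sub h'.2.1) fun φ h1 h2 h3 => ?_
    have i1 := integrableOn_smul_of_tsupport_subset h.2.1 h1.continuous h2 h3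
    have i2 := integrableOn_smul_of_tsupport_subset h'.2.1 h1.continuous h2 h3
    have e : ∫ x, φ x • (w - w') x = ∫ x in Ω, φ x • (w - w') x := by
      symm
      apply setIntegral_eq_integral_of_forall_compl_eq_zero
      intro x hx
      have : φ x = 0 := by
        by_contra h0
        exact hx (h3 (subset_closure h0))
      simp [this]
    simp only [Pi.sub_apply] at e
    rw [e]
    simp only [smul_sub]
    rw [integral_sub i1 i2, sub_eq_zero]
    have e1 := h.2.2 φ h1 h2 h3
    rw [h'.2.2 φ h1 h2 h3] at e1
    have hu : IsUnit ((-1 : ℝ) ^ j) := by simp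
    exact (hu.smul_left_cancel.1 e1).symm
  rw [Filter.EventuallyEq, ae_restrict_iff' hΩ.measurableSet]
  filter_upwards [key] with x hx hxΩ using sub_eq_zero.1 (hx hxΩ)

theorem isWeakDeriv_zero_iff [CompleteSpace F] {n : ℕ} {Ω : Set (E n)} (hΩ : IsOpen Ω)
    {I : Fin 0 → Fin n} {v w : E n → F} :
    IsWeakDeriv Ω I v w ↔ LocallyIntegrableOn v Ω volume ∧ w =ᵐ[volume.restrict Ω] v := by
  have self : LocallyIntegrableOn v Ω volume → IsWeakDeriv Ω I v v := fun hv =>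
    ⟨hv, hv, fun φ _ _ _ => by simp⟩
  exact ⟨fun h => ⟨h.1, h.unique hΩ (self h.1)⟩,
    fun h => (self h.1).congr (ae_eq_refl v) h.2.symm⟩

theorem isWeakDeriv_one_iff {n : ℕ} {Ω : Set (E n)} {k : Fin n} {v w : E n → F} :
    IsWeakDeriv Ω (fun _ : Fin 1 => k) v w ↔
      LocallyIntegrableOn v Ω volume ∧ LocallyIntegrableOn w Ω volume ∧
      ∀ φ : E n → ℝ, ContDiff ℝ ∞ φ → HasCompactSupport φ → tsupport φ ⊆ Ω →
        ∫ x in Ω, (fderiv ℝ φ x (EuclideanSpace.single k 1)) • v x = - ∫ x in Ω, φ x • w x := by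
  simp [IsWeakDeriv, iteratedFDeriv_one_apply]

/-- Since `φ` and its derivative vanish off Ω, all integrals extend to the whole space, where
integration by parts has no boundary term. Nothing about the boundary of Ω or the growth of `f`
matters. -/
theorem isWeakDeriv_of_contDiff {n : ℕ} {Ω : Set (E n)} {k : Fin n} {f : E n → F}
    (hf : ContDiff ℝ ∞ f) :
    IsWeakDeriv Ω (fun _ : Fin 1 => k) f
      (fun x => fderiv ℝ f x (EuclideanSpace.single k 1)) := by
  have hfd : Continuous (fun x => fderiv ℝ f x (EuclideanSpace.single k 1)) := by
    have := hf.continuous_fderiv (by simp)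
    fun_prop
  rw [isWeakDeriv_one_iff]
  refine ⟨hf.continuous.locallyIntegrable.locallyIntegrableOn Ω,
    hfd.locallyIntegrable.locallyIntegrableOn Ω, fun φ h1 h2 h3 => ?_⟩
  have hφd : Continuous (fun x => fderiv ℝ φ x (EuclideanSpace.single k 1)) := by
    have := h1.continuous_fderiv (by simp)
    fun_prop
  have hz : ∀ x ∉ Ω, φ x = 0 := fun x hx => by
    by_contra h0
    exact hx (h3 (subset_closure h0))
  have hz' : ∀ x ∉ Ω, fderiv ℝ φ x = 0 := fun x hx => by
    by_contra h0
    exact hx (h3 (support_fderiv_subset ℝ h0))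
  rw [setIntegral_eq_integral_of_forall_compl_eq_zero fun x hx => by simp [hz' x hx],
    setIntegral_eq_integral_of_forall_compl_eq_zero fun x hx => by simp [hz x hx]]
  have hcd : HasCompactSupport (fun x => fderiv ℝ φ x (EuclideanSpace.single k 1)) :=
    h2.fderiv_apply (𝕜 := ℝ) _
  have := integral_smul_fderiv_eq_neg_fderiv_smul_of_integrable (μ := (volume : Measure (E n)))
    (f := φ) (g := f) (v := EuclideanSpace.single k 1)
    ((hφd.smul hf.continuous).integrable_of_hasCompactSupport (hcd.smul_right))
    ((h1.continuous.smul hfd).integrable_of_hasCompactSupport h2.smul_right)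
    ((h1.continuous.smul hf.continuous).integrable_of_hasCompactSupport h2.smul_right)
    (fun x _ => (h1.differentiable (by simp)) x) (fun x _ => (hf.differentiable (by simp)) x)
  rw [this, neg_neg]

theorem iInf_isWeakDeriv [CompleteSpace F] {n j : ℕ} {Ω : Set (E n)} (hΩ : IsOpen Ω)
    {I : Fin j → Fin n} {v w : E n → F} (h : IsWeakDeriv Ω I v w) :
    ⨅ (w : E n → F) (_ : IsWeakDeriv Ω I v w), ∫⁻ x in Ω, ‖w x‖ₑ ^ 2 = ∫⁻ x in Ω, ‖w x‖ₑ ^ 2 := by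
  apply le_antisymm
  · exact iInf₂_le w h
  · refine le_iInf₂ fun w' h' => le_of_eq (lintegral_congr_ae ?_)
    filter_upwards [h.unique hΩ h'] with x hx
    rw [hx]

theorem eSobolevNorm_one_sq_eq_iInf {n : ℕ} (Ω : Set (E n)) (v : E n → F) :
    eSobolevNorm 1 Ω v ^ 2 =
      (⨅ (w : E n → F) (_ : IsWeakDeriv Ω (fun i : Fin 0 => i.elim0) v w), ∫⁻ x in Ω, ‖w x‖ₑ ^ 2) +
      ∑ k : Fin n, ⨅ (w : E n → F) (_ : IsWeakDeriv Ω (fun _ : Fin 1 => k) v w),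
        ∫⁻ x in Ω, ‖w x‖ₑ ^ 2 := by
  have e : ∑ I : Fin 1 → Fin n, ⨅ (w : E n → F) (_ : IsWeakDeriv Ω I v w), ∫⁻ x in Ω, ‖w x‖ₑ ^ 2 =
      ∑ k : Fin n, ⨅ (w : E n → F) (_ : IsWeakDeriv Ω (fun _ : Fin 1 => k) v w),
        ∫⁻ x in Ω, ‖w x‖ₑ ^ 2 := by
    refine Fintype.sum_equiv (Equiv.funUnique (Fin 1) (Fin n)) _ _ fun I => ?_
    have : I = fun _ => I 0 := by ext i; fin_cases i; rfl
    rw [this]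
    rfl
  have e0 : ∑ I : Fin 0 → Fin n, ⨅ (w : E n → F) (_ : IsWeakDeriv Ω I v w), ∫⁻ x in Ω, ‖w x‖ₑ ^ 2 =
      ⨅ (w : E n → F) (_ : IsWeakDeriv Ω (fun i : Fin 0 => i.elim0) v w),
        ∫⁻ x in Ω, ‖w x‖ₑ ^ 2 := by
    rw [Fintype.sum_eq_single (fun i : Fin 0 => i.elim0)]
    intro I hI
    exact absurd (Subsingleton.elim _ _) hI
  have h1 : ⌊(1 : ℝ)⌋₊ = 1 := by simp
  rw [eSobolevNorm, h1]
  simp only [Nat.cast_one, if_true, add_zero]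
  rw [Finset.sum_range_succ, Finset.sum_range_one, e, e0, ← ENNReal.rpow_natCast,
    ← ENNReal.rpow_mul]
  norm_num

/-- By uniqueness, each infimum in the definition is attained at whichever weak derivative is at
hand. All later computations of H¹ norms go through this formula. -/
theorem eSobolevNorm_one_sq [CompleteSpace F] {n : ℕ} {Ω : Set (E n)} (hΩ : IsOpen Ω)
    {v : E n → F} (hv : LocallyIntegrableOn v Ω volume) {w : Fin n → E n → F}
    (hw : ∀ k, IsWeakDeriv Ω (fun _ : Fin 1 => k) v (w k)) :
    eSobolevNorm 1 Ω v ^ 2 = (∫⁻ x in Ω, ‖v x‖ₑ ^ 2) + ∑ k, ∫⁻ x in Ω, ‖w k x‖ₑ ^ 2 := by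
  rw [eSobolevNorm_one_sq_eq_iInf,
    iInf_isWeakDeriv hΩ ((isWeakDeriv_zero_iff hΩ).2 ⟨hv, ae_eq_refl v⟩)]
  congr 1
  exact Finset.sum_congr rfl fun k _ => iInf_isWeakDeriv hΩ (hw k)

theorem MemSobolev.exists_weakDeriv [CompleteSpace F] {n : ℕ} {Ω : Set (E n)} (hΩ : IsOpen Ω)
    {v : E n → F} (h : MemSobolev 1 Ω v) :
    LocallyIntegrableOn v Ω volume ∧ MemLp v 2 (volume.restrict Ω) ∧
      ∃ w : Fin n → E n → F, (∀ k, IsWeakDeriv Ω (fun _ : Fin 1 => k) v (w k)) ∧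
        ∀ k, MemLp (w k) 2 (volume.restrict Ω) := by
  have h2 : eSobolevNorm 1 Ω v ^ 2 < ⊤ := ENNReal.pow_lt_top h
  rw [eSobolevNorm_one_sq_eq_iInf] at h2
  obtain ⟨ha, hb⟩ := ENNReal.add_lt_top.1 h2
  rw [ENNReal.sum_lt_top] at hb
  obtain ⟨w0, h0, h0'⟩ : ∃ w0, IsWeakDeriv Ω (fun i : Fin 0 => i.elim0) v w0 ∧
      ∫⁻ x in Ω, ‖w0 x‖ₑ ^ 2 < ⊤ := by
    simpa [iInf_lt_iff] using ha
  have hb' : ∀ k, ∃ w, IsWeakDeriv Ω (fun _ : Fin 1 => k) v w ∧ ∫⁻ x in Ω, ‖w x‖ₑ ^ 2 < ⊤ := by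
    intro k
    simpa [iInf_lt_iff] using hb k (Finset.mem_univ k)
  choose w hw hw' using hb'
  obtain ⟨hv, hv0⟩ := (isWeakDeriv_zero_iff hΩ).1 h0
  refine ⟨hv, ?_, w, hw, fun k => ?_⟩
  · exact (memLp_two_of_lintegral_lt_top h0.2.1.aestronglyMeasurable h0').ae_eq hv0
  · exact memLp_two_of_lintegral_lt_top (hw k).2.1.aestronglyMeasurable (hw' k)

theorem memSobolev_one_of_weakDeriv [CompleteSpace F] {n : ℕ} {Ω : Set (E n)} (hΩ : IsOpen Ω)
    {v : E n → F} (hv : LocallyIntegrableOn v Ω volume) (hv2 : MemLp v 2 (volume.restrict Ω))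
    {w : Fin n → E n → F}
    (hw : ∀ k, IsWeakDeriv Ω (fun _ : Fin 1 => k) v (w k))
    (hw2 : ∀ k, MemLp (w k) 2 (volume.restrict Ω)) : MemSobolev 1 Ω v := by
  have : eSobolevNorm 1 Ω v ^ 2 < ⊤ := by
    rw [eSobolevNorm_one_sq hΩ hv hw]
    simp only [← eLpNorm_two_sq]
    refine ENNReal.add_lt_top.2 ⟨ENNReal.pow_lt_top hv2.2,
      ENNReal.sum_lt_top.2 fun k _ => ENNReal.pow_lt_top (hw2 k).2⟩
  rw [MemSobolev, lt_top_iff_ne_top]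
  intro h
  rw [h] at this
  simp at this

theorem eSobolevNorm_one_congr {n : ℕ} {Ω : Set (E n)} {v v' : E n → F}
    (h : v =ᵐ[volume.restrict Ω] v') : eSobolevNorm 1 Ω v = eSobolevNorm 1 Ω v' := by
  have : ∀ {j : ℕ} (I : Fin j → Fin n) (w : E n → F), IsWeakDeriv Ω I v w ↔ IsWeakDeriv Ω I v' w :=
    fun I w => ⟨fun hw => hw.congr h (ae_eq_refl w), fun hw => hw.congr h.symm (ae_eq_refl w)⟩
  simp only [eSobolevNorm, this]

theorem eSobolevNorm_one_add_sq_le [CompleteSpace F] {n : ℕ} {Ω : Set (E n)} (hΩ : IsOpen Ω)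
    (u v : E n → F) :
    eSobolevNorm 1 Ω (fun x => u x + v x) ^ 2 ≤
      2 * eSobolevNorm 1 Ω u ^ 2 + 2 * eSobolevNorm 1 Ω v ^ 2 := by
  by_cases hu : MemSobolev 1 Ω u
  swap
  · rw [MemSobolev, not_lt, top_le_iff] at hu
    simp [hu]
  by_cases hv : MemSobolev 1 Ω v
  swap
  · rw [MemSobolev, not_lt, top_le_iff] at hv
    simp [hv]
  obtain ⟨hu1, hu2, w, hw, hw2⟩ := hu.exists_weakDeriv hΩ
  obtain ⟨hv1, hv2, z, hz, hz2⟩ := hv.exists_weakDeriv hΩ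
  rw [eSobolevNorm_one_sq hΩ hu1 hw, eSobolevNorm_one_sq hΩ hv1 hz,
    eSobolevNorm_one_sq hΩ (show LocallyIntegrableOn (fun x => u x + v x) Ω volume from hu1.add hv1)
      (fun k => (hw k).add (hz k))]
  calc _ ≤ (2 * (∫⁻ x in Ω, ‖u x‖ₑ ^ 2) + 2 * ∫⁻ x in Ω, ‖v x‖ₑ ^ 2) +
        ∑ k, (2 * (∫⁻ x in Ω, ‖w k x‖ₑ ^ 2) + 2 * ∫⁻ x in Ω, ‖z k x‖ₑ ^ 2) :=
        add_le_add (lintegral_enorm_add_sq_le hu2.1)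
          (Finset.sum_le_sum fun k _ => lintegral_enorm_add_sq_le (hw2 k).1)
    _ = _ := by
      rw [Finset.sum_add_distrib, ← Finset.mul_sum, ← Finset.mul_sum]
      ring

theorem eSobolevNorm_one_neg {n : ℕ} (Ω : Set (E n)) (v : E n → F) :
    eSobolevNorm 1 Ω (fun x => - v x) ≤ eSobolevNorm 1 Ω v := by
  have key : ∀ {j : ℕ} (I : Fin j → Fin n),
      ⨅ (w : E n → F) (_ : IsWeakDeriv Ω I (fun x => - v x) w), ∫⁻ x in Ω, ‖w x‖ₑ ^ 2 ≤
      ⨅ (w : E n → F) (_ : IsWeakDeriv Ω I v w), ∫⁻ x in Ω, ‖w x‖ₑ ^ 2 := by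
    intro j I
    refine le_iInf₂ fun w hw => ?_
    refine iInf₂_le_of_le (fun x => - w x) (by simpa using hw.const_smul (-1)) ?_
    simp
  have : eSobolevNorm 1 Ω (fun x => - v x) ^ 2 ≤ eSobolevNorm 1 Ω v ^ 2 := by
    rw [eSobolevNorm_one_sq_eq_iInf, eSobolevNorm_one_sq_eq_iInf]
    exact add_le_add (key _) (Finset.sum_le_sum fun k _ => key _)
  exact (ENNReal.pow_le_pow_left_iff (by norm_num)).1 this

end WeakDerivative

/-! ### Abstract saddle-point estimate in Hilbert spaces -/

section AbstractEstimate

variable {X H P : Type*} [AddCommGroup X] [Module ℝ X]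
  [NormedAddCommGroup H] [InnerProductSpace ℝ H] [NormedAddCommGroup P] [InnerProductSpace ℝ P]

/-- An inf-sup condition with constant `α` for `(v, q) ↦ ⟪D (G v), q⟫` on `Z × Q`, in the form that
every bound for the functional of `q` on `Z` dominates `α ‖q‖`. -/
def AbstractInfSup (G : X →ₗ[ℝ] H) (D : H →L[ℝ] P) (Z : Submodule ℝ X) (Q : Submodule ℝ P)
    (α : ℝ) : Prop :=
  ∀ q ∈ Q, ∀ b : ℝ, 0 ≤ b → (∀ v ∈ Z, inner ℝ (D (G v)) q ≤ b * ‖G v‖) → α * ‖q‖ ≤ b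

/-- Let T be D restricted to G(Z) and projected onto Q, with adjoint A. The inf-sup condition says
‖A q‖ ≥ α‖q‖, so TA is injective on the finite-dimensional Q and hence surjective. Solving T A q =
P_Q f gives G x = A q, and ‖A q‖² = ⟪f, q⟫ ≤ ‖f‖‖A q‖/α is the bound. -/
theorem AbstractInfSup.exists_correction {G : X →ₗ[ℝ] H} {D : H →L[ℝ] P} {Z : Submodule ℝ X}
    {Q : Submodule ℝ P} [FiniteDimensional ℝ Z] [FiniteDimensional ℝ Q] {α : ℝ} (hα : 0 < α)
    (hinf : AbstractInfSup G D Z Q α) (f : P) :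
    ∃ x ∈ Z, (∀ q ∈ Q, inner ℝ (D (G x)) q = inner ℝ f q) ∧ α * ‖G x‖ ≤ ‖f‖ := by
  let W : Submodule ℝ H := Z.map G
  have : FiniteDimensional ℝ W := inferInstanceAs (FiniteDimensional ℝ (Z.map G))
  have : CompleteSpace W := FiniteDimensional.complete ℝ W
  have : CompleteSpace Q := FiniteDimensional.complete ℝ Q
  let T : W →L[ℝ] Q := Q.orthogonalProjectionOnto.comp (D.comp W.subtypeL)
  let A : Q →L[ℝ] W := ContinuousLinearMap.adjoint T
  have hTq : ∀ (w : W) (q : Q), inner ℝ (T w) q = inner ℝ (D (w : H)) (q : P) := by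
    intro w q
    simp [T]
  have hA : ∀ (w : W) (q : Q), inner ℝ w (A q) = inner ℝ (D (w : H)) (q : P) := by
    intro w q
    rw [← hTq, ContinuousLinearMap.adjoint_inner_right]
  have hAlow : ∀ q : Q, α * ‖q‖ ≤ ‖A q‖ := by
    intro q
    refine hinf q q.2 _ (norm_nonneg _) fun v hv => ?_
    have hw : G v ∈ W := ⟨v, hv, rfl⟩
    have := hA ⟨G v, hw⟩ q
    rw [← this, mul_comm]
    exact real_inner_le_norm (⟨G v, hw⟩ : W) (A q)
  have hAA : ∀ q : Q, inner ℝ (T (A q)) q = ‖A q‖ ^ 2 := by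
    intro q
    rw [hTq, ← hA, real_inner_self_eq_norm_sq]
  have hsurj : Function.Surjective (T.comp A).toLinearMap := by
    rw [← LinearMap.injective_iff_surjective, injective_iff_map_eq_zero]
    intro q hq
    have hq' : T (A q) = 0 := hq
    have h0 : ‖A q‖ ^ 2 = 0 := by rw [← hAA, hq', inner_zero_left]
    have h1 := hAlow q
    have h2 : ‖A q‖ = 0 := by simpa using h0
    rw [h2] at h1
    have : ‖q‖ ≤ 0 := by
      by_contra hc
      exact absurd h1 (not_le.2 (mul_pos hα (not_le.1 hc)))
    exact norm_le_zero_iff.1 this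
  obtain ⟨q, hq⟩ := hsurj (Q.orthogonalProjectionOnto f)
  have hq' : T (A q) = Q.orthogonalProjectionOnto f := hq
  obtain ⟨x, hx, hxw⟩ := (A q).2
  refine ⟨x, hx, fun q' hq'' => ?_, ?_⟩
  · have h1 := hTq (A q) ⟨q', hq''⟩
    rw [hq'] at h1
    rw [hxw, ← h1]
    simp
  · have hn : ‖G x‖ = ‖A q‖ := by rw [hxw]; rfl
    rw [hn]
    have h1 : ‖A q‖ ^ 2 ≤ ‖f‖ * ‖q‖ := by
      rw [← hAA, hq']
      have : inner ℝ (Q.orthogonalProjectionOnto f) q = inner ℝ f (q : P) := by simp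
      rw [this]
      exact real_inner_le_norm f (q : P)
    rcases eq_or_lt_of_le (norm_nonneg (A q)) with h0 | h0
    · rw [← h0]; simp
    · have h2 := hAlow q
      have h3 : (α * ‖A q‖) * ‖A q‖ ≤ ‖f‖ * ‖A q‖ := by
        calc (α * ‖A q‖) * ‖A q‖ = α * ‖A q‖ ^ 2 := by ring
          _ ≤ α * (‖f‖ * ‖q‖) := by gcongr
          _ = ‖f‖ * (α * ‖q‖) := by ring
          _ ≤ ‖f‖ * ‖A q‖ := by gcongr
      exact le_of_mul_le_mul_right h3 h0

/-- The constant of the abstract quasi-optimality estimate. -/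
def energyConst (α δ : ℝ) : ℝ := (1 + 1 / α) * (2 * (1 + δ / α) + δ) + (1 + δ / α)

theorem energyConst_pos {α δ : ℝ} (hα : 0 < α) (hδ : 0 ≤ δ) : 0 < energyConst α δ := by
  unfold energyConst
  positivity

/-- Here `vh` is an arbitrary competitor and `φ` repairs its boundary values, which is what `hZ`
expresses. The correction `w` then repairs its divergence without leaving `Z`. -/
theorem AbstractInfSup.energy_estimate {G : X →ₗ[ℝ] H} {D : H →L[ℝ] P} {Z : Submodule ℝ X}
    {Q : Submodule ℝ P} [FiniteDimensional ℝ Z] [FiniteDimensional ℝ Q] {α : ℝ} (hα : 0 < α)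
    (hinf : AbstractInfSup G D Z Q α) {y yh vh φ : X} {p ph qh : P}
    (hZ : vh + φ - yh ∈ Z) (hph : ph ∈ Q) (hqh : qh ∈ Q)
    (hdiv : ∀ q ∈ Q, inner ℝ (D (G y)) q = 0) (hdivh : ∀ q ∈ Q, inner ℝ (D (G yh)) q = 0)
    (hmom : ∀ v ∈ Z, inner ℝ (G y) (G v) = inner ℝ (D (G v)) p)
    (hmomh : ∀ v ∈ Z, inner ℝ (G yh) (G v) = inner ℝ (D (G v)) ph) :
    ‖G (y - yh)‖ + ‖p - ph‖ ≤
      energyConst α ‖D‖ * (‖G (y - vh)‖ + ‖G φ‖ + ‖p - qh‖) := by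
  obtain ⟨w, hw, hwq, hwn⟩ := hinf.exists_correction hα (D (G (y - vh - φ)))
  set A := ‖G (y - vh)‖
  set B := ‖G φ‖
  set R := ‖p - qh‖
  set δ := ‖D‖
  have hδ : 0 ≤ δ := norm_nonneg _
  have hA : 0 ≤ A := norm_nonneg _
  have hB : 0 ≤ B := norm_nonneg _
  have hR : 0 ≤ R := norm_nonneg _
  have hf : ‖D (G (y - vh - φ))‖ ≤ δ * (A + B) := by
    refine (D.le_opNorm _).trans ?_
    gcongr
    rw [map_sub]
    exact norm_sub_le _ _
  have hGw : ‖G w‖ ≤ δ / α * (A + B) := by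
    have := hwn.trans hf
    rw [div_mul_eq_mul_div, le_div_iff₀ hα]
    linarith
  -- The admissible test function: it lies in `Z`, and `G e` has divergence orthogonal to `Q`,
  -- because `w` absorbs the discrete divergence of `y - vh - φ`.
  set e := vh + φ + w - yh with he
  have heZ : e ∈ Z := by
    have : e = (vh + φ - yh) + w := by rw [he]; abel
    rw [this]
    exact Z.add_mem hZ hw
  have heq : ∀ q ∈ Q, inner ℝ (D (G e)) q = 0 := by
    intro q hq
    have h1 := hwq q hq
    have h2 := hdiv q hq
    have h3 := hdivh q hq
    simp only [he, map_add, map_sub, inner_add_left, inner_sub_left] at h1 ⊢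
    linarith
  have hzy : ‖G (vh + φ + w - y)‖ ≤ (1 + δ / α) * (A + B) := by
    have h2 : vh + φ + w - y = φ + w - (y - vh) := by abel
    rw [h2, map_sub, map_add]
    have h3 := norm_sub_le (G φ + G w) (G (y - vh))
    have h4 := norm_add_le (G φ) (G w)
    linarith
  have hDe : ∀ v q, inner ℝ (D (G v)) q ≤ δ * ‖G v‖ * ‖q‖ := by
    intro v q
    refine (real_inner_le_norm _ _).trans ?_
    gcongr
    exact D.le_opNorm _
  have hGe : ‖G e‖ ≤ (1 + δ / α) * (A + B) + δ * R := by
    have h1 : ‖G e‖ ^ 2 ≤ ((1 + δ / α) * (A + B) + δ * R) * ‖G e‖ := by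
      have h2 : e = (vh + φ + w - y) + (y - yh) := by rw [he]; abel
      -- The two momentum equations turn ⟪G(y - yh), G e⟫ into ⟪D(G e), p - ph⟫. Since D(G e) is
      -- orthogonal to `Q`, the element `ph` may be exchanged for `qh`.
      have h3 : ‖G e‖ ^ 2 = inner ℝ (G (vh + φ + w - y)) (G e) + inner ℝ (D (G e)) (p - qh) := by
        rw [← real_inner_self_eq_norm_sq]
        nth_rewrite 1 [h2]
        rw [map_add, inner_add_left]
        congr 1
        rw [map_sub, inner_sub_left, hmom e heZ, hmomh e heZ, inner_sub_right, heq ph hph,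
          heq qh hqh]
      rw [h3]
      have h4 := (real_inner_le_norm (G (vh + φ + w - y)) (G e)).trans
        (mul_le_mul_of_nonneg_right hzy (norm_nonneg _))
      have h5 := hDe e (p - qh)
      nlinarith
    rcases eq_or_lt_of_le (norm_nonneg (G e)) with h0 | h0
    · rw [← h0]; positivity
    · rw [sq] at h1
      exact le_of_mul_le_mul_right h1 h0
  set M := (2 * (1 + δ / α)) * (A + B) + δ * R with hM
  have hyM : ‖G (y - yh)‖ ≤ M := by
    have h2 : y - yh = e - (vh + φ + w - y) := by rw [he]; abel
    rw [h2, map_sub]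
    have := norm_sub_le (G e) (G (vh + φ + w - y))
    rw [hM]
    linarith
  have hM0 : 0 ≤ M := (norm_nonneg _).trans hyM
  -- The inf-sup condition is applied to `qh - ph`. The difference of the momentum equations
  -- expresses ⟪D(G v), p - ph⟫ through the velocity error, already bounded by `M`.
  have hpress : α * ‖qh - ph‖ ≤ δ * R + M := by
    refine hinf _ (Q.sub_mem hqh hph) _ (by positivity) fun v hv => ?_
    have h1 : inner ℝ (D (G v)) (qh - ph) =
        inner ℝ (D (G v)) (qh - p) + inner ℝ (G (y - yh)) (G v) := by
      rw [map_sub, inner_sub_left, hmom v hv, hmomh v hv, ← inner_sub_right, ← inner_add_right]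
      congr 1
      abel
    rw [h1]
    have h2 := hDe v (qh - p)
    rw [norm_sub_rev qh p] at h2
    have h3 := (real_inner_le_norm (G (y - yh)) (G v)).trans
        (mul_le_mul_of_nonneg_right hyM (norm_nonneg _))
    change _ ≤ δ * ‖G v‖ * R at h2
    linarith
  have hpp : ‖p - ph‖ ≤ R + 1 / α * (δ * R + M) := by
    have h1 : p - ph = (p - qh) + (qh - ph) := by abel
    rw [h1]
    refine (norm_add_le _ _).trans ?_
    gcongr
    rw [div_mul_eq_mul_div, one_mul, le_div_iff₀ hα]
    linarith
  have hMle : M ≤ (2 * (1 + δ / α) + δ) * (A + B + R) := by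
    rw [hM]
    have : 0 ≤ δ / α := by positivity
    nlinarith [mul_nonneg hδ (add_nonneg hA hB), mul_nonneg this hR]
  have hRle : (1 + δ / α) * R ≤ (1 + δ / α) * (A + B + R) := by
    gcongr
    linarith
  calc ‖G (y - yh)‖ + ‖p - ph‖ ≤ M + (R + 1 / α * (δ * R + M)) := add_le_add hyM hpp
    _ = (1 + 1 / α) * M + (1 + δ / α) * R := by ring
    _ ≤ (1 + 1 / α) * ((2 * (1 + δ / α) + δ) * (A + B + R)) + (1 + δ / α) * (A + B + R) := by
      gcongr
    _ = _ := by unfold energyConst; ring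

end AbstractEstimate

/-! ### Gradient and divergence as linear maps between L² spaces -/

section Gradient

variable {d : ℕ} {Ω : Set (E d)}

theorem pd_isWeakDeriv (hΩ : IsOpen Ω) {v : E d → E d} (hv : MemSobolev 1 Ω v) (k : Fin d) :
    IsWeakDeriv Ω (fun _ : Fin 1 => k) v (pd Ω k v) := by
  obtain ⟨-, -, w, hw, -⟩ := hv.exists_weakDeriv hΩ
  have h : ∃ w, IsWeakDeriv Ω (fun _ : Fin 1 => k) v w := ⟨w k, hw k⟩
  rw [pd, dif_pos h]
  exact h.choose_spec

theorem pd_memLp (hΩ : IsOpen Ω) {v : E d → E d} (hv : MemSobolev 1 Ω v) (k : Fin d) :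
    MemLp (pd Ω k v) 2 (volume.restrict Ω) := by
  obtain ⟨-, -, w, hw, hw2⟩ := hv.exists_weakDeriv hΩ
  exact (hw2 k).ae_eq ((hw k).unique hΩ (pd_isWeakDeriv hΩ hv k))

theorem IsWeakDeriv.pd_ae_eq (hΩ : IsOpen Ω) {v w : E d → E d} (hv : MemSobolev 1 Ω v) {k : Fin d}
    (h : IsWeakDeriv Ω (fun _ : Fin 1 => k) v w) : pd Ω k v =ᵐ[volume.restrict Ω] w :=
  (pd_isWeakDeriv hΩ hv k).unique hΩ h

theorem L2vec_locallyIntegrableOn (v : L2vec Ω) : LocallyIntegrableOn v Ω volume := by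
  refine locallyIntegrableOn_of_locallyIntegrable_restrict ?_
  exact (Lp.memLp v).locallyIntegrable (by norm_num)

theorem MemSobolev.add_Lp (hΩ : IsOpen Ω) {v w : L2vec Ω} (hv : MemSobolev 1 Ω v)
    (hw : MemSobolev 1 Ω w) : MemSobolev 1 Ω (v + w : L2vec Ω) := by
  rw [MemSobolev, eSobolevNorm_one_congr (Lp.coeFn_add v w)]
  have h := eSobolevNorm_one_add_sq_le hΩ v w
  have h2 : eSobolevNorm 1 Ω (fun x => v x + w x) ^ 2 < ⊤ := by
    refine h.trans_lt (ENNReal.add_lt_top.2 ⟨?_, ?_⟩) <;>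
      exact ENNReal.mul_lt_top (by simp) (ENNReal.pow_lt_top (by assumption))
  rw [lt_top_iff_ne_top]
  intro h3
  change eSobolevNorm 1 Ω (fun x => v x + w x) = ⊤ at h3
  rw [h3] at h2
  simp at h2

theorem memSobolev_one_zero_Lp (hΩ : IsOpen Ω) : MemSobolev 1 Ω (0 : L2vec Ω) := by
  rw [MemSobolev, eSobolevNorm_one_congr (Lp.coeFn_zero (E d) 2 (volume.restrict Ω))]
  have h := fun k => isWeakDeriv_of_contDiff (Ω := Ω) (k := k) (f := fun _ : E d => (0 : E d))
    contDiff_const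
  have hz : MemLp (fun _ : E d => (0 : E d)) 2 (volume.restrict Ω) := MemLp.zero
  exact memSobolev_one_of_weakDeriv hΩ (locallyIntegrableOn_zero (s := Ω)) hz
    (w := fun k x => fderiv ℝ (fun _ : E d => (0 : E d)) x (EuclideanSpace.single k 1))
    h (fun k => by simp)

theorem MemSobolev.smul_Lp (hΩ : IsOpen Ω) {v : L2vec Ω} (c : ℝ) (hv : MemSobolev 1 Ω v) :
    MemSobolev 1 Ω (c • v : L2vec Ω) := by
  obtain ⟨-, -, w, hw, hw2⟩ := hv.exists_weakDeriv hΩ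
  refine memSobolev_one_of_weakDeriv hΩ (L2vec_locallyIntegrableOn _) (Lp.memLp _)
    (w := fun k x => c • w k x) (fun k => ?_) (fun k => (hw2 k).const_smul c)
  exact ((hw k).const_smul c).congr (Lp.coeFn_smul c v).symm (ae_eq_refl _)

/-- `H^1(Ω)^d` as a subspace of `L²(Ω)^d`. -/
def H1 (hΩ : IsOpen Ω) : Submodule ℝ (L2vec Ω) where
  carrier := {v | MemSobolev 1 Ω v}
  add_mem' := fun ha hb => ha.add_Lp hΩ hb
  zero_mem' := memSobolev_one_zero_Lp hΩ
  smul_mem' := fun c _ hv => hv.smul_Lp hΩ c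

/-- `L²(Ω)^{d×d}`, the space of gradients. -/
abbrev L2mat (Ω : Set (E d)) : Type := PiLp 2 (fun _ : Fin d => L2vec Ω)

/-- The gradient `H^1(Ω)^d → L²(Ω)^{d×d}`. -/
def grad (hΩ : IsOpen Ω) : H1 hΩ →ₗ[ℝ] L2mat Ω where
  toFun v := WithLp.toLp 2 fun k => (pd_memLp hΩ v.2 k).toLp (pd Ω k v.1)
  map_add' v w := by
    ext1 k
    rw [PiLp.add_apply]
    change (pd_memLp hΩ (v + w).2 k).toLp _ = (pd_memLp hΩ v.2 k).toLp _ + (pd_memLp hΩ w.2 k).toLp _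
    rw [← MemLp.toLp_add, MemLp.toLp_eq_toLp_iff]
    -- `pd` is an arbitrary choice of representative, so it is additive only almost everywhere, by
    -- uniqueness of weak derivatives.
    refine IsWeakDeriv.pd_ae_eq hΩ (v + w).2 ?_
    exact ((pd_isWeakDeriv hΩ v.2 k).add (pd_isWeakDeriv hΩ w.2 k)).congr
      (Lp.coeFn_add v.1 w.1).symm (ae_eq_refl _)
  map_smul' c v := by
    ext1 k
    rw [PiLp.smul_apply]
    change (pd_memLp hΩ (c • v).2 k).toLp _ = c • (pd_memLp hΩ v.2 k).toLp _
    rw [← MemLp.toLp_const_smul, MemLp.toLp_eq_toLp_iff]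
    refine IsWeakDeriv.pd_ae_eq hΩ (c • v).2 ?_
    exact ((pd_isWeakDeriv hΩ v.2 k).const_smul c).congr
      (Lp.coeFn_smul c v.1).symm (ae_eq_refl _)

theorem grad_apply_ae (hΩ : IsOpen Ω) (v : H1 hΩ) (k : Fin d) :
    grad hΩ v k =ᵐ[volume.restrict Ω] pd Ω k v.1 :=
  MemLp.coeFn_toLp (pd_memLp hΩ v.2 k)

theorem gradInner_eq (hΩ : IsOpen Ω) (v w : H1 hΩ) :
    gradInner Ω v w = inner ℝ (grad hΩ v) (grad hΩ w) := by
  rw [PiLp.inner_apply, gradInner]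
  refine Finset.sum_congr rfl fun k _ => ?_
  rw [L2.inner_def]
  refine integral_congr_ae ?_
  filter_upwards [grad_apply_ae hΩ v k, grad_apply_ae hΩ w k] with x h1 h2
  rw [h1, h2]

theorem gradNorm_eq (hΩ : IsOpen Ω) (v : H1 hΩ) : gradNorm Ω v = ‖grad hΩ v‖ := by
  rw [gradNorm, gradInner_eq, real_inner_self_eq_norm_sq, Real.sqrt_sq (norm_nonneg _)]

/-- The trace of matrix fields, `L²(Ω)^{d×d} → L²(Ω)`, so that `div v = matTrace (grad v)`. -/
def matTrace (Ω : Set (E d)) : L2mat Ω →L[ℝ] L2 Ω :=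
  ∑ k, (ContinuousLinearMap.compLpL 2 (volume.restrict Ω)
    (EuclideanSpace.proj k : E d →L[ℝ] ℝ)).comp (PiLp.proj 2 (fun _ : Fin d => L2vec Ω) k)

theorem matTrace_apply_ae (A : L2mat Ω) :
    matTrace Ω A =ᵐ[volume.restrict Ω] fun x => ∑ k, A k x k := by
  have h1 : matTrace Ω A = ∑ k, ContinuousLinearMap.compLpL 2 (volume.restrict Ω)
      (EuclideanSpace.proj k : E d →L[ℝ] ℝ) (A k) := by
    simp [matTrace]
  rw [h1]
  have h2 := Lp.coeFn_finsetSum (μ := volume.restrict Ω) (p := 2) Finset.univ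
    (fun k => ContinuousLinearMap.compLpL 2 (volume.restrict Ω)
      (EuclideanSpace.proj k : E d →L[ℝ] ℝ) (A k))
  have h3 : ∀ᵐ x ∂(volume.restrict Ω), ∀ k, ContinuousLinearMap.compLpL 2 (volume.restrict Ω)
      (EuclideanSpace.proj k : E d →L[ℝ] ℝ) (A k) x = A k x k := by
    rw [ae_all_iff]
    intro k
    exact ContinuousLinearMap.coeFn_compLpL _ _
  filter_upwards [h2, h3] with x hx hx'
  rw [hx, Finset.sum_apply]
  exact Finset.sum_congr rfl fun k _ => hx' k

theorem divInner_eq (hΩ : IsOpen Ω) (v : H1 hΩ) (q : L2 Ω) :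
    divInner Ω v q = inner ℝ (matTrace Ω (grad hΩ v)) q := by
  rw [L2.inner_def, divInner]
  refine integral_congr_ae ?_
  have h : ∀ᵐ x ∂(volume.restrict Ω), ∀ k, grad hΩ v k x = pd Ω k v.1 x := by
    rw [ae_all_iff]
    exact fun k => grad_apply_ae hΩ v k
  filter_upwards [h, matTrace_apply_ae (grad hΩ v)] with x h1 h2
  rw [h2]
  simp only [h1]
  simp [mul_comm]

theorem gradNorm_le_sobolevNorm (hΩ : IsOpen Ω) (v : H1 hΩ) :
    gradNorm Ω v ≤ sobolevNorm 1 Ω v.1 := by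
  have hsq := eSobolevNorm_one_sq hΩ (L2vec_locallyIntegrableOn v.1)
    (fun k => pd_isWeakDeriv hΩ v.2 k)
  have h1 : gradInner Ω v v = (∑ k, ∫⁻ x in Ω, ‖pd Ω k v.1 x‖ₑ ^ 2).toReal := by
    rw [gradInner, ENNReal.toReal_sum]
    · refine Finset.sum_congr rfl fun k _ => ?_
      rw [integral_eq_lintegral_of_nonneg_ae]
      · congr 1
        refine lintegral_congr fun x => ?_
        rw [real_inner_self_eq_norm_sq, ENNReal.ofReal_pow (norm_nonneg _), ofReal_norm]
      · exact Eventually.of_forall fun x => real_inner_self_nonneg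
      · have := (pd_memLp hΩ v.2 k).1
        exact this.inner this
    · intro k _
      rw [← eLpNorm_two_sq]
      exact (ENNReal.pow_lt_top (pd_memLp hΩ v.2 k).2).ne
  rw [gradNorm, h1]
  refine Real.sqrt_le_iff.2 ⟨ENNReal.toReal_nonneg, ?_⟩
  rw [sobolevNorm, ← ENNReal.toReal_pow, hsq]
  refine ENNReal.toReal_mono ?_ le_add_self
  rw [← hsq]
  exact (ENNReal.pow_lt_top v.2).ne

end Gradient

/-! ### Cauchy–Schwarz for integrals with values in [0, ∞] -/

section CauchySchwarz

variable {X : Type*} [MeasurableSpace X] {μ : Measure X}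

theorem lintegral_mul_sq_le {f g : X → ℝ≥0∞} (hf : AEMeasurable f μ) (hg : AEMeasurable g μ) :
    (∫⁻ x, f x * g x ∂μ) ^ 2 ≤ (∫⁻ x, f x ^ 2 ∂μ) * ∫⁻ x, g x ^ 2 ∂μ := by
  have h := ENNReal.lintegral_mul_le_Lp_mul_Lq μ Real.HolderConjugate.two_two hf hg
  simp only [Pi.mul_apply, ENNReal.rpow_ofNat] at h
  calc (∫⁻ x, f x * g x ∂μ) ^ 2
      ≤ ((∫⁻ x, f x ^ 2 ∂μ) ^ (1 / 2 : ℝ) * (∫⁻ x, g x ^ 2 ∂μ) ^ (1 / 2 : ℝ)) ^ 2 := by gcongr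
    _ = _ := by
      rw [mul_pow, ← ENNReal.rpow_natCast, ← ENNReal.rpow_natCast, ← ENNReal.rpow_mul,
        ← ENNReal.rpow_mul]
      norm_num

theorem lintegral_sq_le_measure_mul {f : X → ℝ≥0∞} (hf : AEMeasurable f μ) :
    (∫⁻ x, f x ∂μ) ^ 2 ≤ μ univ * ∫⁻ x, f x ^ 2 ∂μ := by
  have h := lintegral_mul_sq_le (μ := μ) (f := fun _ => 1) aemeasurable_const hf
  simpa using h

end CauchySchwarz

/-! ### Continuity of translations in L² -/

section Translation

variable {F : Type*} [NormedAddCommGroup F] {d : ℕ}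

/-- Translations act continuously on `L²`. -/
theorem exists_translation_close {f : E d → F} (hf : MemLp f 2 volume) {δ : ℝ≥0∞} (hδ : 0 < δ) :
    ∃ r > 0, ∀ t : E d, ‖t‖ ≤ r → eLpNorm (fun x => f (x - t) - f x) 2 volume ≤ δ := by
  let g : E d → C(E d, E d) := fun t => ⟨fun x => x - t, by fun_prop⟩
  have hg : Continuous g := by
    refine ContinuousMap.continuous_of_continuous_uncurry _ ?_
    exact continuous_snd.sub continuous_fst
  have hgm : ∀ t, MeasurePreserving (g t) volume volume := fun t =>
    measurePreserving_sub_right volume t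
  have hcont : ContinuousAt (fun t => Lp.compMeasurePreserving (g t) (hgm t) (hf.toLp f)) 0 :=
    ContinuousAt.compMeasurePreservingLp continuousAt_const hg.continuousAt hgm (by simp)
  have h0 : Lp.compMeasurePreserving (g 0) (hgm 0) (hf.toLp f) = hf.toLp f := by
    rw [Lp.toLp_compMeasurePreserving, MemLp.toLp_eq_toLp_iff]
    refine Eventually.of_forall fun x => ?_
    simp [g]
  have hev := (EMetric.tendsto_nhds.1 hcont) δ hδ
  obtain ⟨r, hr, hr'⟩ := Metric.eventually_nhds_iff.1 hev
  refine ⟨r / 2, by positivity, fun t ht => ?_⟩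
  have h1 := hr' (y := t) (by rw [dist_zero_right]; linarith)
  beta_reduce at h1
  rw [h0, Lp.toLp_compMeasurePreserving, Lp.edist_toLp_toLp] at h1
  exact h1.le

end Translation

/-! ### Mollification with off-centre kernels -/

section Mollification

variable {F : Type*} [NormedAddCommGroup F] [NormedSpace ℝ F] {d : ℕ}

/-- A smooth mollifier supported in `closedBall p ρ`. -/
structure IsMollifier (η : E d → ℝ) (p : E d) (ρ : ℝ) : Prop where
  smooth : ContDiff ℝ ∞ η
  compact : HasCompactSupport η
  nonneg : ∀ x, 0 ≤ η x
  integral_eq_one : ∫ x, η x = 1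
  tsupport_subset : tsupport η ⊆ Metric.closedBall p ρ

theorem exists_isMollifier (p : E d) {ρ : ℝ} (hρ : 0 < ρ) : ∃ η, IsMollifier η p ρ := by
  let b : ContDiffBump p := ⟨ρ / 2, ρ, by positivity, by linarith⟩
  exact ⟨b.normed volume, b.contDiff_normed, b.hasCompactSupport_normed, b.nonneg_normed,
    b.integral_normed, b.tsupport_normed_eq.subset⟩

/-- The convolution `η * f`. -/
def moll (η : E d → ℝ) (f : E d → F) : E d → F :=
  convolution f η (ContinuousLinearMap.lsmul ℝ ℝ).flip volume

theorem moll_apply (η : E d → ℝ) (f : E d → F) (x : E d) :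
    moll η f x = ∫ t, η (x - t) • f t := rfl

theorem moll_apply' (η : E d → ℝ) (f : E d → F) (x : E d) :
    moll η f x = ∫ t, η t • f (x - t) := by
  rw [moll_apply, ← integral_sub_left_eq_self (fun t => η (x - t) • f t) volume x]
  simp

theorem IsMollifier.contDiff_moll {η : E d → ℝ} {p : E d} {ρ : ℝ} (hη : IsMollifier η p ρ)
    {f : E d → F} (hf : LocallyIntegrable f volume) : ContDiff ℝ ∞ (moll η f) :=
  hη.compact.contDiff_convolution_right _ hf hη.smooth

theorem IsMollifier.fderiv_moll {η : E d → ℝ} {p : E d} {ρ : ℝ} (hη : IsMollifier η p ρ)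
    {f : E d → F} (hf : LocallyIntegrable f volume) (x e : E d) :
    fderiv ℝ (moll η f) x e = ∫ t, fderiv ℝ η (x - t) e • f t := by
  have h1 : ContDiff ℝ 1 η := hη.smooth.of_le (by simp)
  rw [moll, (hη.compact.hasFDerivAt_convolution_right _ hf h1 x).fderiv,
    convolution_precompR_apply _ hf (hη.compact.fderiv ℝ) (h1.continuous_fderiv one_ne_zero)]
  rfl

/-- Extension by zero destroys weak differentiability across the boundary. At points `x` from which
the kernel sees only Ω, however, t ↦ η(x - t) is a test function on Ω, and the weak derivative can
be moved through the convolution. An off-centre support makes this possible up to the boundary. -/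
theorem IsMollifier.fderiv_moll_indicator {η : E d → ℝ} {p : E d} {ρ : ℝ} (hη : IsMollifier η p ρ)
    {Ω : Set (E d)} (hΩ : IsOpen Ω) {v w : E d → F} {k : Fin d}
    (hv : LocallyIntegrable (Ω.indicator v) volume)
    (hw : IsWeakDeriv Ω (fun _ : Fin 1 => k) v w) {x : E d}
    (hx : ∀ t ∈ Metric.closedBall p ρ, x - t ∈ Ω) :
    fderiv ℝ (moll η (Ω.indicator v)) x (EuclideanSpace.single k 1) =
      moll η (Ω.indicator w) x := by
  have h1 : ContDiff ℝ ∞ (fun t => η (x - t)) := hη.smooth.comp (contDiff_const.sub contDiff_id)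
  have hts : tsupport (fun t => η (x - t)) = (fun t => x - t) ⁻¹' tsupport η :=
    tsupport_comp_eq_preimage η (Homeomorph.subLeft x)
  have h2 : HasCompactSupport (fun t => η (x - t)) :=
    hη.compact.comp_homeomorph (Homeomorph.subLeft x)
  have h3 : tsupport (fun t => η (x - t)) ⊆ Ω := by
    rw [hts]
    intro t ht
    have := hx _ (hη.tsupport_subset ht)
    simpa using this
  have key := (isWeakDeriv_one_iff.1 hw).2.2 _ h1 h2 h3
  have hd : ∀ t, fderiv ℝ (fun t => η (x - t)) t (EuclideanSpace.single k 1) =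
      - fderiv ℝ η (x - t) (EuclideanSpace.single k 1) := by
    intro t
    have := (hη.smooth.differentiable (by simp) (x - t)).hasFDerivAt.comp t
      ((hasFDerivAt_const x t).sub (hasFDerivAt_id t))
    have h' := this.fderiv
    change fderiv ℝ (fun t => η (x - t)) t = _ at h'
    rw [h']
    simp
  simp only [hd, neg_smul, integral_neg, neg_inj] at key
  rw [hη.fderiv_moll hv, moll_apply]
  have e1 : ∀ (a : E d → ℝ) (g : E d → F), ∫ t, a t • Ω.indicator g t = ∫ t in Ω, a t • g t := by
    intro a g
    rw [← integral_indicator hΩ.measurableSet]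
    refine integral_congr_ae (Eventually.of_forall fun t => ?_)
    by_cases ht : t ∈ Ω <;> simp [ht]
  rw [e1, e1, key]

/-- η * f - f is an average of f(· - t) - f against the probability density η. Cauchy–Schwarz
pointwise in x and Tonelli bound its L² norm by that of the worst translate. -/
theorem IsMollifier.eLpNorm_moll_sub_le [CompleteSpace F] {η : E d → ℝ} {p : E d} {ρ : ℝ}
    (hη : IsMollifier η p ρ) {f : E d → F} (hf : MemLp f 2 volume) {δ : ℝ≥0∞}
    (h : ∀ t ∈ Metric.closedBall p ρ, eLpNorm (fun x => f (x - t) - f x) 2 volume ≤ δ) :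
    eLpNorm (fun x => moll η f x - f x) 2 volume ≤ δ := by
  have hfl : LocallyIntegrable f volume := hf.locallyIntegrable (by norm_num)
  have hηc := hη.smooth.continuous
  have hηi : Integrable η volume := hηc.integrable_of_hasCompactSupport hη.compact
  obtain ⟨f', hf'm, hf'⟩ := hf.1
  have hηm : Measurable (fun t => ENNReal.ofReal (η t)) := by fun_prop
  have hη1 : ∫⁻ t, ENNReal.ofReal (η t) = 1 := by
    rw [← ofReal_integral_eq_lintegral_ofReal hηi (Eventually.of_forall hη.nonneg),
      hη.integral_eq_one, ENNReal.ofReal_one]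
  let m : Measure (E d) := volume.withDensity fun t => ENNReal.ofReal (η t)
  have hm1 : m univ = 1 := by
    simp only [m]
    rw [withDensity_apply _ MeasurableSet.univ, Measure.restrict_univ, hη1]
  have hm : IsProbabilityMeasure m := ⟨hm1⟩
  have hac : m ≪ volume := withDensity_absolutelyContinuous _ _
  have hmball : ∀ᵐ t ∂m, t ∈ Metric.closedBall p ρ := by
    rw [ae_withDensity_iff hηm]
    refine Eventually.of_forall fun t ht => hη.tsupport_subset (subset_closure ?_)
    intro h0
    simp [h0] at ht
  have hqx : ∀ x : E d, Measure.QuasiMeasurePreserving (fun t => x - t) volume volume := fun x =>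
    (Measure.measurePreserving_sub_left volume x).quasiMeasurePreserving
  have haesm : ∀ x, AEStronglyMeasurable (fun t => f (x - t)) volume := fun x =>
    hf.1.comp_quasiMeasurePreserving (hqx x)
  have hpt : ∀ x, ‖moll η f x - f x‖ₑ ^ 2 ≤ ∫⁻ t, ‖f (x - t) - f x‖ₑ ^ 2 ∂m := by
    intro x
    have hint : Integrable (fun t => η t • f (x - t)) volume := by
      have h1 := hη.compact.convolutionExists_left (ContinuousLinearMap.lsmul ℝ ℝ) hηc hfl x
      exact h1
    have e1 : moll η f x - f x = ∫ t, η t • (f (x - t) - f x) := by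
      simp only [smul_sub]
      rw [integral_sub hint (hηi.smul_const _), integral_smul_const, hη.integral_eq_one, one_smul,
        moll_apply']
    have e2 : ‖moll η f x - f x‖ₑ ≤ ∫⁻ t, ‖f (x - t) - f x‖ₑ ∂m := by
      rw [e1]
      refine (enorm_integral_le_lintegral_enorm _).trans ?_
      simp only [m]
      have hae : AEMeasurable (fun t => ‖f (x - t) - f x‖ₑ) volume :=
        ((haesm x).sub aestronglyMeasurable_const).enorm
      rw [lintegral_withDensity_eq_lintegral_mul₀ hηm.aemeasurable hae]
      refine lintegral_mono fun t => ?_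
      rw [Pi.mul_apply, enorm_smul, Real.enorm_of_nonneg (hη.nonneg t)]
    calc ‖moll η f x - f x‖ₑ ^ 2 ≤ (∫⁻ t, ‖f (x - t) - f x‖ₑ ∂m) ^ 2 := by gcongr
      _ ≤ m univ * ∫⁻ t, ‖f (x - t) - f x‖ₑ ^ 2 ∂m :=
        lintegral_sq_le_measure_mul
          (((haesm x).sub aestronglyMeasurable_const).enorm.mono_ac hac)
      _ = _ := by rw [hm1, one_mul]
  rw [← ENNReal.pow_le_pow_left_iff (n := 2) (by norm_num), eLpNorm_two_sq]
  have hprod : AEMeasurable (fun z : E d × E d => ‖f (z.1 - z.2) - f z.1‖ₑ ^ 2)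
      (volume.prod m) := by
    have h1 : AEStronglyMeasurable (fun z : E d × E d => f (z.1 - z.2))
        ((volume : Measure (E d)).prod volume) :=
      hf.1.comp_quasiMeasurePreserving (quasiMeasurePreserving_sub_of_right_invariant _ _)
    have h2 : AEStronglyMeasurable (fun z : E d × E d => f z.1)
        ((volume : Measure (E d)).prod volume) := hf.1.comp_fst
    have h3 := (h1.sub h2).enorm.pow_const 2
    exact h3.mono_ac (Measure.AbsolutelyContinuous.rfl.prod hac)
  calc ∫⁻ x, ‖moll η f x - f x‖ₑ ^ 2 ≤ ∫⁻ x, ∫⁻ t, ‖f (x - t) - f x‖ₑ ^ 2 ∂m :=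
        lintegral_mono hpt
    _ = ∫⁻ t, (∫⁻ x, ‖f (x - t) - f x‖ₑ ^ 2) ∂m := lintegral_lintegral_swap hprod
    _ ≤ ∫⁻ _, δ ^ 2 ∂m := by
      refine lintegral_mono_ae ?_
      filter_upwards [hmball] with t ht
      rw [← eLpNorm_two_sq]
      gcongr
      exact h t ht
    _ = δ ^ 2 := by simp [hm1]

theorem eventually_eLpNorm_moll_sub_le [CompleteSpace F] {f : E d → F} (hf : MemLp f 2 volume)
    {δ : ℝ≥0∞} (hδ : 0 < δ) (e : E d) (c : ℝ) :
    ∀ᶠ ε in 𝓝[>] (0 : ℝ), ∀ η, IsMollifier η (ε • e) (ε * c) →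
      eLpNorm (fun x => moll η f x - f x) 2 volume ≤ δ := by
  obtain ⟨r, hr, hr'⟩ := exists_translation_close hf hδ
  have hev : ∀ᶠ ε in 𝓝[>] (0 : ℝ), ‖ε • e‖ + ε * c < r := by
    have hc : ContinuousAt (fun ε : ℝ => ‖ε • e‖ + ε * c) 0 := by fun_prop
    have : Tendsto (fun ε : ℝ => ‖ε • e‖ + ε * c) (𝓝[>] 0) (𝓝 0) := by
      have h0 := hc.tendsto.mono_left (nhdsWithin_le_nhds (s := Ioi (0 : ℝ)))
      simpa using h0
    exact this.eventually_lt_const hr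
  filter_upwards [hev] with ε hε η hη
  refine hη.eLpNorm_moll_sub_le hf fun t ht => hr' t ?_
  have h1 : ‖t‖ ≤ ‖t - ε • e‖ + ‖ε • e‖ := by
    simpa using norm_add_le (t - ε • e) (ε • e)
  rw [Metric.mem_closedBall, dist_eq_norm] at ht
  linarith

end Mollification

/-! ### Lipschitz charts and directions pointing into the domain -/

section Charts

variable {d : ℕ}

/-- The Cartesian coordinates of a chart as a linear isometry. -/
theorem exists_chart_isometry (hd : 1 ≤ d) (L : E (d - 1) →ₗᵢ[ℝ] E d) {ν : E d} (hν : ‖ν‖ = 1)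
    (hL : ∀ a, inner ℝ (L a) ν = 0) :
    ∃ e : WithLp 2 (E (d - 1) × ℝ) ≃ₗᵢ[ℝ] E d, ∀ a s, e (WithLp.toLp 2 (a, s)) = L a + s • ν := by
  let f : WithLp 2 (E (d - 1) × ℝ) →ₗ[ℝ] E d :=
    (L.toLinearMap.coprod (LinearMap.toSpanSingleton ℝ (E d) ν)).comp
      (WithLp.linearEquiv 2 ℝ (E (d - 1) × ℝ)).toLinearMap
  have hf : ∀ x, f x = L x.fst + x.snd • ν := fun x => by simp [f]
  have hnorm : ∀ x, ‖f x‖ = ‖x‖ := by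
    intro x
    rw [← sq_eq_sq₀ (norm_nonneg _) (norm_nonneg _), hf, WithLp.prod_norm_sq_eq_of_L2,
      norm_add_sq_real, inner_smul_right, hL, norm_smul, hν, L.norm_map]
    simp
  let li : WithLp 2 (E (d - 1) × ℝ) →ₗᵢ[ℝ] E d := ⟨f, hnorm⟩
  have hfin : Module.finrank ℝ (WithLp 2 (E (d - 1) × ℝ)) = Module.finrank ℝ (E d) := by
    rw [(WithLp.linearEquiv 2 ℝ (E (d - 1) × ℝ)).finrank_eq]
    simp
    omega
  refine ⟨li.toLinearIsometryEquiv hfin, fun a s => ?_⟩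
  rw [LinearIsometry.coe_toLinearIsometryEquiv]
  exact hf _

theorem norm_sq_chart (L : E (d - 1) →ₗᵢ[ℝ] E d) {ν : E d} (hν : ‖ν‖ = 1)
    (hL : ∀ a, inner ℝ (L a) ν = 0) (a : E (d - 1)) (s : ℝ) :
    ‖L a + s • ν‖ ^ 2 = ‖a‖ ^ 2 + s ^ 2 := by
  rw [norm_add_sq_real, inner_smul_right, hL, norm_smul, hν, L.norm_map]
  simp

theorem norm_fst_le_chart (L : E (d - 1) →ₗᵢ[ℝ] E d) {ν : E d} (hν : ‖ν‖ = 1)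
    (hL : ∀ a, inner ℝ (L a) ν = 0) (a : E (d - 1)) (s : ℝ) : ‖a‖ ≤ ‖L a + s • ν‖ := by
  rw [← sq_le_sq₀ (norm_nonneg _) (norm_nonneg _), norm_sq_chart L hν hL]
  nlinarith

theorem abs_snd_le_chart (L : E (d - 1) →ₗᵢ[ℝ] E d) {ν : E d} (hν : ‖ν‖ = 1)
    (hL : ∀ a, inner ℝ (L a) ν = 0) (a : E (d - 1)) (s : ℝ) : |s| ≤ ‖L a + s • ν‖ := by
  rw [← sq_le_sq₀ (abs_nonneg _) (norm_nonneg _), norm_sq_chart L hν hL, sq_abs]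
  nlinarith [sq_nonneg ‖a‖]

theorem exists_chart_coord (hd : 1 ≤ d) (L : E (d - 1) →ₗᵢ[ℝ] E d) {ν : E d} (hν : ‖ν‖ = 1)
    (hL : ∀ a, inner ℝ (L a) ν = 0) (x : E d) : ∃ (a : E (d - 1)) (s : ℝ), x = L a + s • ν := by
  obtain ⟨e, he⟩ := exists_chart_isometry hd L hν hL
  refine ⟨(e.symm x).fst, (e.symm x).snd, ?_⟩
  rw [← he]
  exact (e.apply_symm_apply x).symm

/-- Near each point of its closure, the domain is invariant under small translations by vectors
of a cone. -/
theorem IsPolyhedralDomain.exists_inner_direction (hd : 1 ≤ d) {Ω : Set (E d)}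
    (hΩ : IsPolyhedralDomain Ω) {x₀ : E d} (hx₀ : x₀ ∈ closure Ω) :
    ∃ r > 0, ∃ (e : E d) (c : ℝ), 0 < c ∧ ∃ ε₀ > 0, ∀ x ∈ Ω ∩ Metric.ball x₀ r,
      ∀ ε, 0 < ε → ε < ε₀ → ∀ t ∈ Metric.closedBall (ε • e) (ε * c), x - t ∈ Ω := by
  by_cases hx : x₀ ∈ Ω
  · obtain ⟨R, hR, hRΩ⟩ := Metric.isOpen_iff.1 hΩ.isOpen x₀ hx
    -- At an interior point every sufficiently small translation stays in Ω, so no direction is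
    -- needed.
    refine ⟨R / 2, by positivity, 0, 1, one_pos, R / 2, by positivity, ?_⟩
    rintro x ⟨-, hx2⟩ ε hε hε' t ht
    apply hRΩ
    rw [Metric.mem_ball, dist_eq_norm] at *
    rw [Metric.mem_closedBall, dist_eq_norm] at ht
    have h1 : x - t - x₀ = (x - x₀) - (t - ε • 0) := by simp; abel
    rw [h1]
    have := norm_sub_le (x - x₀) (t - ε • 0)
    linarith
  · have hfr : x₀ ∈ frontier Ω := by
      rw [frontier, hΩ.isOpen.interior_eq]
      exact ⟨hx₀, hx⟩
    obtain ⟨L, ν, φ, R, hR, hν, hL, ⟨K, hK⟩, hchart⟩ := hΩ.lipschitz x₀ hfr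
    have hK0 : (0 : ℝ) ≤ K := K.2
    -- Subtracting t lowers the height by at least ε - εc, while the graph moves by at most Kεc.
    -- These are equal for c = 1/(1 + K), so the point stays strictly below the graph. As ‖t‖ ≤ 2ε <
    -- R/2, it also stays in the chart ball.
    refine ⟨R / 2, by positivity, ν, 1 / (1 + K), by positivity, R / 4, by positivity, ?_⟩
    rintro x ⟨hxΩ, hx2⟩ ε hε hε' t ht
    obtain ⟨a, s, rfl⟩ := exists_chart_coord hd L hν hL x
    obtain ⟨b, τ, rfl⟩ := exists_chart_coord hd L hν hL t
    set c : ℝ := 1 / (1 + K) with hc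
    have hc1 : c * (1 + K) = 1 := by rw [hc]; field_simp
    have hc0 : 0 < c := by positivity
    have hcle : c ≤ 1 := by nlinarith
    rw [Metric.mem_closedBall, dist_eq_norm] at ht
    have ht' : L b + τ • ν - ε • ν = L b + (τ - ε) • ν := by rw [sub_smul]; abel
    rw [ht'] at ht
    have hb := (norm_fst_le_chart L hν hL b (τ - ε)).trans ht
    have hτ := (abs_snd_le_chart L hν hL b (τ - ε)).trans ht
    have hnt : ‖L b + τ • ν‖ ≤ ε * c + ε := by
      have h1 : L b + τ • ν = (L b + (τ - ε) • ν) + ε • ν := by rw [sub_smul]; abel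
      rw [h1]
      refine (norm_add_le _ _).trans (add_le_add ht ?_)
      rw [norm_smul, hν, Real.norm_eq_abs, abs_of_pos hε, mul_one]
    have hxs : s < φ a := by
      refine (hchart a s ?_).1 hxΩ
      exact Metric.ball_subset_ball (by linarith) hx2
    have hsub : L a + s • ν - (L b + τ • ν) = L (a - b) + (s - τ) • ν := by
      rw [map_sub, sub_smul]; abel
    rw [hsub]
    refine (hchart _ _ ?_).2 ?_
    · rw [← hsub, Metric.mem_ball, dist_eq_norm]
      rw [Metric.mem_ball, dist_eq_norm] at hx2
      have h1 : L a + s • ν - (L b + τ • ν) - x₀ = (L a + s • ν - x₀) - (L b + τ • ν) := by abel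
      rw [h1]
      have h2 := norm_sub_le (L a + s • ν - x₀) (L b + τ • ν)
      have : ε * c ≤ ε := by nlinarith
      linarith
    · have h1 := hK.dist_le_mul a (a - b)
      rw [dist_eq_norm, dist_eq_norm, sub_sub_cancel, Real.norm_eq_abs] at h1
      have h2 := (abs_le.1 h1).2
      have h3 := (abs_le.1 hτ).1
      have h4 : (K : ℝ) * ‖b‖ ≤ K * (ε * c) := by gcongr
      have h5 : ε * c + K * (ε * c) = ε := by
        calc ε * c + K * (ε * c) = ε * (c * (1 + K)) := by ring
          _ = ε := by rw [hc1, mul_one]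
      linarith

end Charts

/-! ### L² bounds for finite sums and bounded multipliers -/

section ELpNormBounds

variable {F : Type*} [NormedAddCommGroup F]

theorem eLpNorm_two_sum_le {ι : Type*} (s : Finset ι) {X : Type*} [MeasurableSpace X]
    {μ : Measure X} {f : ι → X → F} {b : ι → ℝ≥0∞} (hf : ∀ i ∈ s, AEStronglyMeasurable (f i) μ)
    (h : ∀ i ∈ s, eLpNorm (f i) 2 μ ≤ b i) :
    eLpNorm (fun x => ∑ i ∈ s, f i x) 2 μ ≤ ∑ i ∈ s, b i := by
  have h1 := eLpNorm_sum_le (p := 2) hf (by norm_num)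
  have h2 : (fun x => ∑ i ∈ s, f i x) = ∑ i ∈ s, f i := by ext x; simp
  rw [h2]
  exact h1.trans (Finset.sum_le_sum h)

theorem eLpNorm_smul_le_of_bound [NormedSpace ℝ F] {X : Type*} [MeasurableSpace X] {μ : Measure X} {a : X → ℝ}
    {g : X → F} {B : ℝ} {δ : ℝ≥0∞} (ha : ∀ x, |a x| ≤ B) (hg : eLpNorm g 2 μ ≤ δ) :
    eLpNorm (fun x => a x • g x) 2 μ ≤ ENNReal.ofReal B * δ := by
  refine (eLpNorm_le_mul_eLpNorm_of_ae_le_mul (Eventually.of_forall fun x => ?_) 2).trans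
    (mul_le_mul_right hg _)
  rw [norm_smul]
  exact mul_le_mul_of_nonneg_right (ha x) (norm_nonneg _)

end ELpNormBounds

/-! ### Density of smooth functions in H¹ -/

section Density

variable {F : Type*} [NormedAddCommGroup F] [NormedSpace ℝ F] [CompleteSpace F] {d : ℕ}

/-- Finitely many balls with an inner direction cover the compact closure of Ω, and a smooth
partition of unity subordinate to them is taken. Where θ i is nonzero, the inner direction of the
i-th ball is available. -/
theorem IsPolyhedralDomain.exists_partition (hd : 1 ≤ d) {Ω : Set (E d)}
    (hΩ : IsPolyhedralDomain Ω) :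
    ∃ (ι : Type) (_ : Fintype ι) (θ : ι → E d → ℝ) (e : ι → E d) (c ε₀ : ι → ℝ),
      (∀ i, ContDiff ℝ ∞ (θ i)) ∧ (∀ i, HasCompactSupport (θ i)) ∧ (∀ i x, |θ i x| ≤ 1) ∧
      (∀ x ∈ Ω, ∑ i, θ i x = 1) ∧ (∀ i, 0 < c i) ∧ (∀ i, 0 < ε₀ i) ∧
      ∀ i, ∀ x ∈ Ω, θ i x ≠ 0 → ∀ ε, 0 < ε → ε < ε₀ i →
        ∀ t ∈ Metric.closedBall (ε • e i) (ε * c i), x - t ∈ Ω := by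
  have hcomp : IsCompact (closure Ω) := hΩ.isBounded.isCompact_closure
  choose! r hr e c hc ε₀ hε₀ H using fun x₀ (h : x₀ ∈ closure Ω) => hΩ.exists_inner_direction hd h
  obtain ⟨T, hT, hcov⟩ := hcomp.elim_nhds_subcover (fun x => Metric.ball x (r x))
    (fun x hx => Metric.ball_mem_nhds x (hr x hx))
  obtain ⟨n, ⟨eqv⟩⟩ : ∃ n, Nonempty (Fin n ≃ T) := ⟨_, ⟨T.equivFin.symm⟩⟩
  obtain ⟨f, hf⟩ := SmoothPartitionOfUnity.exists_isSubordinate (ι := Fin n)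
    (modelWithCornersSelf ℝ (E d)) isClosed_closure
    (fun i => Metric.ball (eqv i : E d) (r (eqv i))) (fun i => Metric.isOpen_ball) (by
      intro x hx
      obtain ⟨y, hy, hxy⟩ := mem_iUnion₂.1 (hcov hx)
      exact mem_iUnion.2 ⟨eqv.symm ⟨y, hy⟩, by simpa using hxy⟩)
  have hmem : ∀ i, (eqv i : E d) ∈ closure Ω := fun i => hT _ (eqv i).2
  refine ⟨Fin n, inferInstance, fun i x => f i x, fun i => e (eqv i), fun i => c (eqv i),
    fun i => ε₀ (eqv i), fun i => (f i).contMDiff.contDiff, fun i => ?_, fun i x => ?_,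
    fun x hx => ?_, fun i => hc _ (hmem i), fun i => hε₀ _ (hmem i), fun i x hx hne => ?_⟩
  · exact Metric.isCompact_of_isClosed_isBounded isClosed_closure
      (Metric.isBounded_ball.subset (hf i))
  · rw [abs_of_nonneg (f.nonneg i x)]
    exact f.le_one i x
  · have := f.sum_eq_one (subset_closure hx)
    rwa [finsum_eq_sum_of_fintype] at this
  · exact H _ (hmem i) x ⟨hx, hf i (subset_closure hne)⟩

/-- The approximant is ∑ θᵢ (ηᵢ * v₀), where v₀ extends v by zero and ηᵢ is shifted along the i-th
inner direction. Its error and the error of its gradient are combinations, with bounded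
coefficients, of the mollification errors of v₀ and of the zero extensions of the weak derivatives.
-/
theorem IsPolyhedralDomain.exists_smooth_close (hd : 1 ≤ d) {Ω : Set (E d)}
    (hΩ : IsPolyhedralDomain Ω) {v : E d → F} (hv : MemSobolev 1 Ω v) :
    ∃ C : ℝ≥0∞, C ≠ ⊤ ∧ ∀ δ : ℝ≥0∞, 0 < δ →
      ∃ φ : E d → F, ContDiff ℝ ∞ φ ∧ eSobolevNorm 1 Ω (fun x => φ x - v x) ^ 2 ≤ C * δ ^ 2 := by
  obtain ⟨hvl, hv2, w, hw, hw2⟩ := hv.exists_weakDeriv hΩ.isOpen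
  obtain ⟨ι, _, θ, e, c, ε₀, hθs, hθc, hθ1, hθsum, hc, hε₀, H⟩ := hΩ.exists_partition hd
  have hms : MeasurableSet Ω := hΩ.isOpen.measurableSet
  have hB : ∀ i (k : Fin d), ∃ B : ℝ, ∀ x, |fderiv ℝ (θ i) x (EuclideanSpace.single k 1)| ≤ B := by
    intro i k
    have h1 : Continuous (fun x => fderiv ℝ (θ i) x (EuclideanSpace.single k 1)) := by
      have := (hθs i).continuous_fderiv (by simp)
      fun_prop
    exact ((hθc i).fderiv_apply (𝕜 := ℝ) _).exists_bound_of_continuous h1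
  choose B hB using hB
  set f₀ : E d → F := Ω.indicator v with hf₀
  set f : Fin d → E d → F := fun k => Ω.indicator (w k) with hf
  have hf₀2 : MemLp f₀ 2 volume := (memLp_indicator_iff_restrict hms).2 hv2
  have hf2 : ∀ k, MemLp (f k) 2 volume := fun k => (memLp_indicator_iff_restrict hms).2 (hw2 k)
  have hf₀l : LocallyIntegrable f₀ volume := hf₀2.locallyIntegrable (by norm_num)
  have hfl : ∀ k, LocallyIntegrable (f k) volume := fun k => (hf2 k).locallyIntegrable (by norm_num)
  -- The first square comes from |θᵢ| ≤ 1 in the L² error. The others come from |∂ₖθᵢ| ≤ `B i k` and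
  -- |θᵢ| ≤ 1 in the product rule for the k-th derivative.
  refine ⟨(∑ _i : ι, 1) ^ 2 + ∑ k, (∑ i, (ENNReal.ofReal (B i k) + 1)) ^ 2, ?_, ?_⟩
  · refine ENNReal.add_ne_top.2 ⟨by simp, (ENNReal.sum_lt_top.2 fun k _ => ?_).ne⟩
    exact ENNReal.pow_lt_top (ENNReal.sum_lt_top.2 fun i _ => by simp)
  intro δ hδ
  have hev : ∀ᶠ ε in 𝓝[>] (0 : ℝ), 0 < ε ∧ (∀ i, ε < ε₀ i) ∧
      (∀ i, ∀ η, IsMollifier η (ε • e i) (ε * c i) →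
        eLpNorm (fun x => moll η f₀ x - f₀ x) 2 volume ≤ δ) ∧
      (∀ i k, ∀ η, IsMollifier η (ε • e i) (ε * c i) →
        eLpNorm (fun x => moll η (f k) x - f k x) 2 volume ≤ δ) := by
    refine eventually_mem_nhdsWithin.and ((eventually_all.2 fun i => ?_).and
      ((eventually_all.2 fun i => ?_).and (eventually_all.2 fun i => eventually_all.2 fun k => ?_)))
    · exact (eventually_lt_nhds (hε₀ i)).filter_mono nhdsWithin_le_nhds
    · exact eventually_eLpNorm_moll_sub_le hf₀2 hδ _ _
    · exact eventually_eLpNorm_moll_sub_le (hf2 k) hδ _ _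
  obtain ⟨ε, hε, hεlt, h0, hk⟩ := hev.exists
  choose η hη using fun i => exists_isMollifier (ε • e i) (mul_pos hε (hc i))
  have hms0 : ∀ i, ContDiff ℝ ∞ (moll (η i) f₀) := fun i => (hη i).contDiff_moll hf₀l
  have hmsk : ∀ i k, ContDiff ℝ ∞ (moll (η i) (f k)) := fun i k => (hη i).contDiff_moll (hfl k)
  set u : E d → F := fun x => ∑ i, θ i x • moll (η i) f₀ x with hu
  have hus : ContDiff ℝ ∞ u := ContDiff.sum fun i _ => (hθs i).smul (hms0 i)
  refine ⟨u, hus, ?_⟩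
  have hwk : ∀ k, IsWeakDeriv Ω (fun _ : Fin 1 => k) (fun x => u x - v x)
      (fun x => fderiv ℝ u x (EuclideanSpace.single k 1) - w k x) := fun k =>
    (isWeakDeriv_of_contDiff hus).sub (hw k)
  have hloc : LocallyIntegrableOn (fun x => u x - v x) Ω volume :=
    (hus.continuous.locallyIntegrable.locallyIntegrableOn Ω).sub hvl
  rw [eSobolevNorm_one_sq hΩ.isOpen hloc hwk]
  have e0 : ∀ x ∈ Ω, u x - v x = ∑ i, θ i x • (moll (η i) f₀ x - f₀ x) := by
    intro x hx
    simp only [smul_sub, Finset.sum_sub_distrib]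
    rw [← Finset.sum_smul, hθsum x hx, one_smul, hf₀, indicator_of_mem hx]
  have hdsum : ∀ x ∈ Ω, ∀ k : Fin d,
      ∑ i, fderiv ℝ (θ i) x (EuclideanSpace.single k 1) = 0 := by
    intro x hx k
    have h1 : (fun x => ∑ i, θ i x) =ᶠ[𝓝 x] fun _ => 1 := by
      filter_upwards [hΩ.isOpen.mem_nhds hx] with z hz using hθsum z hz
    have h2 := h1.fderiv_eq (𝕜 := ℝ)
    rw [fderiv_fun_sum fun i _ => (hθs i).differentiable (by simp) x] at h2
    have h3 := congrArg (fun A => A (EuclideanSpace.single k 1)) h2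
    simpa using h3
  -- Because ∑ θᵢ = 1 on Ω gives ∑ ∂ₖθᵢ = 0 there, v₀ can be subtracted inside the terms carrying
  -- ∂ₖθᵢ, so that these also become mollification errors.
  have ek : ∀ k, ∀ x ∈ Ω, fderiv ℝ u x (EuclideanSpace.single k 1) - w k x =
      ∑ i, (fderiv ℝ (θ i) x (EuclideanSpace.single k 1) • (moll (η i) f₀ x - f₀ x)
        + θ i x • (moll (η i) (f k) x - f k x)) := by
    intro k x hx
    have h1 : fderiv ℝ u x (EuclideanSpace.single k 1) =
        ∑ i, (θ i x • moll (η i) (f k) x +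
          fderiv ℝ (θ i) x (EuclideanSpace.single k 1) • moll (η i) f₀ x) := by
      have hdiff : ∀ i ∈ Finset.univ,
          DifferentiableAt ℝ (fun x => θ i x • moll (η i) f₀ x) x := fun i _ =>
        ((hθs i).differentiable (by simp) x).smul ((hms0 i).differentiable (by simp) x)
      rw [hu, fderiv_fun_sum hdiff, sum_apply]
      refine Finset.sum_congr rfl fun i _ => ?_
      rw [fderiv_fun_smul ((hθs i).differentiable (by simp) x)
        ((hms0 i).differentiable (by simp) x)]
      simp only [add_apply, smul_apply,
        ContinuousLinearMap.smulRight_apply]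
      congr 1
      -- Differentiating under the mollifier is legitimate only where the shifted kernel stays in Ω.
      -- Elsewhere the factor θ i x vanishes.
      by_cases hne : θ i x = 0
      · simp [hne]
      · rw [hf₀, (hη i).fderiv_moll_indicator hΩ.isOpen hf₀l (hw k)
          (H i x hx hne ε hε (hεlt i))]
    rw [h1]
    simp only [smul_sub, Finset.sum_add_distrib, Finset.sum_sub_distrib]
    rw [← Finset.sum_smul, ← Finset.sum_smul, hθsum x hx, hdsum x hx k, one_smul, zero_smul, hf]
    simp only [indicator_of_mem hx]
    abel
  have hr : ∀ {g : E d → F}, eLpNorm g 2 (volume.restrict Ω) ≤ eLpNorm g 2 volume := fun {g} =>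
    eLpNorm_restrict_le _ _ _ _
  have m0 : ∀ i, AEStronglyMeasurable (fun x => moll (η i) f₀ x - f₀ x) (volume.restrict Ω) :=
    fun i => ((hms0 i).continuous.aestronglyMeasurable.sub hf₀2.1).restrict
  have mk : ∀ i k, AEStronglyMeasurable (fun x => moll (η i) (f k) x - f k x)
      (volume.restrict Ω) :=
    fun i k => ((hmsk i k).continuous.aestronglyMeasurable.sub (hf2 k).1).restrict
  have mθ : ∀ i, AEStronglyMeasurable (θ i) (volume.restrict Ω) :=
    fun i => (hθs i).continuous.aestronglyMeasurable
  have mθd : ∀ i (k : Fin d), AEStronglyMeasurable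
      (fun x => fderiv ℝ (θ i) x (EuclideanSpace.single k 1)) (volume.restrict Ω) := fun i k => by
    have := (hθs i).continuous_fderiv (by simp)
    exact Continuous.aestronglyMeasurable (by fun_prop)
  have b0 : ∀ i, eLpNorm (fun x => θ i x • (moll (η i) f₀ x - f₀ x)) 2 (volume.restrict Ω) ≤ δ := by
    intro i
    have := eLpNorm_smul_le_of_bound (hθ1 i) (hr.trans (h0 i (η i) (hη i)))
    simpa using this
  have bk : ∀ i k, eLpNorm (fun x => fderiv ℝ (θ i) x (EuclideanSpace.single k 1) •
      (moll (η i) f₀ x - f₀ x) + θ i x • (moll (η i) (f k) x - f k x)) 2 (volume.restrict Ω) ≤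
      (ENNReal.ofReal (B i k) + 1) * δ := by
    intro i k
    have h1 := eLpNorm_smul_le_of_bound (hB i k) (hr.trans (h0 i (η i) (hη i)))
    have h2 := eLpNorm_smul_le_of_bound (hθ1 i) (hr.trans (hk i k (η i) (hη i)))
    refine (eLpNorm_add_le ((mθd i k).smul (m0 i)) ((mθ i).smul (mk i k)) (by norm_num)).trans ?_
    rw [add_mul]
    refine add_le_add h1 ?_
    rw [ENNReal.ofReal_one] at h2
    exact h2
  rw [add_mul, Finset.sum_mul]
  refine add_le_add ?_ (Finset.sum_le_sum fun k _ => ?_)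
  · rw [setLIntegral_congr_fun hms (g := fun x => ‖∑ i, θ i x • (moll (η i) f₀ x - f₀ x)‖ₑ ^ 2)
      (fun x hx => by simp only [e0 x hx]), ← eLpNorm_two_sq, ← mul_pow, Finset.sum_mul, ]
    simp only [one_mul]
    gcongr
    exact eLpNorm_two_sum_le _ (fun i _ => (mθ i).smul (m0 i)) fun i _ => b0 i
  · rw [setLIntegral_congr_fun hms (fun x hx => by rw [ek k x hx]), ← eLpNorm_two_sq, ← mul_pow,
      Finset.sum_mul]
    gcongr
    exact eLpNorm_two_sum_le _
      (fun i _ => ((mθd i k).smul (m0 i)).add ((mθ i).smul (mk i k))) fun i _ => bk i k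

/-- Functions that are smooth on the whole space are dense in `H^1(Ω)`. -/
theorem IsPolyhedralDomain.exists_smooth_tendsto (hd : 1 ≤ d) {Ω : Set (E d)}
    (hΩ : IsPolyhedralDomain Ω) {v : E d → F} (hv : MemSobolev 1 Ω v) :
    ∃ φ : ℕ → E d → F, (∀ n, ContDiff ℝ ∞ (φ n)) ∧
      Tendsto (fun n => eSobolevNorm 1 Ω (fun x => φ n x - v x)) atTop (𝓝 0) := by
  obtain ⟨C, hC, h⟩ := hΩ.exists_smooth_close hd hv
  choose φ hφ hφ' using fun n : ℕ => h (((n : ℝ≥0∞) + 1)⁻¹) (by simp)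
  refine ⟨φ, hφ, ?_⟩
  have h1 : Tendsto (fun n : ℕ => ((n : ℝ≥0∞) + 1)⁻¹) atTop (𝓝 0) := by
    have := (tendsto_add_atTop_iff_nat 1).2 ENNReal.tendsto_inv_nat_nhds_zero
    simpa using this
  have h2 : Tendsto (fun n : ℕ => C * (((n : ℝ≥0∞) + 1)⁻¹) ^ 2) atTop (𝓝 0) := by
    have := ENNReal.Tendsto.const_mul (a := C) (ENNReal.Tendsto.pow (n := 2) h1) (Or.inr hC)
    simpa using this
  have h3 := tendsto_of_tendsto_of_tendsto_of_le_of_le tendsto_const_nhds h2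
    (fun n => zero_le) hφ'
  have h4 := (ENNReal.continuous_rpow_const (y := (1 / 2 : ℝ))).tendsto 0 |>.comp h3
  have h5 : ∀ a : ℝ≥0∞, (a ^ 2) ^ (1 / 2 : ℝ) = a := fun a => by
    rw [← ENNReal.rpow_natCast, ← ENNReal.rpow_mul]; norm_num
  simp only [Function.comp_def, h5] at h4
  simpa using h4

end Density

/-! ### Increments of smooth functions along Lipschitz curves -/

section CurveBound

variable {F : Type*} [NormedAddCommGroup F] [NormedSpace ℝ F] {d : ℕ}

/-- Curves following a Lipschitz graph need not be differentiable, so the chain rule is replaced by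
a comparison principle: the right slopes of ‖f(γ s) - f(γ a)‖ are eventually below any number
exceeding K‖f'(γ s)‖. -/
theorem norm_sub_le_integral_of_lipschitz {f : E d → F} (hf : ContDiff ℝ 1 f) {γ : ℝ → E d}
    {K : NNReal} (hγ : LipschitzWith K γ) {a b : ℝ} (hab : a ≤ b) :
    ‖f (γ b) - f (γ a)‖ ≤ ∫ s in a..b, K * ‖fderiv ℝ f (γ s)‖ := by
  have hK : (0 : ℝ) ≤ K := K.2
  have hc : Continuous (fun s => (K : ℝ) * ‖fderiv ℝ f (γ s)‖) := by
    have h1 := hf.continuous_fderiv one_ne_zero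
    have h2 := hγ.continuous
    fun_prop
  have hfγ : Continuous (fun s => f (γ s) - f (γ a)) :=
    (hf.continuous.comp hγ.continuous).sub continuous_const
  refine le_of_forall_pos_le_add fun ε hε => ?_
  obtain ⟨η, hη, hηε⟩ : ∃ η > 0, η * (b - a) ≤ ε := by
    refine ⟨ε / (b - a + 1), by have := sub_nonneg.2 hab; positivity, ?_⟩
    rw [div_mul_eq_mul_div, div_le_iff₀ (by linarith)]
    nlinarith
  -- The slack η(s - a) makes the required inequality between the slope bound and the derivative of
  -- the majorant strict. Its total contribution is at most ε.
  have key := image_norm_le_of_liminf_right_slope_norm_lt_deriv_boundary (a := a) (b := b)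
    (f := fun s => f (γ s) - f (γ a)) (f' := fun s => K * ‖fderiv ℝ f (γ s)‖)
    (B := fun s => (∫ σ in a..s, K * ‖fderiv ℝ f (γ σ)‖) + η * (s - a))
    (B' := fun s => K * ‖fderiv ℝ f (γ s)‖ + η) hfγ.continuousOn ?_ (by simp) ?_ ?_ ?_
    (right_mem_Icc.2 hab)
  · exact key.trans (add_le_add le_rfl hηε)
  · intro x _ r hr
    obtain ⟨c, hc0, hc1⟩ : ∃ c > 0, (‖fderiv ℝ f (γ x)‖ + c) * K < r := by
      have hlim : ContinuousAt (fun c : ℝ => (‖fderiv ℝ f (γ x)‖ + c) * K) 0 := by fun_prop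
      have h1 : Tendsto (fun c : ℝ => (‖fderiv ℝ f (γ x)‖ + c) * K) (𝓝[>] 0)
          (𝓝 ((‖fderiv ℝ f (γ x)‖ + 0) * K)) := hlim.tendsto.mono_left nhdsWithin_le_nhds
      have h2 := h1.eventually_lt_const (u := r) (by rw [add_zero, mul_comm]; exact hr)
      obtain ⟨c, hc, hc'⟩ := (h2.and self_mem_nhdsWithin).exists
      exact ⟨c, hc', hc⟩
    have hd := (hf.differentiable one_ne_zero (γ x)).hasFDerivAt.isLittleO
    have hd' := hγ.continuous.continuousAt.eventually (hd.def hc0)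
    have hev : ∀ᶠ z in 𝓝[>] x,
        slope (norm ∘ fun s => f (γ s) - f (γ a)) x z < r := by
      filter_upwards [hd'.filter_mono nhdsWithin_le_nhds, self_mem_nhdsWithin] with z hz hxz
      have hxz' : 0 < z - x := sub_pos.2 hxz
      have h1 : ‖f (γ z) - f (γ x)‖ ≤ (‖fderiv ℝ f (γ x)‖ + c) * ‖γ z - γ x‖ := by
        have e : f (γ z) - f (γ x) = (f (γ z) - f (γ x) - fderiv ℝ f (γ x) (γ z - γ x)) +
            fderiv ℝ f (γ x) (γ z - γ x) := by abel
        rw [e]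
        refine (norm_add_le _ _).trans ?_
        have := (fderiv ℝ f (γ x)).le_opNorm (γ z - γ x)
        linarith
      have h2 : ‖γ z - γ x‖ ≤ K * (z - x) := by
        have := hγ.dist_le_mul z x
        rwa [dist_eq_norm, Real.dist_eq, abs_of_pos hxz'] at this
      have h3 : ‖f (γ z) - f (γ a)‖ - ‖f (γ x) - f (γ a)‖ ≤ ‖f (γ z) - f (γ x)‖ := by
        have := norm_sub_norm_le (f (γ z) - f (γ a)) (f (γ x) - f (γ a))
        simpa using this
      rw [slope_def_field, Function.comp, Function.comp, div_lt_iff₀ hxz']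
      calc _ ≤ (‖fderiv ℝ f (γ x)‖ + c) * ‖γ z - γ x‖ := h3.trans h1
        _ ≤ (‖fderiv ℝ f (γ x)‖ + c) * (K * (z - x)) := by gcongr
        _ = ((‖fderiv ℝ f (γ x)‖ + c) * K) * (z - x) := by ring
        _ < r * (z - x) := by gcongr
    exact hev.frequently
  · have : Continuous fun s => ∫ σ in a..s, K * ‖fderiv ℝ f (γ σ)‖ :=
      intervalIntegral.continuous_primitive (fun _ _ => hc.intervalIntegrable _ _) a
    exact Continuous.continuousOn (by fun_prop)
  · intro x _
    have h1 : HasDerivAt (fun s => ∫ σ in a..s, K * ‖fderiv ℝ f (γ σ)‖)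
        (K * ‖fderiv ℝ f (γ x)‖) x := hc.integral_hasStrictDerivAt a x |>.hasDerivAt
    have h2 : HasDerivAt (fun s => η * (s - a)) η x := by
      simpa using ((hasDerivAt_id x).sub_const a).const_mul η
    exact (h1.add h2).hasDerivWithinAt
  · intro x _ _
    linarith

theorem enorm_sub_le_lintegral_of_lipschitz {f : E d → F} (hf : ContDiff ℝ 1 f) {γ : ℝ → E d}
    {K : NNReal} (hγ : LipschitzWith K γ) {a b : ℝ} (hab : a ≤ b) :
    ‖f (γ b) - f (γ a)‖ₑ ≤ K * ∫⁻ s in Ioc a b, ‖fderiv ℝ f (γ s)‖ₑ := by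
  have hK : (0 : ℝ) ≤ K := K.2
  have hc : Continuous (fun s => (K : ℝ) * ‖fderiv ℝ f (γ s)‖) := by
    have h1 := hf.continuous_fderiv one_ne_zero
    have h2 := hγ.continuous
    fun_prop
  have h := ENNReal.ofReal_le_ofReal (norm_sub_le_integral_of_lipschitz hf hγ hab)
  rw [ofReal_norm, intervalIntegral.integral_of_le hab, ofReal_integral_eq_lintegral_ofReal
    ((hc.intervalIntegrable a b).1) (Eventually.of_forall fun s => by positivity)] at h
  refine h.trans (le_of_eq ?_)
  rw [← lintegral_const_mul' _ _ ENNReal.coe_ne_top]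
  refine lintegral_congr fun s => ?_
  rw [ENNReal.ofReal_mul hK, ofReal_norm, ENNReal.ofReal_coe_nnreal]

end CurveBound

/-! ### Hardy's inequality -/

section Hardy

theorem lintegral_Ioc_rpow_neg_half {r : ℝ} (hr : 0 < r) :
    ∫⁻ s in Ioc 0 r, ENNReal.ofReal (s ^ (-(1 / 2) : ℝ)) = ENNReal.ofReal (2 * r ^ (1 / 2 : ℝ)) := by
  have hi : IntervalIntegrable (fun s : ℝ => s ^ (-(1 / 2) : ℝ)) volume 0 r :=
    intervalIntegral.intervalIntegrable_rpow' (by norm_num)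
  rw [← ofReal_integral_eq_lintegral_ofReal hi.1, ← intervalIntegral.integral_of_le hr.le,
    integral_rpow (Or.inl (by norm_num))]
  · congr 1
    norm_num
    ring
  · filter_upwards [ae_restrict_mem measurableSet_Ioc] with s hs
    exact Real.rpow_nonneg hs.1.le _

theorem lintegral_Ioi_rpow_neg {s : ℝ} (hs : 0 < s) :
    ∫⁻ r in Ioi s, ENNReal.ofReal (r ^ (-(3 / 2) : ℝ)) =
      ENNReal.ofReal (2 * s ^ (-(1 / 2) : ℝ)) := by
  rw [← ofReal_integral_eq_lintegral_ofReal (integrableOn_Ioi_rpow_of_lt (by norm_num) hs),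
    integral_Ioi_rpow_of_lt (by norm_num) hs]
  · congr 1
    norm_num
    ring
  · filter_upwards [ae_restrict_mem measurableSet_Ioi] with r hr
    exact Real.rpow_nonneg (hs.le.trans (le_of_lt hr)) _

/-- Cauchy–Schwarz applied to ψ = s^{-1/4} · s^{1/4} ψ. This weight keeps ∫₀^r s^{-1/2} ds finite
and leaves a kernel that is integrable at infinity in r after division by r². -/
theorem lintegral_Ioc_sq_le {ψ : ℝ → ℝ≥0∞} (hψ : Measurable ψ) {r : ℝ} (hr : 0 < r) :
    (∫⁻ s in Ioc 0 r, ψ s) ^ 2 ≤ ENNReal.ofReal (2 * r ^ (1 / 2 : ℝ)) *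
      ∫⁻ s in Ioc 0 r, ENNReal.ofReal (s ^ (1 / 2 : ℝ)) * ψ s ^ 2 := by
  have h1 : ∫⁻ s in Ioc 0 r, ψ s = ∫⁻ s in Ioc 0 r,
      ENNReal.ofReal (s ^ (-(1 / 4) : ℝ)) * (ENNReal.ofReal (s ^ (1 / 4 : ℝ)) * ψ s) := by
    refine setLIntegral_congr_fun measurableSet_Ioc fun s hs => ?_
    have hs0 : 0 < s := hs.1
    rw [← mul_assoc, ← ENNReal.ofReal_mul (by positivity), ← Real.rpow_add hs0]
    norm_num
  rw [h1]
  refine (lintegral_mul_sq_le (by fun_prop) (by fun_prop)).trans (le_of_eq ?_)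
  rw [← lintegral_Ioc_rpow_neg_half hr]
  congr 1
  · refine setLIntegral_congr_fun measurableSet_Ioc fun s hs => ?_
    have hs0 : 0 < s := hs.1
    rw [← ENNReal.ofReal_pow (by positivity), ← Real.rpow_natCast, ← Real.rpow_mul hs0.le]
    norm_num
  · refine setLIntegral_congr_fun measurableSet_Ioc fun s hs => ?_
    have hs0 : 0 < s := hs.1
    rw [mul_pow, ← ENNReal.ofReal_pow (by positivity), ← Real.rpow_natCast (s ^ (1 / 4 : ℝ)),
      ← Real.rpow_mul hs0.le]
    norm_num

/-- Hardy's inequality in `L²(0, ∞)`. -/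
theorem hardy_inequality {ψ : ℝ → ℝ≥0∞} (hψ : Measurable ψ) :
    ∫⁻ r in Ioi (0 : ℝ), ((∫⁻ s in Ioc 0 r, ψ s) / ENNReal.ofReal r) ^ 2 ≤
      4 * ∫⁻ s in Ioi (0 : ℝ), ψ s ^ 2 := by
  -- The kernel 2 r^{-3/2} s^{1/2} ψ(s)² on s ≤ r. Integrating first in r over (s, ∞) gives 4
  -- s^{-1/2}, which cancels s^{1/2}; this is the constant 4.
  let k : ℝ → ℝ → ℝ≥0∞ := fun r s => {p : ℝ × ℝ | p.2 ≤ p.1}.indicator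
    (fun p => ENNReal.ofReal (2 * p.1 ^ (-(3 / 2) : ℝ)) *
      (ENNReal.ofReal (p.2 ^ (1 / 2 : ℝ)) * ψ p.2 ^ 2)) (r, s)
  have hk : Measurable (Function.uncurry k) := by
    refine Measurable.indicator ?_ (measurableSet_le measurable_snd measurable_fst)
    fun_prop
  calc ∫⁻ r in Ioi (0 : ℝ), ((∫⁻ s in Ioc 0 r, ψ s) / ENNReal.ofReal r) ^ 2
      ≤ ∫⁻ r in Ioi (0 : ℝ), ∫⁻ s in Ioi (0 : ℝ), k r s := by
        refine setLIntegral_mono' measurableSet_Ioi fun r hr => ?_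
        have hr0 : 0 < r := hr
        have e : ∫⁻ s in Ioi (0 : ℝ), k r s = ENNReal.ofReal (2 * r ^ (-(3 / 2) : ℝ)) *
            ∫⁻ s in Ioc 0 r, ENNReal.ofReal (s ^ (1 / 2 : ℝ)) * ψ s ^ 2 := by
          rw [← lintegral_const_mul' _ _ ENNReal.ofReal_ne_top,
            ← lintegral_indicator measurableSet_Ioi, ← lintegral_indicator measurableSet_Ioc]
          refine lintegral_congr fun s => ?_
          simp only [k, indicator_apply, mem_Ioi, mem_Ioc, mem_ofPred_eq]
          by_cases h1 : 0 < s <;> by_cases h2 : s ≤ r <;> simp [h1, h2]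
        rw [e, ENNReal.div_eq_inv_mul, mul_pow, ← ENNReal.ofReal_inv_of_pos hr0,
          ← ENNReal.ofReal_pow (by positivity)]
        calc _ ≤ ENNReal.ofReal (r⁻¹ ^ 2) * (ENNReal.ofReal (2 * r ^ (1 / 2 : ℝ)) *
              ∫⁻ s in Ioc 0 r, ENNReal.ofReal (s ^ (1 / 2 : ℝ)) * ψ s ^ 2) := by
              gcongr
              exact lintegral_Ioc_sq_le hψ hr0
          _ = _ := by
              rw [← mul_assoc, ← ENNReal.ofReal_mul (by positivity)]
              congr 2
              have : r⁻¹ ^ 2 = r ^ (-2 : ℝ) := by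
                rw [Real.rpow_neg hr0.le, inv_pow]; norm_num
              rw [this, mul_left_comm, ← Real.rpow_add hr0]
              norm_num
    _ = ∫⁻ s in Ioi (0 : ℝ), ∫⁻ r in Ioi (0 : ℝ), k r s :=
        lintegral_lintegral_swap hk.aemeasurable
    _ = ∫⁻ s in Ioi (0 : ℝ), 4 * ψ s ^ 2 := by
        refine setLIntegral_congr_fun measurableSet_Ioi fun s hs => ?_
        have hs0 : 0 < s := hs
        have e : ∫⁻ r in Ioi (0 : ℝ), k r s = ∫⁻ r in Ioi s,
            ENNReal.ofReal (r ^ (-(3 / 2) : ℝ)) *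
              (2 * (ENNReal.ofReal (s ^ (1 / 2 : ℝ)) * ψ s ^ 2)) := by
          rw [Measure.restrict_congr_set (Ioi_ae_eq_Ici (a := s))]
          rw [← lintegral_indicator measurableSet_Ioi, ← lintegral_indicator measurableSet_Ici]
          refine lintegral_congr fun r => ?_
          simp only [k, indicator_apply, mem_Ioi, mem_Ici, mem_ofPred_eq]
          by_cases h2 : s ≤ r
          · have h1 : 0 < r := hs0.trans_le h2
            simp only [h1, h2, if_true]
            rw [ENNReal.ofReal_mul (by norm_num)]
            simp only [ENNReal.ofReal_ofNat]
            ring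
          · simp [h2]
        rw [e, lintegral_mul_const _ (by fun_prop), lintegral_Ioi_rpow_neg hs0]
        rw [← mul_assoc, ← mul_assoc, mul_comm _ (2 : ℝ≥0∞), mul_assoc (2 : ℝ≥0∞),
          ← ENNReal.ofReal_mul (by positivity), mul_assoc (2 : ℝ) (s ^ (-(1 / 2) : ℝ)),
          ← Real.rpow_add hs0]
        norm_num
    _ = 4 * ∫⁻ s in Ioi (0 : ℝ), ψ s ^ 2 := lintegral_const_mul _ (by fun_prop)

end Hardy

/-! ### Polar coordinates for radial functions -/

section Polar

theorem lintegral_fun_norm {n : ℕ} (hn : 1 ≤ n) {f : ℝ → ℝ≥0∞} (hf : Measurable f) :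
    ∫⁻ z : E n, f ‖z‖ = (volume : Measure (E n)).toSphere univ *
      ∫⁻ r in Ioi (0 : ℝ), ENNReal.ofReal (r ^ (n - 1)) * f r := by
  have : Nonempty (Fin n) := ⟨⟨0, hn⟩⟩
  have : Nontrivial (E n) := inferInstance
  set μ : Measure (E n) := volume
  have hfin : Module.finrank ℝ (E n) = n := by simp
  calc ∫⁻ z : E n, f ‖z‖ = ∫⁻ z : ({(0 : E n)}ᶜ : Set (E n)), f ‖(z : E n)‖ ∂(μ.comap (↑)) := by
        rw [lintegral_subtype_comap (measurableSet_singleton _).compl (fun z => f ‖z‖),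
          restrict_compl_singleton]
    _ = ∫⁻ p, f (p.2 : ℝ) ∂(μ.toSphere.prod (Measure.volumeIoiPow (n - 1))) := by
        have h := μ.measurePreserving_homeomorphUnitSphereProd
        rw [hfin] at h
        rw [← h.lintegral_comp (f := fun p => f (p.2 : ℝ)) (by fun_prop)]
        simp
    _ = μ.toSphere univ * ∫⁻ r : Ioi (0 : ℝ), f r ∂(Measure.volumeIoiPow (n - 1)) := by
        rw [lintegral_prod _ (by fun_prop)]
        simp [mul_comm]
    _ = _ := by
        rw [Measure.volumeIoiPow, lintegral_withDensity_eq_lintegral_mul _ (by fun_prop)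
          (by fun_prop)]
        congr 1
        exact lintegral_subtype_comap measurableSet_Ioi
          (fun r : ℝ => ENNReal.ofReal (r ^ (n - 1)) * f r)

end Polar

/-! ### Gagliardo's estimate over a flat parameter domain -/

section FlatTrace

variable {F : Type*} [NormedAddCommGroup F] {n : ℕ}

theorem ennreal_add_three_sq_le (a b c : ℝ≥0∞) :
    (a + b + c) ^ 2 ≤ 4 * (a ^ 2 + b ^ 2 + c ^ 2) := by
  calc (a + b + c) ^ 2 ≤ 2 * ((a + b) ^ 2 + c ^ 2) := ennreal_add_sq_le _ _
    _ ≤ 2 * (2 * (a ^ 2 + b ^ 2) + 2 * c ^ 2) := by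
      gcongr
      · exact ennreal_add_sq_le _ _
      · rw [two_mul]; exact le_self_add
    _ = 4 * (a ^ 2 + b ^ 2 + c ^ 2) := by ring

/-- The integral of `ψ (a, ·)` over the segment of length `r` below `a`. -/
def depthIntegral (ψ : E n × ℝ → ℝ≥0∞) (a : E n) (r : ℝ) : ℝ≥0∞ := ∫⁻ s in Ioc 0 r, ψ (a, s)

theorem measurable_depthIntegral {ψ : E n × ℝ → ℝ≥0∞} (hψ : Measurable ψ) :
    Measurable (fun p : E n × ℝ => depthIntegral ψ p.1 p.2) := by
  have e : (fun p : E n × ℝ => depthIntegral ψ p.1 p.2) = fun p => ∫⁻ s,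
      {q : (E n × ℝ) × ℝ | 0 < q.2 ∧ q.2 ≤ q.1.2}.indicator (fun q => ψ (q.1.1, q.2)) (p, s) := by
    ext p
    rw [depthIntegral, ← lintegral_indicator measurableSet_Ioc]
    rfl
  rw [e]
  refine Measurable.lintegral_prod_right' (Measurable.indicator (by fun_prop) ?_)
  exact (measurableSet_lt measurable_const measurable_snd).inter
    (measurableSet_le measurable_snd (by fun_prop))

/-- The Jacobian r^{n-1} against the singularity r^{n+1} of the H^{1/2} kernel in dimension n leaves
exactly r^{-2}, the weight in Hardy's inequality. -/
theorem ofReal_pow_mul_div_pow (hn : 1 ≤ n) {r : ℝ} (hr : 0 < r) (H : ℝ≥0∞) :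
    ENNReal.ofReal (r ^ (n - 1)) * (H ^ 2 / ENNReal.ofReal r ^ (n + 1)) =
      (H / ENNReal.ofReal r) ^ 2 := by
  have h0 : ENNReal.ofReal r ≠ 0 := by simpa using hr
  have h1 : ENNReal.ofReal r ≠ ⊤ := ENNReal.ofReal_ne_top
  rw [ENNReal.ofReal_pow hr.le, div_eq_mul_inv, div_eq_mul_inv, mul_pow, mul_left_comm]
  congr 1
  rw [show n + 1 = (n - 1) + 2 by omega, pow_add, ENNReal.mul_inv (by simp [h0]) (by simp [h1]),
    ← mul_assoc, ENNReal.mul_inv_cancel (pow_ne_zero _ h0) (ENNReal.pow_ne_top h1), one_mul,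
    ENNReal.inv_pow]

/-- The integrand depends on b only through ‖a - b‖, so polar coordinates around a reduce the
integral to Hardy's inequality on the vertical line below a. -/
theorem lintegral_depthIntegral_sq_le (hn : 1 ≤ n) {ψ : E n × ℝ → ℝ≥0∞} (hψ : Measurable ψ)
    (a : E n) :
    ∫⁻ b, depthIntegral ψ a ‖a - b‖ ^ 2 / ‖a - b‖ₑ ^ (n + 1) ≤
      4 * (volume : Measure (E n)).toSphere univ * ∫⁻ s in Ioi (0 : ℝ), ψ (a, s) ^ 2 := by
  have hψa : Measurable (fun s => ψ (a, s)) := by fun_prop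
  have hH : Measurable (fun r => depthIntegral ψ a r) :=
    (measurable_depthIntegral hψ).comp (measurable_prodMk_left (x := a))
  let f : ℝ → ℝ≥0∞ := fun r => depthIntegral ψ a r ^ 2 / ENNReal.ofReal r ^ (n + 1)
  have hf : Measurable f := by fun_prop
  calc ∫⁻ b, depthIntegral ψ a ‖a - b‖ ^ 2 / ‖a - b‖ₑ ^ (n + 1) = ∫⁻ b, f ‖a - b‖ := by
        simp only [f, ofReal_norm]
    _ = ∫⁻ z : E n, f ‖z‖ := lintegral_sub_left_eq_self (fun z => f ‖z‖) a
    _ = (volume : Measure (E n)).toSphere univ *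
        ∫⁻ r in Ioi (0 : ℝ), ENNReal.ofReal (r ^ (n - 1)) * f r := lintegral_fun_norm hn hf
    _ = (volume : Measure (E n)).toSphere univ *
        ∫⁻ r in Ioi (0 : ℝ), ((∫⁻ s in Ioc 0 r, ψ (a, s)) / ENNReal.ofReal r) ^ 2 := by
        congr 1
        exact setLIntegral_congr_fun measurableSet_Ioi fun r hr => ofReal_pow_mul_div_pow hn hr _
    _ ≤ (volume : Measure (E n)).toSphere univ *
        (4 * ∫⁻ s in Ioi (0 : ℝ), ψ (a, s) ^ 2) := by
        gcongr
        exact hardy_inequality hψa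
    _ = _ := by ring

/-- The integral of `ψ (·, r)` over the segment from `b` to `a`. -/
def segmentIntegral (ψ : E n × ℝ → ℝ≥0∞) (a b : E n) (r : ℝ) : ℝ≥0∞ :=
  ∫⁻ τ in Ioc (0 : ℝ) 1, ψ (b + τ • (a - b), r)

theorem measurable_segmentIntegral {ψ : E n × ℝ → ℝ≥0∞} (hψ : Measurable ψ) :
    Measurable (fun p : E n × E n => segmentIntegral ψ p.1 p.2 ‖p.1 - p.2‖) := by
  refine Measurable.lintegral_prod_right' (f := fun q : (E n × E n) × ℝ =>
    ψ (q.1.2 + q.2 • (q.1.1 - q.1.2), ‖q.1.1 - q.1.2‖)) ?_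
  exact hψ.comp (by fun_prop)

/-- Put z = a - b. For fixed z and τ, the integral in b of ψ(b + τz, ‖z‖)² does not depend on τ, by
translation invariance. In polar coordinates for z the powers of r cancel, and r = ‖z‖ becomes the
depth variable. -/
theorem lintegral_segmentIntegral_sq_le (hn : 1 ≤ n) {ψ : E n × ℝ → ℝ≥0∞} (hψ : Measurable ψ) :
    ∫⁻ b, ∫⁻ a, (‖a - b‖ₑ * segmentIntegral ψ a b ‖a - b‖) ^ 2 / ‖a - b‖ₑ ^ (n + 1) ≤
      (volume : Measure (E n)).toSphere univ * ∫⁻ a, ∫⁻ s in Ioi (0 : ℝ), ψ (a, s) ^ 2 := by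
  let w : ℝ → ℝ≥0∞ := fun r => ENNReal.ofReal r ^ 2 / ENNReal.ofReal r ^ (n + 1)
  have hw : Measurable w := by fun_prop
  let G : ℝ → ℝ≥0∞ := fun r => ∫⁻ b, ψ (b, r) ^ 2
  have hG : Measurable G := Measurable.lintegral_prod_left' (f := fun q : E n × ℝ => ψ q ^ 2)
    (by fun_prop)
  have hpt : ∀ a b, (‖a - b‖ₑ * segmentIntegral ψ a b ‖a - b‖) ^ 2 / ‖a - b‖ₑ ^ (n + 1) ≤
      w ‖a - b‖ * ∫⁻ τ in Ioc (0 : ℝ) 1, ψ (b + τ • (a - b), ‖a - b‖) ^ 2 := by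
    intro a b
    have h1 : segmentIntegral ψ a b ‖a - b‖ ^ 2 ≤
        ∫⁻ τ in Ioc (0 : ℝ) 1, ψ (b + τ • (a - b), ‖a - b‖) ^ 2 := by
      have := lintegral_sq_le_measure_mul (μ := volume.restrict (Ioc (0 : ℝ) 1))
        (f := fun τ => ψ (b + τ • (a - b), ‖a - b‖)) (hψ.comp (by fun_prop)).aemeasurable
      simpa [segmentIntegral] using this
    simp only [w, ofReal_norm]
    rw [mul_pow, ENNReal.mul_div_right_comm]
    gcongr
  have hm : Measurable (fun p : (E n × E n) × ℝ => ψ (p.1.1 + p.2 • p.1.2, ‖p.1.2‖) ^ 2) :=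
    (hψ.comp (by fun_prop)).pow_const 2
  calc ∫⁻ b, ∫⁻ a, (‖a - b‖ₑ * segmentIntegral ψ a b ‖a - b‖) ^ 2 / ‖a - b‖ₑ ^ (n + 1)
      ≤ ∫⁻ b, ∫⁻ a, w ‖a - b‖ * ∫⁻ τ in Ioc (0 : ℝ) 1, ψ (b + τ • (a - b), ‖a - b‖) ^ 2 :=
        lintegral_mono fun b => lintegral_mono fun a => hpt a b
    _ = ∫⁻ b, ∫⁻ z, w ‖z‖ * ∫⁻ τ in Ioc (0 : ℝ) 1, ψ (b + τ • z, ‖z‖) ^ 2 := by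
        refine lintegral_congr fun b => ?_
        exact lintegral_sub_right_eq_self
          (fun z => w ‖z‖ * ∫⁻ τ in Ioc (0 : ℝ) 1, ψ (b + τ • z, ‖z‖) ^ 2) b
    _ = ∫⁻ z, ∫⁻ b, w ‖z‖ * ∫⁻ τ in Ioc (0 : ℝ) 1, ψ (b + τ • z, ‖z‖) ^ 2 := by
        refine lintegral_lintegral_swap (Measurable.aemeasurable ?_)
        have h1 : Measurable (fun p : E n × E n =>
            ∫⁻ τ in Ioc (0 : ℝ) 1, ψ (p.1 + τ • p.2, ‖p.2‖) ^ 2) := hm.lintegral_prod_right'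
        exact Measurable.mul (hw.comp (by fun_prop)) h1
    _ = ∫⁻ z : E n, w ‖z‖ * G ‖z‖ := by
        refine lintegral_congr fun z => ?_
        have h1 : Measurable (fun p : E n × ℝ => ψ (p.1 + p.2 • z, ‖z‖) ^ 2) :=
          (hψ.comp (by fun_prop)).pow_const 2
        rw [lintegral_const_mul _ h1.lintegral_prod_right', lintegral_lintegral_swap
          h1.aemeasurable]
        congr 1
        have h2 : ∀ τ : ℝ, ∫⁻ b, ψ (b + τ • z, ‖z‖) ^ 2 = G ‖z‖ := fun τ =>
          lintegral_add_right_eq_self (fun b => ψ (b, ‖z‖) ^ 2) (τ • z)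
        simp [h2]
    _ = (volume : Measure (E n)).toSphere univ *
        ∫⁻ r in Ioi (0 : ℝ), ENNReal.ofReal (r ^ (n - 1)) * (w r * G r) :=
        lintegral_fun_norm hn (f := fun r => w r * G r) (hw.mul hG)
    _ = (volume : Measure (E n)).toSphere univ * ∫⁻ r in Ioi (0 : ℝ), G r := by
        congr 1
        refine setLIntegral_congr_fun measurableSet_Ioi fun r hr => ?_
        have hr0 : (0 : ℝ) < r := hr
        simp only [w]
        rw [← mul_assoc, ofReal_pow_mul_div_pow hn hr0,
          ENNReal.div_self (by simpa using hr0) ENNReal.ofReal_ne_top]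
        simp
    _ = _ := by
        congr 1
        exact lintegral_lintegral_swap (by fun_prop)

theorem measurable_depth_term {ψ : E n × ℝ → ℝ≥0∞} (hψ : Measurable ψ) :
    Measurable (fun p : E n × E n =>
      depthIntegral ψ p.1 ‖p.1 - p.2‖ ^ 2 / ‖p.1 - p.2‖ₑ ^ (n + 1)) := by
  have h1 : Measurable fun p : E n × E n => (p.1, ‖p.1 - p.2‖) := by fun_prop
  have h2 : Measurable (fun p : E n × E n => ‖p.1 - p.2‖ₑ ^ (n + 1)) := by fun_prop
  exact (((measurable_depthIntegral hψ).comp h1).pow_const 2).div h2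

theorem measurable_segment_term {ψ : E n × ℝ → ℝ≥0∞} (hψ : Measurable ψ) :
    Measurable (fun p : E n × E n =>
      (‖p.1 - p.2‖ₑ * segmentIntegral ψ p.1 p.2 ‖p.1 - p.2‖) ^ 2 / ‖p.1 - p.2‖ₑ ^ (n + 1)) := by
  have h1 : Measurable (fun p : E n × E n => ‖p.1 - p.2‖ₑ) := by fun_prop
  have h2 : Measurable (fun p : E n × E n => ‖p.1 - p.2‖ₑ ^ (n + 1)) := by fun_prop
  exact ((h1.mul (measurable_segmentIntegral hψ)).pow_const 2).div h2

theorem lintegral_lintegral_combination {X : Type*} [MeasurableSpace X] {μ : Measure X} [SFinite μ]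
    {f g h : X → X → ℝ≥0∞} (hf : Measurable (Function.uncurry f))
    (hg : Measurable (Function.uncurry g)) (hh : Measurable (Function.uncurry h)) (c e : ℝ≥0∞) :
    ∫⁻ a, ∫⁻ b, c * (f a b + g a b + e * h a b) ∂μ ∂μ =
      c * ((∫⁻ a, ∫⁻ b, f a b ∂μ ∂μ) + (∫⁻ a, ∫⁻ b, g a b ∂μ ∂μ) +
        e * ∫⁻ a, ∫⁻ b, h a b ∂μ ∂μ) := by
  have hf1 : ∀ a, Measurable (f a) := fun a => hf.of_uncurry_left
  have hg1 : ∀ a, Measurable (g a) := fun a => hg.of_uncurry_left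
  have hh1 : ∀ a, Measurable (h a) := fun a => hh.of_uncurry_left
  have hf2 : Measurable (fun a => ∫⁻ b, f a b ∂μ) := hf.lintegral_prod_right'
  have hg2 : Measurable (fun a => ∫⁻ b, g a b ∂μ) := hg.lintegral_prod_right'
  have hh2 : Measurable (fun a => ∫⁻ b, h a b ∂μ) := hh.lintegral_prod_right'
  have e1 : ∀ a, ∫⁻ b, c * (f a b + g a b + e * h a b) ∂μ =
      c * ((∫⁻ b, f a b ∂μ) + (∫⁻ b, g a b ∂μ) + e * ∫⁻ b, h a b ∂μ) := by
    intro a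
    have m2 : Measurable (fun b => e * h a b) := (hh1 a).const_mul e
    have m1 : Measurable (fun b => f a b + g a b + e * h a b) := ((hf1 a).add (hg1 a)).add m2
    rw [lintegral_const_mul _ m1, lintegral_add_right _ m2, lintegral_add_right _ (hg1 a),
      lintegral_const_mul _ (hh1 a)]
  simp only [e1]
  have m2 : Measurable (fun a => e * ∫⁻ b, h a b ∂μ) := hh2.const_mul e
  have m1 : Measurable (fun a => (∫⁻ b, f a b ∂μ) + (∫⁻ b, g a b ∂μ) + e * ∫⁻ b, h a b ∂μ) :=
    (hf2.add hg2).add m2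
  rw [lintegral_const_mul _ m1, lintegral_add_right _ m2, lintegral_add_right _ hg2,
    lintegral_const_mul _ hh2]

/-- By Tonelli, f and its transpose have the same double integral over A × A, so one bound serves
the vertical terms at both endpoints. -/
theorem setLIntegral_combination_le {X : Type*} [MeasurableSpace X] {μ : Measure X} [SFinite μ]
    {A : Set X} (hA : MeasurableSet A) {k f h : X → X → ℝ≥0∞}
    (hf : Measurable (Function.uncurry f)) (hh : Measurable (Function.uncurry h)) {c e b₁ b₂ : ℝ≥0∞}
    (hk : ∀ a ∈ A, ∀ b ∈ A, k a b ≤ c * (f a b + f b a + e * h a b))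
    (h1 : ∫⁻ a in A, ∫⁻ b in A, f a b ∂μ ∂μ ≤ b₁) (h2 : ∫⁻ a in A, ∫⁻ b in A, h a b ∂μ ∂μ ≤ b₂) :
    ∫⁻ a in A, ∫⁻ b in A, k a b ∂μ ∂μ ≤ c * (b₁ + b₁ + e * b₂) := by
  have hf' : Measurable (Function.uncurry fun a b => f b a) := hf.comp measurable_swap
  have h1' : ∫⁻ a in A, ∫⁻ b in A, f b a ∂μ ∂μ ≤ b₁ := by
    rw [lintegral_lintegral_swap (f := fun a b => f b a) hf'.aemeasurable]
    exact h1
  refine (setLIntegral_mono' hA fun a ha => setLIntegral_mono' hA fun b hb => hk a ha b hb).trans ?_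
  rw [lintegral_lintegral_combination hf hf' hh c e]
  gcongr

/-- The path goes down from a to depth ‖a - b‖, across at that depth, and up to b. Choosing the
depth equal to the distance balances the vertical and horizontal contributions. -/
theorem flat_increment_le {A : Set (E n)} {T : ℝ}
    (hAT : ∀ a ∈ A, ∀ b ∈ A, ‖a - b‖ ≤ T) {g : E n → ℝ → F} {ψ : E n × ℝ → ℝ≥0∞} {K : ℝ≥0∞}
    (h1 : ∀ a ∈ A, ∀ r, 0 < r → r ≤ T → ‖g a 0 - g a r‖ₑ ≤ ∫⁻ s in Ioc 0 r, ψ (a, s))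
    (h2 : ∀ a ∈ A, ∀ b ∈ A, ∀ r, 0 < r → r ≤ T →
      ‖g a r - g b r‖ₑ ≤ K * ‖a - b‖ₑ * ∫⁻ τ in Ioc (0 : ℝ) 1, ψ (b + τ • (a - b), r))
    {a : E n} (ha : a ∈ A) {b : E n} (hb : b ∈ A) (hab : a ≠ b) :
    ‖g a 0 - g b 0‖ₑ ≤ depthIntegral ψ a ‖a - b‖ + depthIntegral ψ b ‖a - b‖ +
        K * (‖a - b‖ₑ * segmentIntegral ψ a b ‖a - b‖) := by
  have hr : 0 < ‖a - b‖ := norm_pos_iff.2 (sub_ne_zero.2 hab)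
  have hrT := hAT a ha b hb
  have e : g a 0 - g b 0 = (g a 0 - g a ‖a - b‖) + -(g b 0 - g b ‖a - b‖) +
      (g a ‖a - b‖ - g b ‖a - b‖) := by abel
  rw [e]
  refine (enorm_add_le _ _).trans (add_le_add ((enorm_add_le _ _).trans
    (add_le_add (h1 a ha _ hr hrT) ?_)) ?_)
  · rw [enorm_neg]; exact h1 b hb _ hr hrT
  · rw [← mul_assoc]; exact h2 a ha b hb _ hr hrT

/-- Gagliardo's trace estimate on a flat piece: `g a r` is a function at depth `r` below `a`, and
`ψ` dominates its increments. -/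
theorem flat_gagliardo_le (hn : 1 ≤ n) {A : Set (E n)} (hA : MeasurableSet A) {T : ℝ}
    (hAT : ∀ a ∈ A, ∀ b ∈ A, ‖a - b‖ ≤ T) {g : E n → ℝ → F} {ψ : E n × ℝ → ℝ≥0∞}
    (hψ : Measurable ψ) {K : ℝ≥0∞}
    (h1 : ∀ a ∈ A, ∀ r, 0 < r → r ≤ T → ‖g a 0 - g a r‖ₑ ≤ ∫⁻ s in Ioc 0 r, ψ (a, s))
    (h2 : ∀ a ∈ A, ∀ b ∈ A, ∀ r, 0 < r → r ≤ T →
      ‖g a r - g b r‖ₑ ≤ K * ‖a - b‖ₑ * ∫⁻ τ in Ioc (0 : ℝ) 1, ψ (b + τ • (a - b), r)) :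
    ∫⁻ a in A, ∫⁻ b in A, ‖g a 0 - g b 0‖ₑ ^ 2 / ‖a - b‖ₑ ^ (n + 1) ≤
      4 * (8 + K ^ 2) * (volume : Measure (E n)).toSphere univ *
        ∫⁻ a, ∫⁻ s in Ioi (0 : ℝ), ψ (a, s) ^ 2 := by
  have hψ2 : Measurable (fun a => ∫⁻ s in Ioi (0 : ℝ), ψ (a, s) ^ 2) :=
    Measurable.lintegral_prod_right' (f := fun p : E n × ℝ => ψ p ^ 2) (by fun_prop)
  set κ := (volume : Measure (E n)).toSphere univ
  set S := ∫⁻ a, ∫⁻ s in Ioi (0 : ℝ), ψ (a, s) ^ 2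
  let t1 : E n → E n → ℝ≥0∞ := fun a b => depthIntegral ψ a ‖a - b‖ ^ 2 / ‖a - b‖ₑ ^ (n + 1)
  let t2 : E n → E n → ℝ≥0∞ := fun a b =>
    (‖a - b‖ₑ * segmentIntegral ψ a b ‖a - b‖) ^ 2 / ‖a - b‖ₑ ^ (n + 1)
  have m1 : Measurable (Function.uncurry t1) := measurable_depth_term hψ
  have m2 : Measurable (Function.uncurry t2) := measurable_segment_term hψ
  have hpt : ∀ a ∈ A, ∀ b ∈ A, ‖g a 0 - g b 0‖ₑ ^ 2 / ‖a - b‖ₑ ^ (n + 1) ≤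
      4 * (t1 a b + t1 b a + K ^ 2 * t2 a b) := by
    intro a ha b hb
    -- On the diagonal the quotient is 0/0, which is 0 in `ℝ≥0∞`.
    rcases eq_or_ne a b with rfl | hab
    · simp
    have hsum := flat_increment_le hAT h1 h2 ha hb hab
    calc ‖g a 0 - g b 0‖ₑ ^ 2 / ‖a - b‖ₑ ^ (n + 1)
        ≤ 4 * (depthIntegral ψ a ‖a - b‖ ^ 2 + depthIntegral ψ b ‖a - b‖ ^ 2 +
          (K * (‖a - b‖ₑ * segmentIntegral ψ a b ‖a - b‖)) ^ 2) / ‖a - b‖ₑ ^ (n + 1) := by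
          gcongr
          exact (pow_le_pow_left' hsum 2).trans (ennreal_add_three_sq_le _ _ _)
      _ = 4 * (t1 a b + t1 b a + K ^ 2 * t2 a b) := by
          simp only [t1, t2, enorm_sub_rev b a, norm_sub_rev b a]
          simp only [div_eq_mul_inv, mul_pow]
          ring
  have s1 : ∫⁻ a in A, ∫⁻ b in A, t1 a b ≤ 4 * κ * S := by
    calc ∫⁻ a in A, ∫⁻ b in A, t1 a b ≤ ∫⁻ a, ∫⁻ b, t1 a b :=
          (setLIntegral_le_lintegral _ _).trans
            (lintegral_mono fun a => setLIntegral_le_lintegral _ _)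
      _ ≤ ∫⁻ a, 4 * κ * ∫⁻ s in Ioi (0 : ℝ), ψ (a, s) ^ 2 :=
          lintegral_mono fun a => lintegral_depthIntegral_sq_le hn hψ a
      _ = 4 * κ * S := lintegral_const_mul (4 * κ) hψ2
  have s3 : ∫⁻ a in A, ∫⁻ b in A, t2 a b ≤ κ * S := by
    rw [lintegral_lintegral_swap m2.aemeasurable]
    calc ∫⁻ b in A, ∫⁻ a in A, t2 a b ≤ ∫⁻ b, ∫⁻ a, t2 a b :=
          (setLIntegral_le_lintegral _ _).trans
            (lintegral_mono fun a => setLIntegral_le_lintegral _ _)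
      _ ≤ κ * S := lintegral_segmentIntegral_sq_le hn hψ
  -- Each vertical term contributes 4κS and the horizontal one K²κS, all multiplied by the 4 from
  -- squaring a sum of three; this is 4(8 + K²)κS.
  refine (setLIntegral_combination_le hA m1 m2 hpt s1 s3).trans (le_of_eq ?_)
  generalize κ = x, S = y
  ring

/-- The boundary value is the value at depth r plus the increment on the way up. Averaging the
square over r ∈ (0, T] trades boundary values for interior ones. -/
theorem flat_lintegral_sq_le {A : Set (E n)} (hA : MeasurableSet A) {T : ℝ}
    {g : E n → ℝ → F} {ψ : E n × ℝ → ℝ≥0∞} (hψ : Measurable ψ)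
    (hg : ∀ a, Measurable fun r => ‖g a r‖ₑ)
    (hg' : Measurable fun a => ∫⁻ r in Ioc 0 T, ‖g a r‖ₑ ^ 2)
    (h1 : ∀ a ∈ A, ∀ r, 0 < r → r ≤ T → ‖g a 0 - g a r‖ₑ ≤ ∫⁻ s in Ioc 0 r, ψ (a, s)) :
    ENNReal.ofReal T * ∫⁻ a in A, ‖g a 0‖ₑ ^ 2 ≤
      2 * (∫⁻ a in A, ∫⁻ r in Ioc 0 T, ‖g a r‖ₑ ^ 2) +
      2 * ENNReal.ofReal T ^ 2 * ∫⁻ a, ∫⁻ s in Ioi (0 : ℝ), ψ (a, s) ^ 2 := by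
  have hpt : ∀ a ∈ A, ENNReal.ofReal T * ‖g a 0‖ₑ ^ 2 ≤ 2 * (∫⁻ r in Ioc 0 T, ‖g a r‖ₑ ^ 2) +
      2 * ENNReal.ofReal T ^ 2 * ∫⁻ s in Ioi (0 : ℝ), ψ (a, s) ^ 2 := by
    intro a ha
    have hψa : Measurable (fun s => ψ (a, s)) := by fun_prop
    have h2 : ∀ r ∈ Ioc 0 T, ‖g a 0‖ₑ ^ 2 ≤ 2 * ‖g a r‖ₑ ^ 2 +
        2 * (ENNReal.ofReal T * ∫⁻ s in Ioi (0 : ℝ), ψ (a, s) ^ 2) := by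
      intro r hr
      have h3 : ‖g a 0‖ₑ ≤ ‖g a r‖ₑ + ∫⁻ s in Ioc 0 T, ψ (a, s) := by
        have e : g a 0 = g a r + (g a 0 - g a r) := by abel
        rw [e]
        refine (enorm_add_le _ _).trans (add_le_add le_rfl ?_)
        exact (h1 a ha r hr.1 hr.2).trans
          (lintegral_mono_set (Ioc_subset_Ioc le_rfl hr.2))
      have h4 : (∫⁻ s in Ioc 0 T, ψ (a, s)) ^ 2 ≤
          ENNReal.ofReal T * ∫⁻ s in Ioi (0 : ℝ), ψ (a, s) ^ 2 := by
        have := lintegral_sq_le_measure_mul (μ := volume.restrict (Ioc 0 T)) hψa.aemeasurable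
        simp only [Measure.restrict_apply MeasurableSet.univ, univ_inter, Real.volume_Ioc,
          sub_zero] at this
        refine this.trans ?_
        gcongr
        exact Ioc_subset_Ioi_self
      calc ‖g a 0‖ₑ ^ 2 ≤ (‖g a r‖ₑ + ∫⁻ s in Ioc 0 T, ψ (a, s)) ^ 2 := by gcongr
        _ ≤ 2 * (‖g a r‖ₑ ^ 2 + (∫⁻ s in Ioc 0 T, ψ (a, s)) ^ 2) := ennreal_add_sq_le _ _
        _ ≤ _ := by rw [mul_add]; gcongr
    have h5 := setLIntegral_mono' (μ := volume) measurableSet_Ioc h2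
    have hm := hg a
    rw [lintegral_const, lintegral_add_right _ measurable_const, lintegral_const,
      lintegral_const_mul _ (by fun_prop)] at h5
    simp only [Measure.restrict_apply MeasurableSet.univ, univ_inter, Real.volume_Ioc,
          sub_zero] at h5
    rw [mul_comm]
    refine h5.trans (le_of_eq ?_)
    ring
  have hm2 : Measurable (fun a => ∫⁻ s in Ioi (0 : ℝ), ψ (a, s) ^ 2) :=
    Measurable.lintegral_prod_right' (f := fun p => ψ p ^ 2) (by fun_prop)
  calc ENNReal.ofReal T * ∫⁻ a in A, ‖g a 0‖ₑ ^ 2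
      = ∫⁻ a in A, ENNReal.ofReal T * ‖g a 0‖ₑ ^ 2 :=
        (lintegral_const_mul' _ _ ENNReal.ofReal_ne_top).symm
    _ ≤ ∫⁻ a in A, (2 * (∫⁻ r in Ioc 0 T, ‖g a r‖ₑ ^ 2) +
        2 * ENNReal.ofReal T ^ 2 * ∫⁻ s in Ioi (0 : ℝ), ψ (a, s) ^ 2) :=
        setLIntegral_mono' hA hpt
    _ = 2 * (∫⁻ a in A, ∫⁻ r in Ioc 0 T, ‖g a r‖ₑ ^ 2) +
        2 * ENNReal.ofReal T ^ 2 * ∫⁻ a in A, ∫⁻ s in Ioi (0 : ℝ), ψ (a, s) ^ 2 := by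
        rw [lintegral_add_left (hg'.const_mul 2), lintegral_const_mul _ hg',
          lintegral_const_mul _ hm2]
    _ ≤ _ := by
        gcongr
        exact Measure.restrict_le_self

end FlatTrace

/-! ### Local trace estimate in a Lipschitz chart -/

section ChartTrace

variable {d : ℕ}

/-- The point at depth `p.2` below the point of the graph of `φ` over `p.1`. -/
def chartPoint (L : E (d - 1) →ₗᵢ[ℝ] E d) (ν : E d) (φ : E (d - 1) → ℝ) (p : E (d - 1) × ℝ) : E d :=
  L p.1 + (φ p.1 - p.2) • ν

/-- On each vertical line (a, s) ↦ (a, φ a - s) is a reflection followed by a translation, so this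
skew product preserves volume. An isometry of coordinates follows. -/
theorem measurePreserving_chartPoint (hd : 1 ≤ d) (L : E (d - 1) →ₗᵢ[ℝ] E d) {ν : E d}
    (hν : ‖ν‖ = 1) (hL : ∀ a, inner ℝ (L a) ν = 0) {φ : E (d - 1) → ℝ} (hφ : Continuous φ) :
    MeasurePreserving (chartPoint L ν φ) volume volume := by
  obtain ⟨e, he⟩ := exists_chart_isometry hd L hν hL
  have h1 : MeasurePreserving (fun p : E (d - 1) × ℝ => (p.1, φ p.1 - p.2)) volume volume := by
    refine MeasurePreserving.skew_product (g := fun a s => φ a - s)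
      (MeasurePreserving.id volume) ?_ (Eventually.of_forall fun a => ?_)
    · have := hφ.measurable
      exact Measurable.sub (by fun_prop) (by fun_prop)
    · exact (Measure.measurePreserving_sub_left volume (φ a)).map_eq
  have h2 := e.measurePreserving.comp ((WithLp.volume_preserving_toLp (E (d - 1)) ℝ).comp h1)
  have h3 : chartPoint L ν φ = ⇑e ∘ WithLp.toLp 2 ∘ fun p => (p.1, φ p.1 - p.2) := by
    ext1 p
    rw [chartPoint, ← he]
    rfl
  rw [h3]
  exact h2

theorem chartPoint_sub_chartPoint (L : E (d - 1) →ₗᵢ[ℝ] E d) (ν : E d) (φ : E (d - 1) → ℝ)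
    (a b : E (d - 1)) (r s : ℝ) :
    chartPoint L ν φ (a, r) - chartPoint L ν φ (b, s) =
      L (a - b) + (φ a - φ b - (r - s)) • ν := by
  simp only [chartPoint, map_sub, sub_smul]
  abel

theorem dist_chartPoint_le (L : E (d - 1) →ₗᵢ[ℝ] E d) {ν : E d} (hν : ‖ν‖ = 1)
    {φ : E (d - 1) → ℝ} {K : NNReal} (hφ : LipschitzWith K φ) (a b : E (d - 1)) (r s : ℝ) :
    dist (chartPoint L ν φ (a, r)) (chartPoint L ν φ (b, s)) ≤ (1 + K) * ‖a - b‖ + |r - s| := by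
  rw [dist_eq_norm, chartPoint_sub_chartPoint]
  refine (norm_add_le _ _).trans ?_
  rw [L.norm_map, norm_smul, hν, mul_one, Real.norm_eq_abs]
  have h1 := hφ.dist_le_mul a b
  rw [Real.dist_eq, dist_eq_norm] at h1
  have h2 := abs_sub (φ a - φ b) (r - s)
  linarith

/-- The component orthogonal to ν is no longer than the whole difference. Hence the kernel on Γ is
dominated by the kernel in the flat parameters. -/
theorem norm_sub_le_dist_chartPoint (L : E (d - 1) →ₗᵢ[ℝ] E d) {ν : E d} (hν : ‖ν‖ = 1)
    (hL : ∀ a, inner ℝ (L a) ν = 0) (φ : E (d - 1) → ℝ) (a b : E (d - 1)) (r s : ℝ) :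
    ‖a - b‖ ≤ dist (chartPoint L ν φ (a, r)) (chartPoint L ν φ (b, s)) := by
  rw [dist_eq_norm, chartPoint_sub_chartPoint]
  exact norm_fst_le_chart L hν hL _ _

/-- A chart describes only Ω; that the frontier lies on the graph is a consequence. A point strictly
below the graph lies in the open set Ω. A point strictly above it is separated from Ω by a distance
proportional to its height over the graph, with factor 1/(2 + K), so it is not in the closure. -/
theorem IsLipschitzChart.eq_of_mem_frontier (hd : 1 ≤ d) {Ω : Set (E d)} (hΩ : IsOpen Ω)
    {L : E (d - 1) →ₗᵢ[ℝ] E d} {ν : E d} {φ : E (d - 1) → ℝ} {x : E d} {r : ℝ}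
    (h : IsLipschitzChart Ω L ν φ x r) {a : E (d - 1)} {s : ℝ}
    (hb : L a + s • ν ∈ Metric.ball x r) (hf : L a + s • ν ∈ frontier Ω) : s = φ a := by
  obtain ⟨hν, hL, ⟨K, hK⟩, hchart⟩ := h
  rw [frontier, hΩ.interior_eq] at hf
  refine le_antisymm ?_ ?_
  · by_contra hc
    have hK0 : (0 : ℝ) ≤ K := K.2
    set η := (s - φ a) / (2 + K) with hη
    have hη0 : 0 < η := div_pos (sub_pos.2 (not_le.1 hc)) (by positivity)
    obtain ⟨ρ, hρ, hρb⟩ := Metric.isOpen_iff.1 Metric.isOpen_ball _ hb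
    obtain ⟨z, hz, hzd⟩ := Metric.mem_closure_iff.1 hf.1 (min ρ η) (lt_min hρ hη0)
    obtain ⟨b, t, rfl⟩ := exists_chart_coord hd L hν hL z
    have hzb : L b + t • ν ∈ Metric.ball x r := hρb (by
      rw [Metric.mem_ball, dist_comm]; exact hzd.trans_le (min_le_left _ _))
    have htφ := (hchart b t hzb).1 hz
    have e : L a + s • ν - (L b + t • ν) = L (a - b) + (s - t) • ν := by
      rw [map_sub, sub_smul]; abel
    rw [dist_eq_norm, e] at hzd
    have hd1 := (norm_fst_le_chart L hν hL (a - b) (s - t)).trans (hzd.le.trans (min_le_right _ _))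
    have hd2 := (abs_snd_le_chart L hν hL (a - b) (s - t)).trans (hzd.le.trans (min_le_right _ _))
    have h1 := hK.dist_le_mul a b
    rw [Real.dist_eq, dist_eq_norm] at h1
    have h2 : (K : ℝ) * ‖a - b‖ ≤ K * η := by gcongr
    have h3 := (abs_le.1 h1).1
    have h4 := (abs_le.1 hd2).2
    have h5 : η * (2 + K) = s - φ a := by rw [hη]; field_simp
    nlinarith
  · by_contra hc
    exact hf.2 ((hchart a s hb).2 (not_le.1 hc))

/-- The surface measure of a Lipschitz image is bounded by the Lebesgue measure of the parameter
domain. -/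
theorem surface_restrict_le_map {n : ℕ} {Φ : E n → E d} {M : NNReal} (hΦ : LipschitzWith M Φ)
    {A : Set (E n)} {B : Set (E d)} (hB : B ⊆ Φ '' A) :
    (Measure.euclideanHausdorffMeasure n : Measure (E d)).restrict B ≤
      ((M : ℝ≥0∞) ^ n) • Measure.map Φ (volume.restrict A) := by
  refine Measure.le_iff.2 fun S hS => ?_
  have hm := hΦ.continuous.measurable
  rw [Measure.restrict_apply hS, Measure.smul_apply, Measure.map_apply hm hS,
    Measure.restrict_apply (hm hS), ← EuclideanSpace.euclideanHausdorffMeasure_eq_volume]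
  have hsub : S ∩ B ⊆ Φ '' (Φ ⁻¹' S ∩ A) := by
    rintro x ⟨hxS, hxB⟩
    obtain ⟨a, ha, rfl⟩ := hB hxB
    exact ⟨a, ⟨hxS, ha⟩, rfl⟩
  refine (measure_mono hsub).trans ?_
  rw [Measure.euclideanHausdorffMeasure_def, Measure.euclideanHausdorffMeasure_def,
    Measure.smul_apply, Measure.smul_apply, smul_comm]
  have := (hΦ.lipschitzOnWith (s := Φ ⁻¹' S ∩ A)).hausdorffMeasure_image_le (d := n)
    (Nat.cast_nonneg n)
  rw [ENNReal.rpow_natCast] at this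
  gcongr
  exact this

variable {F : Type*} [NormedAddCommGroup F] [NormedSpace ℝ F]

/-- The trace estimate near a boundary point, for smooth functions. -/
theorem IsPolyhedralDomain.exists_local_trace (hd : 2 ≤ d) {Ω : Set (E d)}
    (hΩ : IsPolyhedralDomain Ω) {x₀ : E d} (hx₀ : x₀ ∈ frontier Ω) :
    ∃ δ > 0, ∃ C : ℝ≥0∞, C ≠ ⊤ ∧ ∀ f : E d → F, ContDiff ℝ 1 f →
      ∫⁻ x in Metric.ball x₀ δ, ‖f x‖ₑ ^ 2 ∂(surfaceMeasure Ω) ≤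
        C * ((∫⁻ x in Ω, ‖f x‖ₑ ^ 2) + ∫⁻ x in Ω, ‖fderiv ℝ f x‖ₑ ^ 2) ∧
      ∫⁻ x in Metric.ball x₀ δ, (∫⁻ y in Metric.ball x₀ δ, ‖f x - f y‖ₑ ^ 2 / edist x y ^ d
        ∂(surfaceMeasure Ω)) ∂(surfaceMeasure Ω) ≤
        C * ((∫⁻ x in Ω, ‖f x‖ₑ ^ 2) + ∫⁻ x in Ω, ‖fderiv ℝ f x‖ₑ ^ 2) := by
  obtain ⟨L, ν, φ, R, hR, hchart⟩ := hΩ.lipschitz x₀ hx₀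
  have hchart' := hchart
  obtain ⟨hν, hL, ⟨K, hK⟩, hsub⟩ := hchart'
  have hd1 : 1 ≤ d := by omega
  have hK0 : (0 : ℝ) ≤ K := K.2
  obtain ⟨a₀, s₀, hxa⟩ := exists_chart_coord hd1 L hν hL x₀
  have hs₀ : s₀ = φ a₀ := hchart.eq_of_mem_frontier hd1 hΩ.isOpen
    (by rw [← hxa]; exact Metric.mem_ball_self hR) (by rw [← hxa]; exact hx₀)
  -- A has diameter at most T = 2δ, so the depth ‖a - b‖ never exceeds T. Points over A down to
  -- depth T stay within (1 + K)δ + 2δ < R of x₀, inside the chart ball and hence in Ω.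
  set δ : ℝ := R / (K + 4) with hδ
  have hδ0 : 0 < δ := by positivity
  have hδR : δ * (K + 4) = R := by rw [hδ]; field_simp
  set T : ℝ := 2 * δ with hT
  set A : Set (E (d - 1)) := Metric.ball a₀ δ with hA
  set Ψ := chartPoint L ν φ with hΨ
  have hx₀Ψ : x₀ = Ψ (a₀, 0) := by rw [hxa, hs₀, hΨ, chartPoint]; simp
  have hΨm := measurePreserving_chartPoint hd1 L hν hL hK.continuous
  have hΨc : Continuous Ψ := by
    have := hK.continuous
    have h2 := L.continuous
    simp only [hΨ]
    unfold chartPoint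
    fun_prop
  have hΨΩ : ∀ a ∈ A, ∀ s, 0 < s → s ≤ T → Ψ (a, s) ∈ Ω := by
    intro a ha s hs hsT
    refine (hsub a (φ a - s) ?_).2 (by linarith)
    change dist (Ψ (a, s)) x₀ < R
    rw [hx₀Ψ]
    refine (dist_chartPoint_le L hν hK a a₀ s 0).trans_lt ?_
    rw [hA, Metric.mem_ball, dist_eq_norm] at ha
    rw [sub_zero, abs_of_pos hs]
    have : (1 + K) * ‖a - a₀‖ ≤ (1 + K) * δ := by gcongr
    nlinarith
  have hΦ : LipschitzWith (1 + K) (fun a => Ψ (a, 0)) := by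
    refine LipschitzWith.of_dist_le_mul fun a b => ?_
    have := dist_chartPoint_le L hν hK a b 0 0
    simpa [dist_eq_norm] using this
  have hpatch : Metric.ball x₀ δ ∩ frontier Ω ⊆ (fun a => Ψ (a, 0)) '' A := by
    rintro x ⟨hxb, hxf⟩
    obtain ⟨a, s, rfl⟩ := exists_chart_coord hd1 L hν hL x
    have hδle : δ ≤ R := by nlinarith
    have hs : s = φ a := hchart.eq_of_mem_frontier hd1 hΩ.isOpen
      (Metric.ball_subset_ball hδle hxb) hxf
    refine ⟨a, ?_, by simp [hΨ, chartPoint, hs]⟩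
    rw [Metric.mem_ball, hx₀Ψ] at hxb
    rw [hA, Metric.mem_ball, dist_eq_norm]
    refine lt_of_le_of_lt ?_ hxb
    have := norm_sub_le_dist_chartPoint L hν hL φ a a₀ 0 0
    simpa [hs, hΨ, chartPoint] using this
  set M : ℝ≥0∞ := ((1 + K : NNReal) : ℝ≥0∞) ^ (d - 1) with hM
  have hMtop : M ≠ ⊤ := ENNReal.pow_ne_top ENNReal.coe_ne_top
  have hmeas : (surfaceMeasure Ω).restrict (Metric.ball x₀ δ) ≤
      M • Measure.map (fun a => Ψ (a, 0)) (volume.restrict A) := by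
    rw [surfaceMeasure, Measure.restrict_restrict measurableSet_ball]
    exact surface_restrict_le_map hΦ hpatch
  have hlint : ∀ k : E d → ℝ≥0∞, ∫⁻ x in Metric.ball x₀ δ, k x ∂(surfaceMeasure Ω) ≤
      M * ∫⁻ a in A, k (Ψ (a, 0)) := by
    intro k
    refine (lintegral_mono' hmeas le_rfl).trans ?_
    rw [lintegral_smul_measure, smul_eq_mul]
    gcongr
    exact lintegral_map_le _ _
  -- Ψ preserves volume and maps A × (0, T] into Ω, so integrals over this box are bounded by
  -- integrals over Ω.
  have hvol : ∀ k : E d → ℝ≥0∞, Measurable k →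
      ∫⁻ a in A, ∫⁻ r in Ioc 0 T, k (Ψ (a, r)) ≤ ∫⁻ x in Ω, k x := by
    intro k hk
    have hkm : Measurable (Ω.indicator k) := hk.indicator hΩ.isOpen.measurableSet
    rw [← lintegral_indicator hΩ.isOpen.measurableSet, ← hΨm.lintegral_comp hkm,
      Measure.volume_eq_prod,
      lintegral_prod (fun p => Ω.indicator k (chartPoint L ν φ p))
        (hkm.comp hΨm.measurable).aemeasurable,
      ← lintegral_indicator measurableSet_ball]
    refine lintegral_mono fun a => ?_
    by_cases ha : a ∈ A
    · rw [indicator_of_mem ha, ← lintegral_indicator measurableSet_Ioc]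
      refine lintegral_mono fun r => ?_
      by_cases hr : r ∈ Ioc 0 T
      · rw [indicator_of_mem hr, indicator_of_mem (hΨΩ a ha r hr.1 hr.2)]
      · rw [indicator_of_notMem hr]; exact zero_le
    · rw [indicator_of_notMem ha]; exact zero_le
  set κ := (volume : Measure (E (d - 1))).toSphere univ
  have hκ : κ ≠ ⊤ := measure_ne_top _ _
  -- `C₁` carries the division by T from averaging over the depth and one factor `M` for the surface
  -- measure. `C₂` carries two factors `M`, one for each boundary variable, and the constant of the
  -- flat estimate.
  set C₁ : ℝ≥0∞ := (ENNReal.ofReal T)⁻¹ * M * (2 + 2 * ENNReal.ofReal T ^ 2) with hC₁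
  set C₂ : ℝ≥0∞ := M * M * (4 * (8 + ((1 + K : NNReal) : ℝ≥0∞) ^ 2) * κ) with hC₂
  have hT0 : ENNReal.ofReal T ≠ 0 := by simp [hT, hδ0]
  refine ⟨δ, hδ0, C₁ + C₂, ?_, fun f hf => ?_⟩
  · refine ENNReal.add_ne_top.2 ⟨?_, ?_⟩
    · refine ENNReal.mul_ne_top (ENNReal.mul_ne_top (by simpa using hT0) hMtop) ?_
      exact ENNReal.add_ne_top.2 ⟨by simp, ENNReal.mul_ne_top (by simp) (by simp)⟩
    · refine ENNReal.mul_ne_top (ENNReal.mul_ne_top hMtop hMtop) (ENNReal.mul_ne_top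
        (ENNReal.mul_ne_top (by simp) (ENNReal.add_ne_top.2 ⟨by simp, by simp⟩)) hκ)
  have hfd := hf.continuous_fderiv one_ne_zero
  -- Cutting the gradient off to the box keeps the integral of ψ² over all parameters and depths
  -- within the Dirichlet integral over Ω.
  let ψ : E (d - 1) × ℝ → ℝ≥0∞ :=
    (A ×ˢ Ioc 0 T).indicator fun p => ‖fderiv ℝ f (Ψ p)‖ₑ
  have hψ : Measurable ψ := by
    refine Measurable.indicator ?_ (measurableSet_ball.prod measurableSet_Ioc)
    exact (hfd.comp hΨc).enorm.measurable
  have hψv : ∀ a ∈ A, ∀ s ∈ Ioc 0 T, ψ (a, s) = ‖fderiv ℝ f (Ψ (a, s))‖ₑ :=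
    fun a ha s hs => indicator_of_mem (mk_mem_prod ha hs) _
  let g : E (d - 1) → ℝ → F := fun a r => f (Ψ (a, r))
  have hψS : ∫⁻ a, ∫⁻ s in Ioi (0 : ℝ), ψ (a, s) ^ 2 ≤ ∫⁻ x in Ω, ‖fderiv ℝ f x‖ₑ ^ 2 := by
    refine le_trans (le_of_eq ?_) (hvol (fun x => ‖fderiv ℝ f x‖ₑ ^ 2)
      (hfd.enorm.measurable.pow_const 2))
    rw [← lintegral_indicator measurableSet_ball]
    refine lintegral_congr fun a => ?_
    by_cases ha : a ∈ A
    · rw [indicator_of_mem ha, ← lintegral_indicator measurableSet_Ioc,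
        ← lintegral_indicator measurableSet_Ioi]
      refine lintegral_congr fun r => ?_
      by_cases hr : r ∈ Ioc 0 T
      · have h0 : r ∈ Ioi (0 : ℝ) := hr.1
        rw [indicator_of_mem hr, indicator_of_mem h0]
        rw [hψv a ha r hr]
      · have h0 : ψ (a, r) = 0 := indicator_of_notMem (fun h => hr h.2) _
        rw [indicator_of_notMem hr, indicator_apply]
        simp [h0]
    · have h0 : ∀ r, ψ (a, r) = 0 := fun r => indicator_of_notMem (fun h => ha h.1) _
      rw [indicator_of_notMem ha]
      simp [h0]
  have h1 : ∀ a ∈ A, ∀ r, 0 < r → r ≤ T → ‖g a 0 - g a r‖ₑ ≤ ∫⁻ s in Ioc 0 r, ψ (a, s) := by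
    intro a ha r hr hrT
    have hγ : LipschitzWith 1 (fun s : ℝ => Ψ (a, s)) := by
      refine LipschitzWith.of_dist_le_mul fun s t => ?_
      have := dist_chartPoint_le L hν hK a a s t
      simpa [Real.dist_eq] using this
    have h := enorm_sub_le_lintegral_of_lipschitz hf hγ hr.le
    rw [enorm_sub_rev]
    refine h.trans (le_of_eq ?_)
    rw [ENNReal.coe_one, one_mul]
    refine setLIntegral_congr_fun measurableSet_Ioc fun s hs => ?_
    exact (hψv a ha s ⟨hs.1, hs.2.trans hrT⟩).symm
  have h2 : ∀ a ∈ A, ∀ b ∈ A, ∀ r, 0 < r → r ≤ T → ‖g a r - g b r‖ₑ ≤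
      ((1 + K : NNReal) : ℝ≥0∞) * ‖a - b‖ₑ *
        ∫⁻ τ in Ioc (0 : ℝ) 1, ψ (b + τ • (a - b), r) := by
    intro a ha b hb r hr hrT
    -- At fixed depth the curve follows the graph over the segment from b to a, which stays in A
    -- because a ball is convex.
    have hγ : LipschitzWith ((1 + K) * ‖a - b‖₊) (fun τ : ℝ => Ψ (b + τ • (a - b), r)) := by
      refine LipschitzWith.of_dist_le_mul fun s t => ?_
      refine (dist_chartPoint_le L hν hK _ _ r r).trans (le_of_eq ?_)
      rw [add_sub_add_left_eq_sub, ← sub_smul, norm_smul, Real.dist_eq]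
      push_cast
      simp
      ring
    have h := enorm_sub_le_lintegral_of_lipschitz hf hγ (zero_le_one' ℝ)
    simp only [one_smul, zero_smul, add_zero, add_sub_cancel] at h
    refine h.trans (le_of_eq ?_)
    rw [ENNReal.coe_mul]
    congr 1
    refine setLIntegral_congr_fun measurableSet_Ioc fun τ hτ => ?_
    have hmem : b + τ • (a - b) ∈ A :=
      (convex_ball a₀ δ).add_smul_sub_mem hb ha ⟨hτ.1.le, hτ.2⟩
    exact (hψv _ hmem r ⟨hr, hrT⟩).symm
  have hAT : ∀ a ∈ A, ∀ b ∈ A, ‖a - b‖ ≤ T := by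
    intro a ha b hb
    have := dist_triangle_right a b a₀
    rw [dist_eq_norm] at this
    rw [hA, Metric.mem_ball] at ha hb
    linarith
  set N₀ := ∫⁻ x in Ω, ‖f x‖ₑ ^ 2
  set N₁ := ∫⁻ x in Ω, ‖fderiv ℝ f x‖ₑ ^ 2
  constructor
  · have hcg : Continuous (fun p : E (d - 1) × ℝ => g p.1 p.2) := hf.continuous.comp hΨc
    have hflat := flat_lintegral_sq_le (A := A) measurableSet_ball (T := T) (g := g) hψ
      (fun a => (hcg.comp (Continuous.prodMk_right a)).enorm.measurable)
      (Measurable.lintegral_prod_right' (f := fun p : E (d - 1) × ℝ => ‖g p.1 p.2‖ₑ ^ 2)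
        (hcg.enorm.measurable.pow_const 2)) h1
    have hb : ENNReal.ofReal T * ∫⁻ a in A, ‖g a 0‖ₑ ^ 2 ≤
        (2 + 2 * ENNReal.ofReal T ^ 2) * (N₀ + N₁) := by
      refine hflat.trans ?_
      have hv := hvol (fun x => ‖f x‖ₑ ^ 2) (hf.continuous.enorm.measurable.pow_const 2)
      calc _ ≤ 2 * N₀ + 2 * ENNReal.ofReal T ^ 2 * N₁ := by gcongr
        _ ≤ 2 * (N₀ + N₁) + 2 * ENNReal.ofReal T ^ 2 * (N₀ + N₁) := by
          gcongr
          · exact le_self_add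
          · exact le_add_self
        _ = _ := by ring
    calc ∫⁻ x in Metric.ball x₀ δ, ‖f x‖ₑ ^ 2 ∂(surfaceMeasure Ω)
        ≤ M * ∫⁻ a in A, ‖g a 0‖ₑ ^ 2 := hlint _
      _ = (ENNReal.ofReal T)⁻¹ * M * (ENNReal.ofReal T * ∫⁻ a in A, ‖g a 0‖ₑ ^ 2) := by
        rw [mul_comm (ENNReal.ofReal T)⁻¹ M, mul_assoc, ← mul_assoc (ENNReal.ofReal T)⁻¹,
          ENNReal.inv_mul_cancel hT0 ENNReal.ofReal_ne_top, one_mul]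
      _ ≤ (ENNReal.ofReal T)⁻¹ * M * ((2 + 2 * ENNReal.ofReal T ^ 2) * (N₀ + N₁)) := by gcongr
      _ = C₁ * (N₀ + N₁) := by rw [hC₁]; ring
      _ ≤ (C₁ + C₂) * (N₀ + N₁) := by gcongr; exact le_self_add
  · have hn : d - 1 + 1 = d := by omega
    have hflat := flat_gagliardo_le (n := d - 1) (by omega) measurableSet_ball hAT hψ h1 h2
    rw [hn] at hflat
    have hcmp : ∀ a b, ‖f (Ψ (a, 0)) - f (Ψ (b, 0))‖ₑ ^ 2 / edist (Ψ (a, 0)) (Ψ (b, 0)) ^ d ≤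
        ‖g a 0 - g b 0‖ₑ ^ 2 / ‖a - b‖ₑ ^ d := by
      intro a b
      have : ‖a - b‖ₑ ≤ edist (Ψ (a, 0)) (Ψ (b, 0)) := by
        rw [edist_dist, ← ofReal_norm]
        exact ENNReal.ofReal_le_ofReal (norm_sub_le_dist_chartPoint L hν hL φ a b 0 0)
      gcongr
    calc _ ≤ M * ∫⁻ a in A, (∫⁻ y in Metric.ball x₀ δ,
          ‖f (Ψ (a, 0)) - f y‖ₑ ^ 2 / edist (Ψ (a, 0)) y ^ d ∂(surfaceMeasure Ω)) := hlint _
      _ ≤ M * ∫⁻ a in A, M * ∫⁻ b in A,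
          ‖f (Ψ (a, 0)) - f (Ψ (b, 0))‖ₑ ^ 2 / edist (Ψ (a, 0)) (Ψ (b, 0)) ^ d := by
        gcongr with a
        exact hlint _
      _ ≤ M * ∫⁻ a in A, M * ∫⁻ b in A, ‖g a 0 - g b 0‖ₑ ^ 2 / ‖a - b‖ₑ ^ d := by
        gcongr M * ?_
        refine lintegral_mono fun a => ?_
        gcongr M * ?_
        exact lintegral_mono fun b => hcmp a b
      _ = M * (M * ∫⁻ a in A, ∫⁻ b in A, ‖g a 0 - g b 0‖ₑ ^ 2 / ‖a - b‖ₑ ^ d) := by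
        rw [lintegral_const_mul' _ _ hMtop]
      _ ≤ M * (M * (4 * (8 + ((1 + K : NNReal) : ℝ≥0∞) ^ 2) * κ * N₁)) := by
        gcongr
        exact hflat.trans (by gcongr)
      _ = C₂ * N₁ := by rw [hC₂]; ring
      _ ≤ (C₁ + C₂) * (N₀ + N₁) := by
        gcongr
        · exact le_add_self
        · exact le_add_self

end ChartTrace

/-! ### Global trace estimate for smooth functions -/

section GlobalTrace

/-- A Gagliardo integral does not localize by itself. Pairs in a common B i are counted by the local
integrals, and all remaining pairs must be dominated by l. -/
theorem lintegral_lintegral_le_of_cover {X ι : Type*} [Fintype ι] [MeasurableSpace X]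
    {μ : Measure X} [SFinite μ] {B : ι → Set X} (hB : ∀ i, MeasurableSet (B i))
    {k l : X → X → ℝ≥0∞} (hk : Measurable (Function.uncurry k))
    (hkl : ∀ᵐ x ∂μ, ∀ᵐ y ∂μ, k x y ≤
      (∑ i, (B i).indicator (fun x => (B i).indicator (k x) y) x) + l x y) :
    ∫⁻ x, ∫⁻ y, k x y ∂μ ∂μ ≤
      (∑ i, ∫⁻ x in B i, ∫⁻ y in B i, k x y ∂μ ∂μ) + ∫⁻ x, ∫⁻ y, l x y ∂μ ∂μ := by
  have e : ∀ i x y, (B i).indicator (fun x => (B i).indicator (k x) y) x =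
      (B i ×ˢ B i).indicator (Function.uncurry k) (x, y) := by
    intro i x y
    by_cases hx : x ∈ B i <;> by_cases hy : y ∈ B i <;> simp [indicator, hx, hy]
  have m : ∀ i, Measurable fun p : X × X => (B i ×ˢ B i).indicator (Function.uncurry k) p :=
    fun i => hk.indicator ((hB i).prod (hB i))
  have m1 : ∀ i x, Measurable fun y => (B i ×ˢ B i).indicator (Function.uncurry k) (x, y) :=
    fun i x => (m i).comp measurable_prodMk_left
  have m2 : ∀ i, Measurable fun x => ∫⁻ y, (B i ×ˢ B i).indicator (Function.uncurry k) (x, y) ∂μ :=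
    fun i => (m i).lintegral_prod_right'
  have int : ∀ i, ∫⁻ x, ∫⁻ y, (B i ×ˢ B i).indicator (Function.uncurry k) (x, y) ∂μ ∂μ =
      ∫⁻ x in B i, ∫⁻ y in B i, k x y ∂μ ∂μ := by
    intro i
    rw [← lintegral_indicator (hB i)]
    refine lintegral_congr fun x => ?_
    simp only [← e]
    by_cases hx : x ∈ B i
    · simp only [indicator_of_mem hx]
      rw [lintegral_indicator (hB i)]
    · simp [indicator_of_notMem hx]
  simp only [e] at hkl
  calc ∫⁻ x, ∫⁻ y, k x y ∂μ ∂μ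
      ≤ ∫⁻ x, ∫⁻ y, ((∑ i, (B i ×ˢ B i).indicator (Function.uncurry k) (x, y)) + l x y) ∂μ ∂μ :=
        lintegral_mono_ae (hkl.mono fun x hx => lintegral_mono_ae hx)
    _ = ∫⁻ x, ((∑ i, ∫⁻ y, (B i ×ˢ B i).indicator (Function.uncurry k) (x, y) ∂μ) +
          ∫⁻ y, l x y ∂μ) ∂μ := by
        refine lintegral_congr fun x => ?_
        rw [lintegral_add_left (Finset.measurable_fun_sum _ fun i _ => m1 i x),
          lintegral_finsetSum _ fun i _ => m1 i x]
    _ = _ := by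
        rw [lintegral_add_left (Finset.measurable_fun_sum _ fun i _ => m2 i),
          lintegral_finsetSum _ fun i _ => m2 i]
        simp only [int]

variable {d : ℕ} {F : Type*} [NormedAddCommGroup F] [NormedSpace ℝ F]

theorem IsPolyhedralDomain.isCompact_frontier {Ω : Set (E d)} (hΩ : IsPolyhedralDomain Ω) :
    IsCompact (frontier Ω) :=
  hΩ.isBounded.isCompact_closure.of_isClosed_subset isClosed_frontier frontier_subset_closure

/-- The local trace estimate for the constant function 1 bounds the surface measure near each
boundary point by the volume of Ω, and Γ is compact. -/
theorem IsPolyhedralDomain.isFiniteMeasure_surfaceMeasure (hd : 2 ≤ d) {Ω : Set (E d)}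
    (hΩ : IsPolyhedralDomain Ω) : IsFiniteMeasure (surfaceMeasure Ω) := by
  have key : surfaceMeasure Ω (frontier Ω) < ⊤ := by
    refine hΩ.isCompact_frontier.measure_lt_top_of_nhdsWithin fun x hx => ?_
    obtain ⟨δ, hδ, C, hC, h⟩ := hΩ.exists_local_trace (F := ℝ) hd hx
    refine ⟨Metric.ball x δ, mem_nhdsWithin_of_mem_nhds (Metric.ball_mem_nhds x hδ), ?_⟩
    have h1 := (h (fun _ => (1 : ℝ)) contDiff_const).1
    have hv : volume Ω < ⊤ := hΩ.isBounded.measure_lt_top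
    have h0 : ∀ x : E d, fderiv ℝ (fun _ : E d => (1 : ℝ)) x = 0 := fun x => by simp
    simp only [h0, enorm_one, one_pow, lintegral_const, one_mul,
      Measure.restrict_apply MeasurableSet.univ, univ_inter] at h1
    exact h1.trans_lt (ENNReal.mul_lt_top hC.lt_top (ENNReal.add_lt_top.2
      ⟨hv, ENNReal.mul_lt_top (ENNReal.pow_lt_top enorm_lt_top) hv⟩))
  refine ⟨?_⟩
  rw [surfaceMeasure, Measure.restrict_apply isClosed_frontier.measurableSet, inter_self] at key
  rwa [surfaceMeasure, Measure.restrict_apply MeasurableSet.univ, univ_inter]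

theorem ae_mem_frontier (Ω : Set (E d)) : ∀ᵐ x ∂(surfaceMeasure Ω), x ∈ frontier Ω :=
  ae_restrict_mem isClosed_frontier.measurableSet

theorem opNorm_le_sum_norm_single (A : E d →L[ℝ] F) :
    ‖A‖ ≤ ∑ k, ‖A (EuclideanSpace.single k 1)‖ := by
  refine A.opNorm_le_bound (Finset.sum_nonneg fun _ _ => norm_nonneg _) fun x => ?_
  have e : x = ∑ k, x k • EuclideanSpace.single k (1 : ℝ) := by
    ext i
    simp [Finset.sum_apply, Pi.single_apply]
  conv_lhs => rw [e, map_sum]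
  rw [Finset.sum_mul]
  refine (norm_sum_le _ _).trans (Finset.sum_le_sum fun k _ => ?_)
  rw [map_smul, norm_smul, mul_comm]
  gcongr
  exact PiLp.norm_apply_le x k

theorem enorm_opNorm_sq_le (A : E d →L[ℝ] F) :
    ‖A‖ₑ ^ 2 ≤ d * ∑ k, ‖A (EuclideanSpace.single k 1)‖ₑ ^ 2 := by
  have h : ‖A‖ ^ 2 ≤ d * ∑ k, ‖A (EuclideanSpace.single k 1)‖ ^ 2 := by
    refine (pow_le_pow_left₀ (norm_nonneg _) (opNorm_le_sum_norm_single A) 2).trans ?_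
    simpa using sq_sum_le_card_mul_sum_sq (s := Finset.univ)
      (f := fun k => ‖A (EuclideanSpace.single k 1)‖)
  have h2 := ENNReal.ofReal_le_ofReal h
  rw [ENNReal.ofReal_mul (Nat.cast_nonneg d), ENNReal.ofReal_sum_of_nonneg
    (fun _ _ => sq_nonneg _)] at h2
  simpa only [ENNReal.ofReal_pow (norm_nonneg _), ofReal_norm, ENNReal.ofReal_natCast] using h2

/-- The curve estimates use the operator norm of the derivative, while the Sobolev norm uses partial
derivatives. Cauchy–Schwarz over the d coordinates costs the factor d. -/
theorem lintegral_sq_add_lintegral_fderiv_sq_le [CompleteSpace F] {Ω : Set (E d)}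
    (hΩ : IsOpen Ω) {f : E d → F} (hf : ContDiff ℝ ∞ f) :
    (∫⁻ x in Ω, ‖f x‖ₑ ^ 2) + ∫⁻ x in Ω, ‖fderiv ℝ f x‖ₑ ^ 2 ≤
      (1 + d) * eSobolevNorm 1 Ω f ^ 2 := by
  rw [eSobolevNorm_one_sq hΩ (hf.continuous.locallyIntegrable.locallyIntegrableOn Ω)
    (fun k => isWeakDeriv_of_contDiff hf)]
  have hfd : Continuous (fderiv ℝ f) := hf.continuous_fderiv (by simp)
  have h1 : ∫⁻ x in Ω, ‖fderiv ℝ f x‖ₑ ^ 2 ≤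
      d * ∑ k, ∫⁻ x in Ω, ‖fderiv ℝ f x (EuclideanSpace.single k 1)‖ₑ ^ 2 := by
    have m : ∀ k : Fin d, Measurable fun x =>
        ‖fderiv ℝ f x (EuclideanSpace.single k 1)‖ₑ ^ 2 := fun k =>
      (hfd.clm_apply continuous_const).enorm.measurable.pow_const 2
    rw [← lintegral_finsetSum _ fun k _ => m k,
      ← lintegral_const_mul _ (Finset.measurable_fun_sum _ fun k _ => m k)]
    exact lintegral_mono fun x => enorm_opNorm_sq_le _
  set a := ∫⁻ x in Ω, ‖f x‖ₑ ^ 2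
  set b := ∑ k, ∫⁻ x in Ω, ‖fderiv ℝ f x (EuclideanSpace.single k 1)‖ₑ ^ 2
  calc a + ∫⁻ x in Ω, ‖fderiv ℝ f x‖ₑ ^ 2 ≤ 1 * a + d * b := by rw [one_mul]; gcongr
    _ ≤ 1 * (a + b) + d * (a + b) := by
      gcongr
      · exact le_self_add
      · exact le_add_self
    _ = (1 + d) * (a + b) := by ring

/-- The trace estimate `H¹(Ω) → H^{1/2}(Γ)` for smooth functions. -/
theorem IsPolyhedralDomain.exists_smooth_trace_bound [CompleteSpace F] (hd : 2 ≤ d)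
    {Ω : Set (E d)} (hΩ : IsPolyhedralDomain Ω) :
    ∃ C : ℝ≥0∞, C ≠ ⊤ ∧ ∀ f : E d → F, ContDiff ℝ ∞ f →
      ∫⁻ x, ‖f x‖ₑ ^ 2 ∂(surfaceMeasure Ω) ≤ C * eSobolevNorm 1 Ω f ^ 2 ∧
      ∫⁻ x, ∫⁻ y, ‖f x - f y‖ₑ ^ 2 / edist x y ^ d ∂(surfaceMeasure Ω) ∂(surfaceMeasure Ω) ≤
        C * eSobolevNorm 1 Ω f ^ 2 := by
  have := hΩ.isFiniteMeasure_surfaceMeasure hd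
  choose! δ hδ c hc hloc using fun x (hx : x ∈ frontier Ω) =>
    hΩ.exists_local_trace (F := F) hd hx
  obtain ⟨t, ht⟩ := hΩ.isCompact_frontier.elim_nhds_subcover' (fun x _ => Metric.ball x (δ x))
    fun x hx => Metric.ball_mem_nhds x (hδ x hx)
  let B : t → Set (E d) := fun i => Metric.ball (i : E d) (δ i)
  have hcov : frontier Ω ⊆ ⋃ i, B i := by
    refine ht.trans (iUnion₂_subset fun i hi => ?_)
    exact subset_iUnion B ⟨i, hi⟩
  -- With a Lebesgue number η of the covering, a point of Γ and any point closer than η lie in a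
  -- common ball. For the remaining pairs the kernel is bounded by η^{-d}.
  obtain ⟨η, hη, hleb⟩ := lebesgue_number_lemma_of_metric hΩ.isCompact_frontier
    (fun i => Metric.isOpen_ball) hcov
  set σ := surfaceMeasure Ω
  set C₀ : ℝ≥0∞ := ∑ i : t, c i with hC₀
  have hC₀' : C₀ ≠ ⊤ := ENNReal.sum_ne_top.2 fun i _ => hc _ i.1.2
  -- For distant pairs |f x - f y|² ≤ 2(|f x|² + |f y|²). Integrating over Γ × Γ gives each of the
  -- two terms the factor σ(Γ), hence 4σ(Γ)/η^d.
  set C₁ : ℝ≥0∞ := 4 * σ univ / ENNReal.ofReal η ^ d with hC₁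
  have hC₁' : C₁ ≠ ⊤ := by
    refine ENNReal.div_ne_top (ENNReal.mul_ne_top (by simp) (measure_ne_top _ _)) ?_
    simp [hη]
  refine ⟨(1 + C₁) * C₀ * (1 + d), ?_, fun f hf => ?_⟩
  · refine ENNReal.mul_ne_top (ENNReal.mul_ne_top ?_ hC₀') (by simp)
    exact ENNReal.add_ne_top.2 ⟨by simp, hC₁'⟩
  have hf1 : ContDiff ℝ 1 f := hf.of_le (by simp)
  set N := (∫⁻ x in Ω, ‖f x‖ₑ ^ 2) + ∫⁻ x in Ω, ‖fderiv ℝ f x‖ₑ ^ 2 with hN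
  have hNS : N ≤ (1 + d) * eSobolevNorm 1 Ω f ^ 2 :=
    lintegral_sq_add_lintegral_fderiv_sq_le hΩ.isOpen hf
  have b1 : ∫⁻ x, ‖f x‖ₑ ^ 2 ∂σ ≤ C₀ * N := by
    calc ∫⁻ x, ‖f x‖ₑ ^ 2 ∂σ = ∫⁻ x in frontier Ω, ‖f x‖ₑ ^ 2 ∂σ := by
          rw [Measure.restrict_eq_self_of_ae_mem (ae_mem_frontier Ω)]
      _ ≤ ∫⁻ x in ⋃ i, B i, ‖f x‖ₑ ^ 2 ∂σ := lintegral_mono_set hcov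
      _ ≤ ∑' i, ∫⁻ x in B i, ‖f x‖ₑ ^ 2 ∂σ := lintegral_iUnion_le _ _
      _ = ∑ i, ∫⁻ x in B i, ‖f x‖ₑ ^ 2 ∂σ := tsum_fintype _
      _ ≤ ∑ i : t, c i * N := Finset.sum_le_sum fun i _ => (hloc i i.1.2 f hf1).1
      _ = C₀ * N := by rw [hC₀, Finset.sum_mul]
  let k : E d → E d → ℝ≥0∞ := fun x y => ‖f x - f y‖ₑ ^ 2 / edist x y ^ d
  have hk : Measurable (Function.uncurry k) := by
    have h1 : Continuous fun p : E d × E d => f p.1 - f p.2 :=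
      (hf.continuous.comp continuous_fst).sub (hf.continuous.comp continuous_snd)
    have h2 : Measurable fun p : E d × E d => edist p.1 p.2 ^ d :=
      (measurable_fst.edist measurable_snd).pow_const d
    exact (h1.enorm.measurable.pow_const 2).div h2
  let l : E d → E d → ℝ≥0∞ := fun x y =>
    2 * (‖f x‖ₑ ^ 2 + ‖f y‖ₑ ^ 2) / ENNReal.ofReal η ^ d
  have hkl : ∀ᵐ x ∂σ, ∀ᵐ y ∂σ, k x y ≤
      (∑ i, (B i).indicator (fun x => (B i).indicator (k x) y) x) + l x y := by
    filter_upwards [ae_mem_frontier Ω] with x hx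
    refine Eventually.of_forall fun y => ?_
    rcases lt_or_ge (dist y x) η with h | h
    · obtain ⟨i, hi⟩ := hleb x hx
      have hxi : x ∈ B i := hi (Metric.mem_ball_self hη)
      have hyi : y ∈ B i := hi h
      refine le_trans ?_ le_self_add
      refine le_trans (le_of_eq ?_) (Finset.single_le_sum
        (f := fun i => (B i).indicator (fun x => (B i).indicator (k x) y) x)
        (fun _ _ => zero_le) (Finset.mem_univ i))
      simp only [indicator_of_mem hxi, indicator_of_mem hyi]
    · refine le_trans ?_ le_add_self
      have h1 : ENNReal.ofReal η ≤ edist x y := by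
        rw [edist_dist, dist_comm]; exact ENNReal.ofReal_le_ofReal h
      have h2 : ‖f x - f y‖ₑ ^ 2 ≤ 2 * (‖f x‖ₑ ^ 2 + ‖f y‖ₑ ^ 2) :=
        (pow_le_pow_left' (enorm_sub_le) 2).trans (ennreal_add_sq_le _ _)
      simp only [k, l]
      gcongr
  have hl : ∫⁻ x, ∫⁻ y, l x y ∂σ ∂σ = C₁ * ∫⁻ x, ‖f x‖ₑ ^ 2 ∂σ := by
    have m : Measurable fun x => ‖f x‖ₑ ^ 2 := hf.continuous.enorm.measurable.pow_const 2
    set I := ∫⁻ x, ‖f x‖ₑ ^ 2 ∂σ with hI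
    have e1 : ∀ x, ∫⁻ y, l x y ∂σ =
        2 / ENNReal.ofReal η ^ d * (‖f x‖ₑ ^ 2 * σ univ + I) := by
      intro x
      have e : ∀ y, l x y = 2 / ENNReal.ofReal η ^ d * (‖f x‖ₑ ^ 2 + ‖f y‖ₑ ^ 2) := fun y => by
        simp only [l, div_eq_mul_inv]; ring
      simp only [e]
      have mx : Measurable fun y => ‖f x‖ₑ ^ 2 + ‖f y‖ₑ ^ 2 := measurable_const.add m
      rw [lintegral_const_mul _ mx, lintegral_add_right _ m,
        lintegral_const]
    simp only [e1]
    have mx : Measurable fun x => ‖f x‖ₑ ^ 2 * σ univ + I := (m.mul_const _).add measurable_const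
    rw [lintegral_const_mul _ mx,
      lintegral_add_right _ measurable_const, lintegral_mul_const _ m, lintegral_const, ← hI, hC₁]
    simp only [div_eq_mul_inv]
    ring
  have b2 : ∫⁻ x, ∫⁻ y, k x y ∂σ ∂σ ≤ (1 + C₁) * (C₀ * N) := by
    calc ∫⁻ x, ∫⁻ y, k x y ∂σ ∂σ
        ≤ (∑ i, ∫⁻ x in B i, ∫⁻ y in B i, k x y ∂σ ∂σ) + ∫⁻ x, ∫⁻ y, l x y ∂σ ∂σ :=
          lintegral_lintegral_le_of_cover (fun i => measurableSet_ball) hk hkl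
      _ ≤ (∑ i : t, c i * N) + C₁ * (C₀ * N) := by
          rw [hl]
          gcongr with i
          exact (hloc i i.1.2 f hf1).2
      _ = _ := by rw [← Finset.sum_mul, ← hC₀]; ring
  constructor
  · calc ∫⁻ x, ‖f x‖ₑ ^ 2 ∂σ ≤ 1 * (C₀ * N) := by rw [one_mul]; exact b1
      _ ≤ (1 + C₁) * (C₀ * ((1 + d) * eSobolevNorm 1 Ω f ^ 2)) := by
        gcongr
        exact le_self_add
      _ = _ := by ring
  · calc _ ≤ (1 + C₁) * (C₀ * N) := b2
      _ ≤ (1 + C₁) * (C₀ * ((1 + d) * eSobolevNorm 1 Ω f ^ 2)) := by gcongr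
      _ = _ := by ring

end GlobalTrace

/-! ### Existence, linearity and boundedness of traces on H¹ -/

section Trace

variable {d : ℕ} {Ω : Set (E d)}

theorem eBdryNorm_half_sq (hd : 1 ≤ d) (g : L2bdry Ω) :
    eBdryNorm (1 / 2) Ω g ^ 2 = (∫⁻ x, ‖g x‖ₑ ^ 2 ∂(surfaceMeasure Ω)) +
      ∫⁻ x, ∫⁻ y, ‖g x - g y‖ₑ ^ 2 / edist x y ^ d ∂(surfaceMeasure Ω) ∂(surfaceMeasure Ω) := by
  have e : (((d - 1 : ℕ) : ℝ) + 2 * (1 / 2)) = d := by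
    push_cast [hd]
    ring
  rw [eBdryNorm, if_neg (by norm_num), ← ENNReal.rpow_natCast, ← ENNReal.rpow_mul, eGagliardoSq]
  simp only [e, ENNReal.rpow_natCast]
  norm_num

/-- Fatou's lemma, applied once in each variable. Off the diagonal the integrands converge, and on
it the limit integrand is 0. -/
theorem lintegral_lintegral_quotient_le_liminf {F : Type*} [NormedAddCommGroup F]
    {μ : Measure (E d)} [SFinite μ] {f : ℕ → E d → F} (hf : ∀ n, Continuous (f n)) {g : E d → F}
    (h : ∀ᵐ x ∂μ, Tendsto (fun n => f n x) atTop (𝓝 (g x))) :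
    ∫⁻ x, ∫⁻ y, ‖g x - g y‖ₑ ^ 2 / edist x y ^ d ∂μ ∂μ ≤
      liminf (fun n => ∫⁻ x, ∫⁻ y, ‖f n x - f n y‖ₑ ^ 2 / edist x y ^ d ∂μ ∂μ) atTop := by
  have m : ∀ n, Measurable fun p : E d × E d =>
      ‖f n p.1 - f n p.2‖ₑ ^ 2 / edist p.1 p.2 ^ d := by
    intro n
    have h1 : Continuous fun p : E d × E d => f n p.1 - f n p.2 :=
      ((hf n).comp continuous_fst).sub ((hf n).comp continuous_snd)
    exact (h1.enorm.measurable.pow_const 2).div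
      ((measurable_fst.edist measurable_snd).pow_const d)
  calc ∫⁻ x, ∫⁻ y, ‖g x - g y‖ₑ ^ 2 / edist x y ^ d ∂μ ∂μ
      ≤ ∫⁻ x, ∫⁻ y, liminf (fun n => ‖f n x - f n y‖ₑ ^ 2 / edist x y ^ d) atTop ∂μ ∂μ := by
        refine lintegral_mono_ae (h.mono fun x hx => lintegral_mono_ae (h.mono fun y hy => ?_))
        rcases eq_or_ne x y with rfl | hxy
        · simp
        · have h1 : Tendsto (fun n => ‖f n x - f n y‖ₑ ^ 2 / edist x y ^ d) atTop
              (𝓝 (‖g x - g y‖ₑ ^ 2 / edist x y ^ d)) :=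
            ENNReal.Tendsto.div_const (ENNReal.Tendsto.pow (hx.sub hy).enorm)
              (Or.inr (pow_ne_zero _ (by simpa using hxy)))
          exact h1.liminf_eq.ge
    _ ≤ ∫⁻ x, liminf (fun n => ∫⁻ y, ‖f n x - f n y‖ₑ ^ 2 / edist x y ^ d ∂μ) atTop ∂μ :=
        lintegral_mono fun x => lintegral_liminf_le fun n => (m n).comp measurable_prodMk_left
    _ ≤ _ := lintegral_liminf_le fun n => (m n).lintegral_prod_right'

theorem lintegral_sq_le_liminf {F : Type*} [NormedAddCommGroup F] {μ : Measure (E d)}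
    {f : ℕ → E d → F} (hf : ∀ n, Continuous (f n)) {g : E d → F}
    (h : ∀ᵐ x ∂μ, Tendsto (fun n => f n x) atTop (𝓝 (g x))) :
    ∫⁻ x, ‖g x‖ₑ ^ 2 ∂μ ≤ liminf (fun n => ∫⁻ x, ‖f n x‖ₑ ^ 2 ∂μ) atTop :=
  (lintegral_mono_ae (h.mono fun _ hx =>
    (ENNReal.Tendsto.pow hx.enorm).liminf_eq.ge)).trans
      (lintegral_liminf_le fun n => (hf n).enorm.measurable.pow_const 2)

/-- The trace theorem `H¹(Ω) → H^{1/2}(Γ)`. -/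
theorem IsPolyhedralDomain.exists_trace_bound (hd : 2 ≤ d) (hΩ : IsPolyhedralDomain Ω) :
    ∃ C : ℝ≥0∞, C ≠ ⊤ ∧ ∀ (v : L2vec Ω) (g : L2bdry Ω), IsTrace Ω v g →
      eBdryNorm (1 / 2) Ω g ^ 2 ≤ C * eSobolevNorm 1 Ω v ^ 2 := by
  have := hΩ.isFiniteMeasure_surfaceMeasure hd
  obtain ⟨C, hC, hb⟩ := hΩ.exists_smooth_trace_bound (F := E d) hd
  -- A subsequence of the smooth approximants converges a.e. on Γ. Comparing ‖φₙ‖² with 2‖φₙ - v‖² +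
  -- 2‖v‖² gives a factor 2, and the two parts of the boundary norm give another.
  refine ⟨C * 4, ENNReal.mul_ne_top hC (by simp), fun v g ⟨φ, hφ, hφv, hφg⟩ => ?_⟩
  have hm := tendstoInMeasure_of_tendsto_eLpNorm (by simp)
    (fun n => (hφ n).continuous.aestronglyMeasurable) (Lp.memLp g).1 hφg
  obtain ⟨ns, hns, hae⟩ := hm.exists_seq_tendsto_ae
  have hcont : ∀ i, Continuous (φ (ns i)) := fun i => (hφ _).continuous
  set N := eSobolevNorm 1 Ω v
  have hlim : Tendsto (fun i => C * (2 * eSobolevNorm 1 Ω (fun x => φ (ns i) x - v x) ^ 2 +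
      2 * N ^ 2)) atTop (𝓝 (C * (2 * 0 ^ 2 + 2 * N ^ 2))) := by
    refine ENNReal.Tendsto.const_mul (Tendsto.add (ENNReal.Tendsto.const_mul
      (ENNReal.Tendsto.pow (hφv.comp hns.tendsto_atTop)) (Or.inr (by simp)))
      tendsto_const_nhds) (Or.inr hC)
  have hbd : ∀ i, C * eSobolevNorm 1 Ω (φ (ns i)) ^ 2 ≤
      C * (2 * eSobolevNorm 1 Ω (fun x => φ (ns i) x - v x) ^ 2 + 2 * N ^ 2) := by
    intro i
    gcongr
    simpa using eSobolevNorm_one_add_sq_le hΩ.isOpen (fun x => φ (ns i) x - v x) v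
  have hfin : ∀ a : ℕ → ℝ≥0∞, (∀ i, a i ≤ C * eSobolevNorm 1 Ω (φ (ns i)) ^ 2) →
      liminf a atTop ≤ C * (2 * N ^ 2) := by
    intro a ha
    have h1 := liminf_le_liminf (f := atTop) (Eventually.of_forall fun i => (ha i).trans (hbd i))
    rw [hlim.liminf_eq] at h1
    simpa using h1
  rw [eBdryNorm_half_sq (by omega)]
  calc _ ≤ C * (2 * N ^ 2) + C * (2 * N ^ 2) := by
        refine add_le_add ?_ ?_
        · exact (lintegral_sq_le_liminf hcont hae).trans (hfin _ fun i => (hb _ (hφ _)).1)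
        · exact (lintegral_lintegral_quotient_le_liminf hcont hae).trans
            (hfin _ fun i => (hb _ (hφ _)).2)
    _ = _ := by ring

theorem eSobolevNorm_one_add_le {F : Type*} [NormedAddCommGroup F] [NormedSpace ℝ F]
    [CompleteSpace F] (hΩ : IsOpen Ω) (u v : E d → F) :
    eSobolevNorm 1 Ω (fun x => u x + v x) ≤
      2 * eSobolevNorm 1 Ω u + 2 * eSobolevNorm 1 Ω v := by
  rw [← ENNReal.pow_le_pow_left_iff two_ne_zero]
  refine (eSobolevNorm_one_add_sq_le hΩ u v).trans ?_
  set a := eSobolevNorm 1 Ω u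
  set b := eSobolevNorm 1 Ω v
  calc 2 * a ^ 2 + 2 * b ^ 2 ≤ 2 * a ^ 2 + 2 * b ^ 2 + (2 * a ^ 2 + 2 * b ^ 2 + 8 * a * b) :=
        le_self_add
    _ = (2 * a + 2 * b) ^ 2 := by ring

theorem eSobolevNorm_one_smul_le {F : Type*} [NormedAddCommGroup F] [NormedSpace ℝ F]
    [CompleteSpace F] (hΩ : IsOpen Ω) {v : E d → F} (hv : MemSobolev 1 Ω v) (c : ℝ) :
    eSobolevNorm 1 Ω (fun x => c • v x) ≤ ‖c‖ₑ * eSobolevNorm 1 Ω v := by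
  obtain ⟨h1, -, w, hw, -⟩ := hv.exists_weakDeriv hΩ
  rw [← ENNReal.pow_le_pow_left_iff two_ne_zero, mul_pow,
    eSobolevNorm_one_sq (v := fun x => c • v x) hΩ (h1.smul c) (fun k => (hw k).const_smul c),
    eSobolevNorm_one_sq hΩ h1 hw]
  simp only [enorm_smul, mul_pow]
  have h : ‖c‖ₑ ^ 2 ≠ ⊤ := by simp
  simp only [lintegral_const_mul' _ _ h]
  rw [← Finset.mul_sum, ← mul_add]

theorem IsTrace.add (hΩ : IsOpen Ω) {v v' : L2vec Ω} {g g' : L2bdry Ω} (h : IsTrace Ω v g)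
    (h' : IsTrace Ω v' g') : IsTrace Ω (v + v') (g + g') := by
  obtain ⟨φ, h1, h2, h3⟩ := h
  obtain ⟨φ', h1', h2', h3'⟩ := h'
  refine ⟨fun n x => φ n x + φ' n x, fun n => (h1 n).add (h1' n), ?_, ?_⟩
  · have hlim : Tendsto (fun n => 2 * eSobolevNorm 1 Ω (fun x => φ n x - v x) +
        2 * eSobolevNorm 1 Ω (fun x => φ' n x - v' x)) atTop (𝓝 (2 * 0 + 2 * 0)) :=
      (ENNReal.Tendsto.const_mul h2 (Or.inr (by simp))).add
        (ENNReal.Tendsto.const_mul h2' (Or.inr (by simp)))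
    rw [mul_zero, add_zero] at hlim
    refine tendsto_of_tendsto_of_tendsto_of_le_of_le tendsto_const_nhds hlim
      (fun _ => zero_le) fun n => ?_
    have e : eSobolevNorm 1 Ω (fun x => φ n x + φ' n x - (v + v' : L2vec Ω) x) =
        eSobolevNorm 1 Ω (fun x => (φ n x - v x) + (φ' n x - v' x)) := by
      refine eSobolevNorm_one_congr ?_
      filter_upwards [Lp.coeFn_add v v'] with x hx
      rw [hx, Pi.add_apply]
      abel
    exact e.le.trans (eSobolevNorm_one_add_le hΩ _ _)
  · have hlim := h3.add h3'
    rw [add_zero] at hlim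
    refine tendsto_of_tendsto_of_tendsto_of_le_of_le tendsto_const_nhds hlim
      (fun _ => zero_le) fun n => ?_
    have e : eLpNorm (fun x => φ n x + φ' n x - (g + g' : L2bdry Ω) x) 2 (surfaceMeasure Ω) =
        eLpNorm ((fun x => φ n x - g x) + (fun x => φ' n x - g' x)) 2 (surfaceMeasure Ω) := by
      refine eLpNorm_congr_ae ?_
      filter_upwards [Lp.coeFn_add g g'] with x hx
      rw [hx, Pi.add_apply, Pi.add_apply]
      abel
    exact e.le.trans (eLpNorm_add_le
      ((h1 n).continuous.aestronglyMeasurable.sub (Lp.memLp g).1)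
      ((h1' n).continuous.aestronglyMeasurable.sub (Lp.memLp g').1) (by norm_num))

theorem IsTrace.const_smul (hΩ : IsOpen Ω) {v : L2vec Ω} {g : L2bdry Ω} (h : IsTrace Ω v g)
    (c : ℝ) : IsTrace Ω (c • v) (c • g) := by
  obtain ⟨φ, h1, h2, h3⟩ := h
  refine ⟨fun n x => c • φ n x, fun n => (h1 n).const_smul c, ?_, ?_⟩
  · have hlim := ENNReal.Tendsto.const_mul (a := ‖c‖ₑ) h2 (Or.inr (by simp))
    rw [mul_zero] at hlim
    refine tendsto_of_tendsto_of_tendsto_of_le_of_le' tendsto_const_nhds hlim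
      (Eventually.of_forall fun _ => zero_le) ?_
    filter_upwards [h2.eventually (gt_mem_nhds ENNReal.zero_lt_top)] with n hn
    refine le_trans (le_of_eq (eSobolevNorm_one_congr ?_)) (eSobolevNorm_one_smul_le hΩ hn c)
    filter_upwards [Lp.coeFn_smul c v] with x hx
    rw [hx, Pi.smul_apply, smul_sub]
  · have hlim := ENNReal.Tendsto.const_mul (a := ‖c‖ₑ) h3 (Or.inr (by simp))
    rw [mul_zero] at hlim
    refine hlim.congr fun n => ?_
    rw [← eLpNorm_const_smul]
    refine eLpNorm_congr_ae ?_
    filter_upwards [Lp.coeFn_smul c g] with x hx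
    rw [hx, Pi.smul_apply, Pi.smul_apply, smul_sub]

theorem IsTrace.sub (hΩ : IsOpen Ω) {v v' : L2vec Ω} {g g' : L2bdry Ω} (h : IsTrace Ω v g)
    (h' : IsTrace Ω v' g') : IsTrace Ω (v - v') (g - g') := by
  have := h.add hΩ (h'.const_smul hΩ (-1))
  simpa [sub_eq_add_neg] using this

theorem isTrace_zero (hΩ : IsOpen Ω) : IsTrace Ω (0 : L2vec Ω) (0 : L2bdry Ω) := by
  refine ⟨fun _ _ => 0, fun n => contDiff_const, ?_, ?_⟩
  · have e : eSobolevNorm 1 Ω (fun x => 0 - (0 : L2vec Ω) x) = 0 := by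
      rw [eSobolevNorm_one_congr (v' := fun _ => (0 : E d)),
        ← pow_eq_zero_iff two_ne_zero, eSobolevNorm_one_sq hΩ
        (continuous_const.locallyIntegrable.locallyIntegrableOn Ω)
        (fun k => isWeakDeriv_of_contDiff contDiff_const)]
      · simp
      · filter_upwards [Lp.coeFn_zero (E d) 2 (volume.restrict Ω)] with x hx
        rw [hx]; simp
    simp only [e]
    exact tendsto_const_nhds
  · have e : eLpNorm (fun x => 0 - (0 : L2bdry Ω) x) 2 (surfaceMeasure Ω) = 0 := by
      rw [eLpNorm_congr_ae (g := 0)]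
      · simp
      · filter_upwards [Lp.coeFn_zero (E d) 2 (surfaceMeasure Ω)] with x hx
        rw [hx]; simp
    simp only [e]
    exact tendsto_const_nhds

/-- Every function in `H¹(Ω)` has a trace. -/
theorem IsPolyhedralDomain.exists_isTrace (hd : 2 ≤ d) (hΩ : IsPolyhedralDomain Ω) {v : L2vec Ω}
    (hv : MemSobolev 1 Ω v) : ∃ g : L2bdry Ω, IsTrace Ω v g := by
  obtain ⟨C, hC, hb⟩ := hΩ.exists_smooth_trace_bound (F := E d) hd
  obtain ⟨φ, hφ, hφv⟩ := hΩ.exists_smooth_tendsto (by omega) hv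
  have hlim : Tendsto (fun n => C * (4 * eSobolevNorm 1 Ω (fun x => φ n x - v x) ^ 2)) atTop
      (𝓝 0) := by
    have h1 := ENNReal.Tendsto.const_mul (a := C) (ENNReal.Tendsto.const_mul (a := 4)
      (ENNReal.Tendsto.pow (n := 2) hφv) (Or.inr (by simp))) (Or.inr hC)
    simpa using h1
  -- A subsequence whose boundary values are Cauchy in L²(Γ) at a summable rate, as the completeness
  -- lemma requires. The rate in H¹ is carried over by the smooth trace bound applied to
  -- differences.
  let B : ℕ → ℝ≥0∞ := fun n => (1 / 2) ^ n
  have hB0 : ∀ n, 0 < B n ^ 2 := fun n =>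
    ENNReal.pow_pos (ENNReal.pow_pos (by simp) n) 2
  obtain ⟨ns, hns, hlt⟩ := extraction_forall_of_eventually fun n =>
    (hφv.eventually (gt_mem_nhds ENNReal.zero_lt_top)).and
      (hlim.eventually (gt_mem_nhds (hB0 n)))
  have hmem : ∀ i, MemLp (φ (ns i)) 2 (surfaceMeasure Ω) := by
    intro i
    refine memLp_two_of_lintegral_lt_top (hφ _).continuous.aestronglyMeasurable ?_
    refine (hb _ (hφ _)).1.trans_lt (ENNReal.mul_lt_top hC.lt_top (ENNReal.pow_lt_top ?_))
    have h1 := eSobolevNorm_one_add_le hΩ.isOpen (fun x => φ (ns i) x - v x) v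
    simp only [sub_add_cancel] at h1
    refine h1.trans_lt (ENNReal.add_lt_top.2 ⟨ENNReal.mul_lt_top (by simp) (hlt i).1,
      ENNReal.mul_lt_top (by simp) hv⟩)
  have hcau : ∀ M n m, M ≤ n → M ≤ m →
      eLpNorm (φ (ns n) - φ (ns m)) 2 (surfaceMeasure Ω) < B M := by
    intro M n m hn hm
    have hmono : ∀ n, M ≤ n → C * (4 * eSobolevNorm 1 Ω (fun x => φ (ns n) x - v x) ^ 2) <
        B M ^ 2 := by
      intro n hn
      refine (hlt n).2.trans_le (pow_le_pow_left' ?_ 2)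
      exact pow_le_pow_right_of_le_one' (by simp) hn
    have h2 : eSobolevNorm 1 Ω (φ (ns n) - φ (ns m)) ^ 2 ≤
        2 * eSobolevNorm 1 Ω (fun x => φ (ns n) x - v x) ^ 2 +
        2 * eSobolevNorm 1 Ω (fun x => φ (ns m) x - v x) ^ 2 := by
      have e : φ (ns n) - φ (ns m) = fun x => (φ (ns n) x - v x) + -(φ (ns m) x - v x) := by
        ext1 x
        rw [Pi.sub_apply]
        abel
      rw [e]
      refine (eSobolevNorm_one_add_sq_le hΩ.isOpen _ _).trans ?_
      gcongr
      exact eSobolevNorm_one_neg Ω _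
    rw [← ENNReal.pow_lt_pow_left_iff two_ne_zero, eLpNorm_two_sq]
    refine ((hb _ ((hφ _).sub (hφ _))).1.trans (mul_le_mul_right h2 C)).trans_lt ?_
    set a := eSobolevNorm 1 Ω (fun x => φ (ns n) x - v x)
    set b := eSobolevNorm 1 Ω (fun x => φ (ns m) x - v x)
    have e4 : C * (2 * a ^ 2 + 2 * b ^ 2) ≤ C * (4 * (max a b) ^ 2) := by
      calc C * (2 * a ^ 2 + 2 * b ^ 2) ≤ C * (2 * (max a b) ^ 2 + 2 * (max a b) ^ 2) := by
            gcongr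
            · exact le_max_left _ _
            · exact le_max_right _ _
        _ = _ := by ring
    refine e4.trans_lt ?_
    rcases max_choice a b with h | h <;> rw [h]
    · exact hmono n hn
    · exact hmono m hm
  have hBsum : ∑' i, B i ≠ ⊤ := by
    simp only [B]
    rw [ENNReal.tsum_geometric]
    simp
  obtain ⟨g, hg, hglim⟩ := Lp.cauchy_complete_eLpNorm (by norm_num) hmem hBsum hcau
  refine ⟨hg.toLp g, fun i => φ (ns i), fun i => hφ _, hφv.comp hns.tendsto_atTop, ?_⟩
  refine hglim.congr fun i => eLpNorm_congr_ae ?_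
  filter_upwards [hg.coeFn_toLp] with x hx
  rw [hx, Pi.sub_apply]

theorem lintegral_lintegral_le_two_mul_add {X : Type*} [MeasurableSpace X] {μ : Measure X}
    [SFinite μ] {k a b : X → X → ℝ≥0∞} (ha : Measurable (Function.uncurry a))
    (h : ∀ᵐ x ∂μ, ∀ᵐ y ∂μ, k x y ≤ 2 * a x y + 2 * b x y) :
    ∫⁻ x, ∫⁻ y, k x y ∂μ ∂μ ≤
      2 * (∫⁻ x, ∫⁻ y, a x y ∂μ ∂μ) + 2 * ∫⁻ x, ∫⁻ y, b x y ∂μ ∂μ := by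
  have h2 : (2 : ℝ≥0∞) ≠ ⊤ := by simp
  have m1 : ∀ x, Measurable fun y => 2 * a x y := fun x => ha.of_uncurry_left.const_mul 2
  have m2 : Measurable fun x => 2 * ∫⁻ y, a x y ∂μ :=
    Measurable.const_mul ha.lintegral_prod_right' 2
  calc ∫⁻ x, ∫⁻ y, k x y ∂μ ∂μ ≤ ∫⁻ x, ∫⁻ y, (2 * a x y + 2 * b x y) ∂μ ∂μ :=
        lintegral_mono_ae (h.mono fun x hx => lintegral_mono_ae hx)
    _ = ∫⁻ x, (2 * (∫⁻ y, a x y ∂μ) + 2 * ∫⁻ y, b x y ∂μ) ∂μ := by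
        refine lintegral_congr fun x => ?_
        rw [lintegral_add_left (m1 x), lintegral_const_mul' _ _ h2, lintegral_const_mul' _ _ h2]
    _ = _ := by
        rw [lintegral_add_left m2, lintegral_const_mul' _ _ h2, lintegral_const_mul' _ _ h2]

theorem measurable_quotient {g : E d → E d} (hg : Measurable g) :
    Measurable (Function.uncurry fun x y => ‖g x - g y‖ₑ ^ 2 / edist x y ^ d) := by
  have h1 : Measurable fun p : E d × E d => g p.1 - g p.2 :=
    (hg.comp measurable_fst).sub (hg.comp measurable_snd)
  exact (h1.enorm.pow_const 2).div ((measurable_fst.edist measurable_snd).pow_const d)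

theorem eBdryNorm_half_sub_sq_le (hd : 2 ≤ d) (hΩ : IsPolyhedralDomain Ω) (a b : L2bdry Ω) :
    eBdryNorm (1 / 2) Ω (a - b) ^ 2 ≤
      2 * eBdryNorm (1 / 2) Ω a ^ 2 + 2 * eBdryNorm (1 / 2) Ω b ^ 2 := by
  have := hΩ.isFiniteMeasure_surfaceMeasure hd
  have hsub : ∀ u v : E d, ‖u - v‖ₑ ^ 2 ≤ 2 * ‖u‖ₑ ^ 2 + 2 * ‖v‖ₑ ^ 2 := fun u v => by
    rw [← mul_add]
    exact (pow_le_pow_left' enorm_sub_le 2).trans (ennreal_add_sq_le _ _)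
  have ma := (Lp.stronglyMeasurable a).measurable
  have hab := Lp.coeFn_sub a b
  have h1 : ∫⁻ x, ‖(a - b : L2bdry Ω) x‖ₑ ^ 2 ∂(surfaceMeasure Ω) ≤
      2 * (∫⁻ x, ‖a x‖ₑ ^ 2 ∂(surfaceMeasure Ω)) + 2 * ∫⁻ x, ‖b x‖ₑ ^ 2 ∂(surfaceMeasure Ω) := by
    rw [← lintegral_const_mul' 2 _ (by simp), ← lintegral_const_mul' 2 _ (by simp),
      ← lintegral_add_left (by fun_prop)]
    refine lintegral_mono_ae (hab.mono fun x hx => ?_)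
    rw [hx]
    exact hsub _ _
  have h2 := lintegral_lintegral_le_two_mul_add (μ := surfaceMeasure Ω)
    (k := fun x y => ‖(a - b : L2bdry Ω) x - (a - b : L2bdry Ω) y‖ₑ ^ 2 / edist x y ^ d)
    (b := fun x y => ‖b x - b y‖ₑ ^ 2 / edist x y ^ d) (measurable_quotient ma) (by
      refine hab.mono fun x hx => hab.mono fun y hy => ?_
      rw [hx, hy, Pi.sub_apply, Pi.sub_apply, sub_sub_sub_comm, ← mul_div_assoc, ← mul_div_assoc,
        ← ENNReal.add_div]
      exact ENNReal.div_le_div_right (hsub _ _) _)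
  rw [eBdryNorm_half_sq (by omega), eBdryNorm_half_sq (by omega), eBdryNorm_half_sq (by omega)]
  refine (add_le_add h1 h2).trans (le_of_eq ?_)
  ring

end Trace

/-! ### From the abstract estimate to the Stokes problem -/

section ErrorEstimate

variable {d : ℕ} {Ω : Set (E d)}

/-- Finiteness of both norms is essential, since `toReal` sends ∞ to 0. The factor 2 comes from 2a²
+ 2b² ≤ (2(a + b))² and is harmless. -/
theorem hHalfNorm_sub_le (hd : 2 ≤ d) (hΩ : IsPolyhedralDomain Ω) {a b : L2bdry Ω}
    (ha : eBdryNorm (1 / 2) Ω a < ⊤) (hb : eBdryNorm (1 / 2) Ω b < ⊤) :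
    hHalfNorm Ω (a - b) ≤ 2 * (hHalfNorm Ω a + hHalfNorm Ω b) := by
  have ha2 : 2 * eBdryNorm (1 / 2) Ω a ^ 2 ≠ ⊤ :=
    ENNReal.mul_ne_top (by simp) (ENNReal.pow_ne_top ha.ne)
  have hb2 : 2 * eBdryNorm (1 / 2) Ω b ^ 2 ≠ ⊤ :=
    ENNReal.mul_ne_top (by simp) (ENNReal.pow_ne_top hb.ne)
  have h := ENNReal.toReal_mono (ENNReal.add_ne_top.2 ⟨ha2, hb2⟩)
    (eBdryNorm_half_sub_sq_le hd hΩ a b)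
  rw [ENNReal.toReal_add ha2 hb2] at h
  simp only [ENNReal.toReal_mul, ENNReal.toReal_pow, ENNReal.toReal_ofNat] at h
  change hHalfNorm Ω (a - b) ^ 2 ≤ 2 * hHalfNorm Ω a ^ 2 + 2 * hHalfNorm Ω b ^ 2 at h
  have h1 : 0 ≤ hHalfNorm Ω a := ENNReal.toReal_nonneg
  have h2 : 0 ≤ hHalfNorm Ω b := ENNReal.toReal_nonneg
  refine le_of_sq_le_sq (h.trans ?_) (by positivity)
  nlinarith [mul_nonneg h1 h2, sq_nonneg (hHalfNorm Ω a), sq_nonneg (hHalfNorm Ω b)]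

theorem IsPolyhedralDomain.exists_trace_const (hd : 2 ≤ d) (hΩ : IsPolyhedralDomain Ω) :
    ∃ C : ℝ, 0 ≤ C ∧ ∀ (v : L2vec Ω) (g : L2bdry Ω), MemSobolev 1 Ω v → IsTrace Ω v g →
      eBdryNorm (1 / 2) Ω g < ⊤ ∧ hHalfNorm Ω g ≤ C * sobolevNorm 1 Ω v := by
  obtain ⟨C, hC, hb⟩ := hΩ.exists_trace_bound hd
  -- C + 1 dominates √C, which avoids a square root.
  refine ⟨C.toReal + 1, by positivity, fun v g hv hg => ?_⟩
  have h := hb v g hg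
  have htop : C * eSobolevNorm 1 Ω v ^ 2 ≠ ⊤ := ENNReal.mul_ne_top hC (ENNReal.pow_ne_top hv.ne)
  have hfin : eBdryNorm (1 / 2) Ω g < ⊤ := by
    by_contra hc
    rw [not_lt, top_le_iff] at hc
    rw [hc] at h
    exact htop (top_le_iff.1 (by simpa using h))
  refine ⟨hfin, ?_⟩
  have h2 := ENNReal.toReal_mono htop h
  simp only [ENNReal.toReal_mul, ENNReal.toReal_pow] at h2
  change hHalfNorm Ω g ^ 2 ≤ C.toReal * sobolevNorm 1 Ω v ^ 2 at h2
  have h3 : 0 ≤ sobolevNorm 1 Ω v := ENNReal.toReal_nonneg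
  have h4 : 0 ≤ C.toReal := ENNReal.toReal_nonneg
  refine le_of_sq_le_sq (h2.trans ?_) (by positivity)
  rw [mul_pow]
  gcongr
  nlinarith

theorem hHalfNorm_zero (hd : 1 ≤ d) : hHalfNorm Ω (0 : L2bdry Ω) = 0 := by
  have h := Lp.coeFn_zero (E d) 2 (surfaceMeasure Ω)
  have h1 : ∫⁻ x, ‖(0 : L2bdry Ω) x‖ₑ ^ 2 ∂(surfaceMeasure Ω) = 0 := by
    rw [lintegral_congr_ae (g := 0) (h.mono fun x hx => by rw [hx]; simp)]
    simp
  have h2 : ∫⁻ x, ∫⁻ y, ‖(0 : L2bdry Ω) x - (0 : L2bdry Ω) y‖ₑ ^ 2 / edist x y ^ d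
      ∂(surfaceMeasure Ω) ∂(surfaceMeasure Ω) = 0 := by
    have e : ∀ᵐ x ∂(surfaceMeasure Ω), ∫⁻ y, ‖(0 : L2bdry Ω) x - (0 : L2bdry Ω) y‖ₑ ^ 2 /
        edist x y ^ d ∂(surfaceMeasure Ω) = 0 := h.mono fun x hx => by
      rw [lintegral_congr_ae (g := 0) (h.mono fun y hy => by rw [hx, hy]; simp)]
      simp
    rw [lintegral_congr_ae (g := 0) e]
    simp
  have h3 := eBdryNorm_half_sq hd (0 : L2bdry Ω)
  rw [h1, h2, add_zero, pow_eq_zero_iff two_ne_zero] at h3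
  rw [hHalfNorm, h3, ENNReal.toReal_zero]

/-- `Y_{0h}` as a subspace of `H¹(Ω)^d`. -/
def Y0hSubmodule (hΩ : IsOpen Ω) (Yh : Submodule ℝ (L2vec Ω)) : Submodule ℝ (H1 hΩ) where
  carrier := {v | v.1 ∈ Y0h Ω Yh}
  add_mem' := fun ha hb => ⟨Yh.add_mem ha.1 hb.1, by simpa using ha.2.add hΩ hb.2⟩
  zero_mem' := ⟨Yh.zero_mem, isTrace_zero hΩ⟩
  smul_mem' := fun c _ hv => ⟨Yh.smul_mem c hv.1, by simpa using hv.2.const_smul hΩ c⟩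

theorem finiteDimensional_Y0hSubmodule (hΩ : IsOpen Ω) (Yh : Submodule ℝ (L2vec Ω))
    [FiniteDimensional ℝ Yh] : FiniteDimensional ℝ (Y0hSubmodule hΩ Yh) := by
  let f : Y0hSubmodule hΩ Yh →ₗ[ℝ] Yh := LinearMap.codRestrict Yh
    ((H1 hΩ).subtype.comp (Y0hSubmodule hΩ Yh).subtype) fun v => v.2.1
  refine Module.Finite.of_injective f fun v w h => ?_
  have h1 : (f v : L2vec Ω) = f w := congrArg Subtype.val h
  exact Subtype.ext (Subtype.ext h1)

/-- Any nonnegative bound for the quotients bounds the real supremum, even over an empty index set,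
where it is 0. Quotients with vanishing gradient norm are 0 by convention and do no harm. -/
theorem InfSup.abstractInfSup (hΩ : IsOpen Ω) {Yh : Submodule ℝ (L2vec Ω)}
    {Qh : Submodule ℝ (L2 Ω)} (hconf : IsConforming Ω Yh Qh) {α : ℝ} (h : InfSup Ω Yh Qh α) :
    AbstractInfSup (grad hΩ) (matTrace Ω) (Y0hSubmodule hΩ Yh) Qh α := by
  intro q hq b hb hv
  refine (h q hq).trans (Real.iSup_le (fun v => ?_) hb)
  have hw := hv ⟨v.1, hconf.mem_H1 _ v.2.1.1⟩ v.2.1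
  rw [← divInner_eq, ← gradNorm_eq] at hw
  exact div_le_of_le_mul₀ (Real.sqrt_nonneg _) hb hw

/-- p - qh has mean zero and is therefore orthogonal to the constant qt - qh. By Pythagoras,
dropping the constant can only reduce the error. -/
theorem norm_sub_le_of_mem_QhTilde (hΩ : IsPolyhedralDomain Ω) {p qh qt : L2 Ω}
    (hp : p ∈ L20 Ω) (hqh : qh ∈ L20 Ω) {c : ℝ}
    (hc : ∀ᵐ x ∂(volume.restrict Ω), qt x = qh x + c) : ‖p - qh‖ ≤ ‖p - qt‖ := by
  have : IsFiniteMeasure (volume.restrict Ω) :=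
    ⟨by simpa using hΩ.isBounded.measure_lt_top⟩
  have hint : ∀ q : L2 Ω, Integrable q (volume.restrict Ω) := fun q =>
    (Lp.memLp q).integrable (by norm_num)
  have hmean : ∫ x in Ω, (p - qh : L2 Ω) x = 0 := by
    rw [integral_congr_ae (Lp.coeFn_sub p qh)]
    simp only [Pi.sub_apply]
    rw [integral_sub (hint p) (hint qh), show ∫ x in Ω, p x = 0 from hp,
      show ∫ x in Ω, qh x = 0 from hqh, sub_zero]
  have horth : inner ℝ (p - qh) (qt - qh) = 0 := by
    rw [L2.inner_def, ← mul_zero c, ← hmean, ← integral_const_mul]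
    refine integral_congr_ae ?_
    filter_upwards [Lp.coeFn_sub qt qh, hc] with x h1 h2
    rw [h1, Pi.sub_apply, h2]
    simp
  have h := norm_sub_sq_real (p - qh) (qt - qh)
  rw [sub_sub_sub_cancel_right, horth] at h
  refine le_of_sq_le_sq ?_ (norm_nonneg _)
  rw [h]
  nlinarith [sq_nonneg ‖qt - qh‖]

/-- The error is bounded by the approximation errors of arbitrary elements of the discrete spaces
and the error of the boundary data. -/
theorem error_le_of_mem (hd : 2 ≤ d) (hΩ : IsPolyhedralDomain Ω) {α c₁ Ctr : ℝ} (hα : 0 < α)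
    (hc₁ : 0 < c₁)
    (htr : ∀ (v : L2vec Ω) (g : L2bdry Ω), MemSobolev 1 Ω v → IsTrace Ω v g →
      eBdryNorm (1 / 2) Ω g < ⊤ ∧ hHalfNorm Ω g ≤ Ctr * sobolevNorm 1 Ω v)
    {Yh : Submodule ℝ (L2vec Ω)} {Qh : Submodule ℝ (L2 Ω)} (hconf : IsConforming Ω Yh Qh)
    (hinf : InfSup Ω Yh Qh α) (hext : DiscreteExtension Ω Yh c₁) {u uh : L2bdry Ω}
    {y yh : L2vec Ω} {p ph : L2 Ω} (hs : IsWeakSolution Ω u y p)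
    (hsh : IsDiscreteSolution Ω Yh Qh uh yh ph) {vh : L2vec Ω} (hvh : vh ∈ Yh)
    {qt : L2 Ω} (hqt : qt ∈ QhTilde Ω Qh) :
    gradNorm Ω (y - yh) + ‖p - ph‖ ≤ energyConst α ‖matTrace Ω‖ *
      ((1 + 2 * c₁ * Ctr) * sobolevNorm 1 Ω (y - vh : L2vec Ω) +
        2 * c₁ * hHalfNorm Ω (u - uh) + ‖p - qt‖) := by
  have hΩo := hΩ.isOpen
  have := hconf.finite_Y
  have := hconf.finite_Q
  have := finiteDimensional_Y0hSubmodule hΩo Yh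
  have hK : 0 < energyConst α ‖matTrace Ω‖ := energyConst_pos hα (norm_nonneg _)
  set K := energyConst α ‖matTrace Ω‖
  obtain ⟨qh, hqh, c, hqc⟩ := hqt
  have hpq := norm_sub_le_of_mem_QhTilde hΩ hs.mem_Q (hconf.mem_Q qh hqh) hqc
  let yH : H1 hΩo := ⟨y, hs.mem_H1⟩
  let yhH : H1 hΩo := ⟨yh, hconf.mem_H1 _ hsh.mem_Y⟩
  let vhH : H1 hΩo := ⟨vh, hconf.mem_H1 _ hvh⟩
  -- The difference of u - gh, the trace of y - vh, and u - uh is uh - gh, the boundary defect of vh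
  -- that has to be extended into Ω.
  obtain ⟨gh, hgh⟩ := hΩ.exists_isTrace hd (hconf.mem_H1 _ hvh)
  have hfin1 := htr (y - vh) (u - gh) (yH - vhH).2 (hs.trace.sub hΩo hgh)
  have hfin2 := htr (y - yh) (u - uh) (yH - yhH).2 (hs.trace.sub hΩo hsh.trace)
  have hg : hHalfNorm Ω (uh - gh) ≤ 2 * (Ctr * sobolevNorm 1 Ω (y - vh : L2vec Ω) +
      hHalfNorm Ω (u - uh)) := by
    have h := hHalfNorm_sub_le hd hΩ hfin1.1 hfin2.1
    rw [sub_sub_sub_cancel_left] at h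
    refine h.trans ?_
    have := hfin1.2
    gcongr
  have hmemg : uh - gh ∈ YhBdry Ω Yh :=
    ⟨yh - vh, Yh.sub_mem hsh.mem_Y hvh, hsh.trace.sub hΩo hgh⟩
  have hne : Nonempty {φ // φ ∈ Yh ∧ IsTrace Ω φ (uh - gh)} :=
    ⟨⟨yh - vh, Yh.sub_mem hsh.mem_Y hvh, hsh.trace.sub hΩo hgh⟩⟩
  refine le_of_forall_pos_le_add fun ε hε => ?_
  -- The infimum in the extension property is approached up to ε/K, so that after multiplication by
  -- K the final estimate is off by only ε.
  obtain ⟨⟨φ, hφ, hφt⟩, hφn⟩ := exists_lt_of_ciInf_lt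
    (lt_of_le_of_lt (hext _ hmemg) (lt_add_of_pos_right _ (div_pos hε hK)))
  let φH : H1 hΩo := ⟨φ, hconf.mem_H1 _ hφ⟩
  have hZ : vhH + φH - yhH ∈ Y0hSubmodule hΩo Yh := by
    refine ⟨Yh.sub_mem (Yh.add_mem hvh hφ) hsh.mem_Y, ?_⟩
    have h := (hgh.add hΩo hφt).sub hΩo hsh.trace
    rwa [add_sub_cancel, sub_self] at h
  have hest := (hinf.abstractInfSup hΩo hconf).energy_estimate (y := yH) (p := p) hα hZ hsh.mem_Q
    hqh (fun q hq => by rw [← divInner_eq]; exact hs.continuity q (hconf.mem_Q q hq))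
    (fun q hq => by rw [← divInner_eq]; exact hsh.continuity q hq)
    (fun v hv => by
      rw [← divInner_eq, ← gradInner_eq]
      exact sub_eq_zero.1 (hs.momentum v.1 ⟨v.2, hv.2⟩))
    (fun v hv => by
      rw [← divInner_eq, ← gradInner_eq]
      exact sub_eq_zero.1 (hsh.momentum v.1 hv))
  rw [← gradNorm_eq, ← gradNorm_eq, ← gradNorm_eq] at hest
  have h1 : gradNorm Ω (yH - vhH : H1 hΩo) ≤ sobolevNorm 1 Ω (y - vh : L2vec Ω) :=
    gradNorm_le_sobolevNorm hΩo (yH - vhH)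
  set S := sobolevNorm 1 Ω (y - vh : L2vec Ω)
  have h2 : gradNorm Ω φ ≤ c₁ * (2 * (Ctr * S + hHalfNorm Ω (u - uh))) + ε / K := by
    refine hφn.le.trans ?_
    gcongr
  calc gradNorm Ω (y - yh) + ‖p - ph‖
      ≤ K * (gradNorm Ω (yH - vhH : H1 hΩo) + gradNorm Ω φ + ‖p - qh‖) := hest
    _ ≤ K * (S + (c₁ * (2 * (Ctr * S + hHalfNorm Ω (u - uh))) + ε / K) + ‖p - qt‖) := by gcongr
    _ = _ := by
      field_simp
      ring

/-- Near-minimizers suffice: elements within ε of the bounds a and b are inserted, and ε tends to 0.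
-/
theorem error_le (hd : 2 ≤ d) (hΩ : IsPolyhedralDomain Ω) {α c₁ Ctr : ℝ} (hα : 0 < α)
    (hc₁ : 0 < c₁) (hCtr : 0 ≤ Ctr)
    (htr : ∀ (v : L2vec Ω) (g : L2bdry Ω), MemSobolev 1 Ω v → IsTrace Ω v g →
      eBdryNorm (1 / 2) Ω g < ⊤ ∧ hHalfNorm Ω g ≤ Ctr * sobolevNorm 1 Ω v)
    {Yh : Submodule ℝ (L2vec Ω)} {Qh : Submodule ℝ (L2 Ω)} (hconf : IsConforming Ω Yh Qh)
    (hinf : InfSup Ω Yh Qh α) (hext : DiscreteExtension Ω Yh c₁) {u uh : L2bdry Ω}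
    {y yh : L2vec Ω} {p ph : L2 Ω} (hs : IsWeakSolution Ω u y p)
    (hsh : IsDiscreteSolution Ω Yh Qh uh yh ph) {a b : ℝ}
    (ha : ⨅ vh : Yh, sobolevNorm 1 Ω (y - vh.1 : L2vec Ω) ≤ a)
    (hb : ⨅ qh : QhTilde Ω Qh, ‖p - qh.1‖ ≤ b) :
    gradNorm Ω (y - yh) + ‖p - ph‖ ≤ energyConst α ‖matTrace Ω‖ *
      ((1 + 2 * c₁ * Ctr) * a + 2 * c₁ * hHalfNorm Ω (u - uh) + b) := by
  have hK : 0 < energyConst α ‖matTrace Ω‖ := energyConst_pos hα (norm_nonneg _)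
  have hne : Nonempty (QhTilde Ω Qh) :=
    ⟨⟨0, 0, Qh.zero_mem, 0, Eventually.of_forall fun x => by simp⟩⟩
  have hlim : Tendsto (fun ε : ℝ => energyConst α ‖matTrace Ω‖ *
      ((1 + 2 * c₁ * Ctr) * (a + ε) + 2 * c₁ * hHalfNorm Ω (u - uh) + (b + ε))) (𝓝[>] 0)
      (𝓝 (energyConst α ‖matTrace Ω‖ *
      ((1 + 2 * c₁ * Ctr) * (a + 0) + 2 * c₁ * hHalfNorm Ω (u - uh) + (b + 0)))) := by
    refine Tendsto.mono_left (Continuous.tendsto ?_ 0) nhdsWithin_le_nhds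
    fun_prop
  rw [add_zero, add_zero] at hlim
  refine ge_of_tendsto hlim ?_
  filter_upwards [self_mem_nhdsWithin] with ε hε
  have hε0 : 0 < ε := hε
  obtain ⟨⟨vh, hvh⟩, hv⟩ := exists_lt_of_ciInf_lt (ha.trans_lt (lt_add_of_pos_right a hε0))
  obtain ⟨⟨qt, hqt⟩, hq⟩ := exists_lt_of_ciInf_lt (hb.trans_lt (lt_add_of_pos_right b hε0))
  refine (error_le_of_mem hd hΩ hα hc₁ htr hconf hinf hext hs hsh hvh hqt).trans ?_
  have h1 : 0 ≤ 1 + 2 * c₁ * Ctr := by positivity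
  gcongr

end ErrorEstimate

end Stokes

end

/-! ### The error estimates -/

theorem mainTheorem2 {d : ℕ} (hd : d = 2 ∨ d = 3) (Ω : Set (Stokes.E d))
    (hΩ : Stokes.IsPolyhedralDomain Ω)
    (k : ℕ) (t : ℝ) (ht : 1 / 2 ≤ t)
    (α c₁ c₂ : ℝ) (hα : 0 < α) (hc₁ : 0 < c₁) (cA : ℝ → ℝ) :
    ∃ C : ℝ, 0 < C ∧
      ∀ (h : ℝ) (Yh : Submodule ℝ (Stokes.L2vec Ω)) (Qh : Submodule ℝ (Stokes.L2 Ω)),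
        0 < h →
        Stokes.IsConforming Ω Yh Qh →
        Stokes.InfSup Ω Yh Qh α →
        Stokes.ApproxProperty Ω Yh Qh h k cA →
        Stokes.DiscreteExtension Ω Yh c₁ →
        ∀ (u uh : Stokes.L2bdry Ω) (y yh : Stokes.L2vec Ω) (p ph : Stokes.L2 Ω),
          Stokes.IsWeakSolution Ω u y p →
          Stokes.IsDiscreteSolution Ω Yh Qh uh yh ph →
          Stokes.MemSobolev (t + 1 / 2) Ω y →
          Stokes.MemSobolev (t - 1 / 2) Ω p →
          Stokes.MemHTilde t Ω u →
          (Stokes.hHalfNorm Ω (u - uh) ≤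
              c₂ * h ^ min (t - 1 / 2) (k : ℝ) * Stokes.hTildeNorm t Ω u →
            Stokes.gradNorm Ω (y - yh) + ‖p - ph‖ ≤
              C * h ^ min (t - 1 / 2) (k : ℝ) *
                (Stokes.sobolevNorm (t + 1 / 2) Ω y + Stokes.sobolevNorm (t - 1 / 2) Ω p
                  + Stokes.hTildeNorm t Ω u)) ∧
          (u = uh →
            Stokes.gradNorm Ω (y - yh) + ‖p - ph‖ ≤
              C * h ^ min (t - 1 / 2) (k : ℝ) *
                (Stokes.sobolevNorm (t + 1 / 2) Ω y + Stokes.sobolevNorm (t - 1 / 2) Ω p)) := by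
  have hd2 : 2 ≤ d := by omega
  obtain ⟨Ctr, hCtr, htr⟩ := hΩ.exists_trace_const hd2
  have hK : 0 < Stokes.energyConst α ‖Stokes.matTrace Ω‖ :=
    Stokes.energyConst_pos hα (norm_nonneg _)
  set K := Stokes.energyConst α ‖Stokes.matTrace Ω‖
  set A := |cA (t - 1 / 2)|
  set B := 1 + 2 * c₁ * Ctr
  have hA : 0 ≤ A := abs_nonneg _
  have hB : 0 < B := by positivity
  -- The sum of the coefficients of the velocity, boundary and pressure terms, so one constant
  -- serves all three norms. The 1 ensures positivity, and absolute values are taken because `cA`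
  -- and `c₂` carry no sign condition.
  refine ⟨K * (B * A + 2 * c₁ * |c₂| + A + 1), by positivity, ?_⟩
  intro h Yh Qh hh hconf hinf happ hext u uh y yh p ph hs hsh hy hp _
  have hm : 0 < h ^ min (t - 1 / 2) (k : ℝ) := Real.rpow_pos_of_pos hh _
  -- The index r = t - 1/2 matches both regularities at once: r + 1 = t + 1/2 for the velocity and r
  -- for the pressure.
  obtain ⟨hay, haq⟩ := happ (t - 1 / 2) (by linarith)
  rw [min_comm, show t - 1 / 2 + 1 = t + 1 / 2 by ring] at hay
  rw [min_comm] at haq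
  set m := h ^ min (t - 1 / 2) (k : ℝ)
  set Ny := Stokes.sobolevNorm (t + 1 / 2) Ω y
  set Np := Stokes.sobolevNorm (t - 1 / 2) Ω p
  set Nu := Stokes.hTildeNorm t Ω u
  have hNy : 0 ≤ Ny := ENNReal.toReal_nonneg
  have hNp : 0 ≤ Np := ENNReal.toReal_nonneg
  have hNu : 0 ≤ Nu := ENNReal.toReal_nonneg
  have hcA : cA (t - 1 / 2) ≤ A := le_abs_self _
  have ha : ⨅ vh : Yh, Stokes.sobolevNorm 1 Ω (y - vh.1 : Stokes.L2vec Ω) ≤ A * m * Ny :=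
    (hay y hy).trans (by gcongr)
  have hb : ⨅ qh : Stokes.QhTilde Ω Qh, ‖p - qh.1‖ ≤ A * m * Np :=
    (haq p hp).trans (by gcongr)
  have hmain := Stokes.error_le hd2 hΩ hα hc₁ hCtr htr hconf hinf hext hs hsh ha hb
  constructor
  · intro hu
    refine hmain.trans ?_
    have hu' : Stokes.hHalfNorm Ω (u - uh) ≤ |c₂| * m * Nu :=
      hu.trans (by gcongr; exact le_abs_self _)
    calc K * (B * (A * m * Ny) + 2 * c₁ * Stokes.hHalfNorm Ω (u - uh) + A * m * Np)
        ≤ K * (B * (A * m * Ny) + 2 * c₁ * (|c₂| * m * Nu) + A * m * Np) := by gcongr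
      -- The added nonnegative terms are exactly what each norm lacks to carry the full constant, so
      -- that the last step is an identity.
      _ ≤ K * (B * (A * m * Ny) + 2 * c₁ * (|c₂| * m * Nu) + A * m * Np) +
          K * m * ((2 * c₁ * |c₂| + A + 1) * Ny + (B * A + A + 1) * Nu +
            (B * A + 2 * c₁ * |c₂| + 1) * Np) := le_add_of_nonneg_right (by positivity)
      _ = _ := by ring
  · intro hu
    refine hmain.trans ?_
    rw [hu, sub_self, Stokes.hHalfNorm_zero (by omega)]
    calc K * (B * (A * m * Ny) + 2 * c₁ * 0 + A * m * Np)
        ≤ K * (B * (A * m * Ny) + 2 * c₁ * 0 + A * m * Np) +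
          K * m * ((2 * c₁ * |c₂| + A + 1) * Ny +
            (B * A + 2 * c₁ * |c₂| + 1) * Np) := le_add_of_nonneg_right (by positivity)
      _ = _ := by ring
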